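/- Let $\Omega\subset\mathbb C^n$ be a bounded domain with Bergman kernel $K(z,w)$, the reproducing kernel of the space $A^2(\Omega)$ of square integrable holomorphic functions on $\Omega$ with respect to Lebesgue measure $dV$. Put $P(z,\xi)=|K(z,\xi)|^2/K(z,z)$, $l(z,\xi)=\log P(z,\xi)$ and $$D(z,w)=\log\frac{K(z,z)K(w,w)}{|K(z,w)|^2}\in[0,+\infty],$$ with the value $+\infty$ where $K(z,w)=0$. Let $g_{\alpha\bar\beta}(z)=\frac{\partial^2\log K(z,z)}{\partial z_\alpha\,\partial\bar z_\beta}$ be the components of the Bergman metric, and let $g_B(z)$ be its matrix, written so that $v^{\mathsf H}g_B(z)\,v=\sum_{\alpha,\beta}g_{\alpha\bar\beta}(z)\,v_\alpha\bar v_\beta$ for $v\in\mathbb C^n$. Write $\partial_\alpha=\partial/\partial z_\alpha$ for the derivative in the first variable and assume that $$(\partial_\alpha l)(z,\cdot)\,(\partial_\beta l)(z,\cdot)\,(\partial_\gamma l)(z,\cdot)\,K(\cdot,z)\in L^2(\Omega,dV)$$ for every $z\in\Omega$ and all $1\le\alpha,\beta,\gamma\le n$. Let $z_0\in\Omega$ and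 let $Z_1,Z_2,\dots$ be independent random vectors on a probability space, each with distribution $P(z_0,\xi)\,dV(\xi)$ on $\Omega$. Then there are $\Omega$-valued random vectors $\hat z_m$, $m\ge 0$, on the same probability space such that, with probability tending to $1$ as $m\to\infty$, $\hat z_m$ is a local minimizer of $z\mapsto\sum_{i=1}^m D(z,Z_i)$ on $\Omega$, and $$\sqrt m\,(\hat z_m-z_0)\ \longrightarrow\ \mathcal N_{\mathbb C}\bigl(0,\,g_B(z_0)^{-1},\,0\bigr)\quad\text{in distribution (weakly) as } m\to\infty .$$ Here $\mathcal N_{\mathbb C}(0,\Gamma,0)$ is the complex normal distribution on $\mathbb C^n$, i.e. the probability measure with density $\frac{1}{\pi^n\det\Gamma}\exp(-z^{\mathsf H}\Gamma^{-1}z)$. -/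

import Mathlib

open MeasureTheory ProbabilityTheory Filter
open scoped Topology ENNReal ComplexConjugate Matrix

noncomputable section

/-- `f` belongs to the Bergman space `A²(Ω)`: it is holomorphic on `Ω` and square integrable on `Ω`
with respect to Lebesgue measure. -/
def MemBergmanSpace {n : ℕ} (Ω : Set (Fin n → ℂ)) (f : (Fin n → ℂ) → ℂ) : Prop :=
  DifferentiableOn ℂ f Ω ∧ MemLp f 2 (volume.restrict Ω)

/-- `k` represents the evaluation at `w` on `A²(Ω)`: it lies in `A²(Ω)` and `f w = ⟨f, k⟩` for every
`f` in `A²(Ω)`. -/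
def RepresentsEval {n : ℕ} (Ω : Set (Fin n → ℂ)) (w : Fin n → ℂ) (k : (Fin n → ℂ) → ℂ) : Prop :=
  MemBergmanSpace Ω k ∧
    ∀ f : (Fin n → ℂ) → ℂ, MemBergmanSpace Ω f → f w = ∫ ξ in Ω, f ξ * conj (k ξ)

open Classical in
/-- The Bergman kernel `K(z, w)`, the reproducing kernel of `A²(Ω)`: `K(·, w)` is the element of
`A²(Ω)` that represents the evaluation at `w`. For `Ω` open and `w ∈ Ω` evaluation at `w` is a
bounded functional, so that such an element exists, and it is unique as a function on `Ω`. -/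
def bergmanKernel {n : ℕ} (Ω : Set (Fin n → ℂ)) (z w : Fin n → ℂ) : ℂ :=
  if h : ∃ k : (Fin n → ℂ) → ℂ, RepresentsEval Ω w k then Classical.choose h z else 0

/-- The Wirtinger derivative `∂f/∂z_α = (∂f/∂x_α - i ∂f/∂y_α) / 2`. -/
def wirtinger {n : ℕ} (α : Fin n) (f : (Fin n → ℂ) → ℂ) (z : Fin n → ℂ) : ℂ :=
  (fderiv ℝ f z (Pi.single α 1) - Complex.I * fderiv ℝ f z (Pi.single α Complex.I)) / 2

/-- The conjugate Wirtinger derivative `∂f/∂z̄_α = (∂f/∂x_α + i ∂f/∂y_α) / 2`. -/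
def wirtingerBar {n : ℕ} (α : Fin n) (f : (Fin n → ℂ) → ℂ) (z : Fin n → ℂ) : ℂ :=
  (fderiv ℝ f z (Pi.single α 1) + Complex.I * fderiv ℝ f z (Pi.single α Complex.I)) / 2

/-- The matrix of the Bergman metric `g_{αβ̄} = ∂² log K(z, z) / ∂z_α ∂z̄_β`. The column index is the
holomorphic index `α` and the row index is the antiholomorphic index `β`, so that
`vᴴ g v = ∑_{α,β} g_{αβ̄} v_α v̄_β` is the squared Bergman length of `v`. -/
def bergmanMetric {n : ℕ} (Ω : Set (Fin n → ℂ)) (z : Fin n → ℂ) : Matrix (Fin n) (Fin n) ℂ :=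
  Matrix.of fun β α =>
    wirtinger α (wirtingerBar β fun ζ => (Real.log (bergmanKernel Ω ζ ζ).re : ℂ)) z

/-- The Poisson-Bergman kernel `P(z, ξ) = |K(z, ξ)|² / K(z, z)`. -/
def poissonBergmanKernel {n : ℕ} (Ω : Set (Fin n → ℂ)) (z ξ : Fin n → ℂ) : ℝ :=
  ‖bergmanKernel Ω z ξ‖ ^ 2 / (bergmanKernel Ω z z).re

/-- The measure `P(z, ξ) dV(ξ)` on `Ω`. -/
def poissonBergmanMeasure {n : ℕ} (Ω : Set (Fin n → ℂ)) (z : Fin n → ℂ) : Measure (Fin n → ℂ) :=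
  (volume.restrict Ω).withDensity fun ξ => ENNReal.ofReal (poissonBergmanKernel Ω z ξ)

/-- `∂_α l (z, ξ)`, where `l(z, ξ) = log P(z, ξ)` and the derivative is taken in `z`. -/
def score {n : ℕ} (Ω : Set (Fin n → ℂ)) (α : Fin n) (z ξ : Fin n → ℂ) : ℂ :=
  wirtinger α (fun ζ => (Real.log (poissonBergmanKernel Ω ζ ξ) : ℂ)) z

/-- The diastasis `D(z, w) = log (K(z, z) K(w, w) / |K(z, w)|²)` of the Bergman metric. It has the
value `+∞` where `K(z, w) = 0`. -/
def diastasis {n : ℕ} (Ω : Set (Fin n → ℂ)) (z w : Fin n → ℂ) : EReal :=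
  ENNReal.log (ENNReal.ofReal ((bergmanKernel Ω z z).re * (bergmanKernel Ω w w).re) /
    ENNReal.ofReal (‖bergmanKernel Ω z w‖ ^ 2))

/-- The complex normal distribution `𝒩_ℂ(μ, Γ, 0)` on `ℂⁿ`, for a positive definite matrix `Γ`: the
measure with density `exp (-(z - μ)ᴴ Γ⁻¹ (z - μ)) / (πⁿ det Γ)`. -/
def complexNormal {n : ℕ} (μ : Fin n → ℂ) (Γ : Matrix (Fin n) (Fin n) ℂ) : Measure (Fin n → ℂ) :=
  volume.withDensity fun z =>
    ENNReal.ofReal (Real.exp (-(star (z - μ) ⬝ᵥ (Γ⁻¹ *ᵥ (z - μ))).re) / (Real.pi ^ n * Γ.det.re))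

end

/-! Put z = z₀ + v. Inserting K(z, z₀) into the diastasis gives D(z, ξ) = b(v) - 2 log|1 + a(v, ξ)|
+ κ(ξ), where 1 + a = K(z, ξ) K(z₀, z₀) / (K(z, z₀) K(z₀, ξ)), b(v) = D(z, z₀) and κ does not depend
on v (`KernelModel.diastasis_eq`). So the random part of the loss is the real part of the logarithm
of a function holomorphic in v, equal to 1 at v = 0.

Under the law P(z₀, ξ) dV(ξ), moments of such ratios are inner products in L². The reproducing
property gives E a(v) = 0 and centres the scores, that is, the derivatives of a at v = 0, which are
∂_α l. Their Hermitian covariance is the Gram matrix of the derivatives of K(z, ·) projected off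
K(z₀, ·), which is the Bergman metric g (`bergmanMetric_apply`). The same projection and Pythagoras
give b(v) = vᴴ g v + o(|v|²) (`normalized_expansion`).

The integrability hypothesis yields E[∂_α l ∂_β l] = 0 (`integral_tangentFun_mul`). Up to
conjugation this moment is a multiple of the value at z₀ of a quotient of holomorphic functions with
denominator K(·, z₀). The cubic bound makes the quotient square integrable, such a quotient is
holomorphic (`exists_extension_of_sq_integrable`), and its numerator vanishes at z₀.

The rest is a local analysis for an abstract `HolomorphicLossModel`. Expand log(1 + a) = a - a²/2 +
O(|a|³) at v = u/√m. The means of a tend to zero locally uniformly by the strong law and the Schwarz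
lemma, so the nonlinear part of Σ a is negligible; Σ a² is negligible because the holomorphic second
moments vanish; Σ |a|³ is negligible because a is dominated by a square integrable function
(`eventually_norm_sum_log_sub_le`). Hence the total loss is, up to a constant and o(1) uniformly on
bounded sets, uᴴ g u - 2 Re((g U)ᴴ u), with U = g⁻¹ Σ conj(score) / √m.

The quadratic form is minimized at U, which is asymptotically complex normal with covariance g⁻¹
(`tendstoInDistribution_linearEstimator`). A measurable minimizer of the loss over the unit ball
around U is eventually interior and within o(1) of U, so it is a local minimizer with the same limit
law. -/

set_option linter.unusedSectionVars false

/-! ### Schwarz-type estimates for bounded holomorphic maps. -/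

section HolomorphicEstimates

variable {E F : Type*} [NormedAddCommGroup E] [NormedSpace ℂ E] [NormedAddCommGroup F]
  [NormedSpace ℂ F] {f : E → F} {c z : E} {R M : ℝ}

/-- The factor 2 recentres the target ball at `f c`, the form in which the Schwarz lemma applies. -/
theorem mapsTo_closedBall_of_norm_le (hM : ∀ z ∈ Metric.ball c R, ‖f z‖ ≤ M) (hR : 0 < R) :
    Set.MapsTo f (Metric.ball c R) (Metric.closedBall (f c) (2 * M)) := by
  intro z hz
  rw [mem_closedBall_iff_norm]
  linarith [norm_sub_le (f z) (f c), hM z hz, hM c (Metric.mem_ball_self hR)]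

theorem norm_sub_le_of_norm_le (hd : DifferentiableOn ℂ f (Metric.ball c R))
    (hM : ∀ z ∈ Metric.ball c R, ‖f z‖ ≤ M) (hz : z ∈ Metric.ball c R) :
    ‖f z - f c‖ ≤ 2 * M / R * ‖z - c‖ := by
  have hR : 0 < R := Metric.nonempty_ball.1 ⟨z, hz⟩
  simpa [dist_eq_norm] using Complex.dist_le_div_mul_dist_of_mapsTo_ball hd
    (mapsTo_closedBall_of_norm_le hM hR) hz

theorem norm_fderiv_le_of_norm_le (hd : DifferentiableOn ℂ f (Metric.ball c R))
    (hM : ∀ z ∈ Metric.ball c R, ‖f z‖ ≤ M) (hR : 0 < R) :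
    ‖fderiv ℂ f c‖ ≤ 2 * M / R :=
  Complex.norm_fderiv_le_div_of_mapsTo_ball hd (mapsTo_closedBall_of_norm_le hM hR) hR

/-- Second order remainder estimate for a bounded holomorphic map. -/
theorem norm_sub_sub_fderiv_le (hd : DifferentiableOn ℂ f (Metric.ball c R))
    (hM : ∀ z ∈ Metric.ball c R, ‖f z‖ ≤ M) (hz : z ∈ Metric.ball c R) :
    ‖f z - f c - fderiv ℂ f c (z - c)‖ ≤ 4 * M * (‖z - c‖ / R) ^ 2 := by
  have hR : 0 < R := Metric.nonempty_ball.1 ⟨z, hz⟩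
  have hM0 : 0 ≤ M := (norm_nonneg _).trans (hM c (Metric.mem_ball_self hR))
  set g : E → F := fun z => f z - f c - fderiv ℂ f c (z - c) with hg
  have hgc : g c = 0 := by simp [hg]
  have hgd : DifferentiableOn ℂ g (Metric.ball c R) :=
    (hd.sub_const _).sub
      ((fderiv ℂ f c).differentiable.comp (differentiable_id.sub_const c)).differentiableOn
  have hmaps : Set.MapsTo g (Metric.ball c R) (Metric.closedBall (g c) (4 * M)) := by
    intro w hw
    rw [hgc, mem_closedBall_zero_iff]
    have h1 := norm_fderiv_le_of_norm_le hd hM hR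
    have h2 : ‖fderiv ℂ f c (w - c)‖ ≤ 2 * M := by
      calc ‖fderiv ℂ f c (w - c)‖ ≤ ‖fderiv ℂ f c‖ * ‖w - c‖ := (fderiv ℂ f c).le_opNorm _
        _ ≤ 2 * M / R * R := by
          gcongr
          exact (mem_ball_iff_norm.1 hw).le
        _ = 2 * M := by field_simp
    calc ‖g w‖ ≤ ‖f w‖ + ‖f c‖ + ‖fderiv ℂ f c (w - c)‖ :=
          (norm_sub_le _ _).trans (by gcongr; exact norm_sub_le _ _)
      _ ≤ M + M + 2 * M := by
        gcongr
        exacts [hM w hw, hM c (Metric.mem_ball_self hR)]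
      _ = 4 * M := by ring
  -- Removing the first order Taylor polynomial makes `g` vanish to second order at `c`; the higher
  -- order Schwarz lemma turns this and the bound M + M + 2M into quadratic decay.
  have hlo : (fun w => g w - g c) =o[𝓝 c] fun w => ‖w - c‖ ^ 1 := by
    have := (hd.differentiableAt (Metric.ball_mem_nhds c hR)).hasFDerivAt.isLittleO
    simpa [hgc, hg] using this.norm_right
  have := Complex.dist_le_mul_div_pow_of_mapsTo_ball_of_isLittleO hgd hmaps hlo hz
  simpa [hgc, dist_eq_norm, hg] using this

end HolomorphicEstimates

/-! ### Holomorphy of circle averages and of directional derivatives. -/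

section CircleIntegrals

variable {V : Type*} [NormedAddCommGroup V] [NormedSpace ℂ V] [FiniteDimensional ℂ V]

/-- Averages of translates of a holomorphic function along a compact curve are holomorphic. -/
theorem differentiableAt_intervalIntegral_translate {f : V → ℂ} {U : Set V} (hU : IsOpen U)
    (hf : DifferentiableOn ℂ f U) {γ : ℝ → V} (hγ : Continuous γ) {w : ℝ → ℂ} (hw : Continuous w)
    {a b : ℝ} {z : V} (hz : ∀ θ ∈ Set.uIcc a b, z + γ θ ∈ U) :
    DifferentiableAt ℂ (fun x => ∫ θ in a..b, w θ * f (x + γ θ)) z := by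
  have : ProperSpace V := FiniteDimensional.proper ℂ V
  borelize V
  have : SecondCountableTopology (V →L[ℂ] ℂ) := by
    have : ProperSpace (V →L[ℂ] ℂ) := FiniteDimensional.proper ℂ _
    infer_instance
  have : SecondCountableTopology V := inferInstance
  set K : Set V := (fun θ => z + γ θ) '' Set.uIcc a b with hK
  have hKc : IsCompact K := isCompact_uIcc.image (by fun_prop)
  have hKU : K ⊆ U := by rintro _ ⟨θ, hθ, rfl⟩; exact hz θ hθ
  -- A compact thickening of the curve still lies in `U`, so `f` is bounded on it. The Schwarz
  -- estimate on balls of radius δ/2 then bounds the derivative uniformly, which justifies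
  -- differentiation under the integral.
  obtain ⟨δ, hδ, hδU⟩ := hKc.exists_cthickening_subset_open hU hKU
  have hKδ : IsCompact (Metric.cthickening δ K) := hKc.cthickening
  obtain ⟨M, hM⟩ := hKδ.exists_bound_of_continuousOn (hf.continuousOn.mono hδU)
  obtain ⟨B, hB⟩ := (isCompact_uIcc (a := a) (b := b)).exists_bound_of_continuousOn hw.continuousOn
  have hball : ∀ θ ∈ Set.uIcc a b, ∀ x ∈ Metric.ball z (δ / 2),
      Metric.ball (x + γ θ) (δ / 2) ⊆ Metric.cthickening δ K := by
    intro θ hθ x hx y hy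
    refine Metric.mem_cthickening_of_dist_le y (z + γ θ) δ K ⟨θ, hθ, rfl⟩ ?_
    have h1 : dist (x + γ θ) (z + γ θ) < δ / 2 := by simpa using hx
    have h2 := dist_triangle y (x + γ θ) (z + γ θ)
    have h3 : dist y (x + γ θ) < δ / 2 := hy
    linarith
  have hdiff : ∀ θ ∈ Set.uIcc a b, ∀ x ∈ Metric.ball z (δ / 2), DifferentiableAt ℂ f (x + γ θ) := by
    intro θ hθ x hx
    refine hf.differentiableAt (hU.mem_nhds (hδU (hball θ hθ x hx ?_)))
    exact Metric.mem_ball_self (by positivity)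
  have hsub : ∀ θ, θ ∈ Set.uIoc a b → θ ∈ Set.uIcc a b := fun θ h => Set.uIoc_subset_uIcc h
  have hcont : ∀ x ∈ Metric.ball z (δ / 2),
      ContinuousOn (fun θ => w θ * f (x + γ θ)) (Set.uIcc a b) := by
    intro x hx θ hθ
    have h1 : ContinuousAt (fun θ => f (x + γ θ)) θ :=
      ContinuousAt.comp (f := fun θ => x + γ θ) (hdiff θ hθ x hx).continuousAt (by fun_prop)
    exact (hw.continuousAt.mul h1).continuousWithinAt
  refine (intervalIntegral.hasFDerivAt_integral_of_dominated_of_fderiv_le (𝕜 := ℂ)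
    (s := Metric.ball z (δ / 2))
    (F' := fun x θ => w θ • fderiv ℂ f (x + γ θ)) (bound := fun _ => B * (2 * M / (δ / 2)))
    (Metric.ball_mem_nhds z (by positivity)) ?_ ?_ ?_ ?_ ?_ ?_).differentiableAt
  · filter_upwards [Metric.ball_mem_nhds z (show 0 < δ / 2 by positivity)] with x hx
    exact ((hcont x hx).mono Set.uIoc_subset_uIcc).aestronglyMeasurable measurableSet_uIoc
  · exact (hcont z (Metric.mem_ball_self (by positivity))).intervalIntegrable
  · refine (hw.aestronglyMeasurable).smul ?_
    have : Measurable fun θ => fderiv ℂ f (z + γ θ) :=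
      (measurable_fderiv ℂ f).comp (by fun_prop)
    exact this.aestronglyMeasurable
  · refine ae_of_all _ fun θ hθ x hx => ?_
    rw [norm_smul]
    have hb := hball θ (hsub θ hθ) x hx
    have hMx := norm_fderiv_le_of_norm_le (hf.mono (hb.trans hδU)) (fun y hy => hM y (hb hy))
      (by positivity)
    gcongr
    · exact (norm_nonneg _).trans (hB θ (hsub θ hθ))
    · exact hB θ (hsub θ hθ)
  · exact intervalIntegrable_const
  · refine ae_of_all _ fun θ hθ x hx => ?_
    have h1 : HasFDerivAt (fun x => f (x + γ θ)) (fderiv ℂ f (x + γ θ)) x := by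
      have := (hdiff θ (hsub θ hθ) x hx).hasFDerivAt
      exact (hasFDerivAt_comp_add_right (γ θ)).2 this
    exact h1.const_smul (w θ)

theorem exists_ball_add_circleMap_mem {U : Set V} (hU : IsOpen U) {z : V} (hz : z ∈ U) (v : V) :
    ∃ r > 0, ∀ x ∈ Metric.ball z r, ∀ τ ∈ Metric.closedBall (0 : ℂ) r, x + τ • v ∈ U := by
  obtain ⟨ε, hε, hεU⟩ := Metric.isOpen_iff.1 hU z hz
  refine ⟨ε / (2 * (‖v‖ + 1)), by positivity, fun x hx τ hτ => hεU ?_⟩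
  have h1 : ‖x - z‖ < ε / (2 * (‖v‖ + 1)) := mem_ball_iff_norm.1 hx
  have h2 : ‖τ‖ ≤ ε / (2 * (‖v‖ + 1)) := mem_closedBall_zero_iff.1 hτ
  rw [mem_ball_iff_norm]
  calc ‖x + τ • v - z‖ ≤ ‖x - z‖ + ‖τ‖ * ‖v‖ := by
        rw [add_sub_right_comm, ← norm_smul]; exact norm_add_le _ _
    _ < ε / (2 * (‖v‖ + 1)) + ε / (2 * (‖v‖ + 1)) * ‖v‖ :=
        add_lt_add_of_lt_of_le h1 (by gcongr)
    _ = ε / 2 := by field_simp; ring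
    _ < ε := by linarith

theorem differentiableAt_slice {f : V → ℂ} {x v : V} {τ : ℂ} (h : DifferentiableAt ℂ f (x + τ • v)) :
    DifferentiableAt ℂ (fun τ : ℂ => f (x + τ • v)) τ :=
  DifferentiableAt.comp τ (g := f) (f := fun τ : ℂ => x + τ • v) h (by fun_prop)

/-- Directional derivatives of holomorphic functions of several variables are holomorphic. -/
theorem differentiableOn_fderiv_apply {f : V → ℂ} {U : Set V} (hU : IsOpen U)
    (hf : DifferentiableOn ℂ f U) (v : V) :
    DifferentiableOn ℂ (fun z => fderiv ℂ f z v) U := by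
  intro z hz
  obtain ⟨r, hr, hrU⟩ := exists_ball_add_circleMap_mem hU hz v
  -- Cauchy's formula for the derivative along the line `x + τ • v` writes the directional
  -- derivative as a weighted circle average of translates of `f`, and such averages are holomorphic
  -- in `x`.
  have hI : DifferentiableAt ℂ (fun x => ∫ θ in (0 : ℝ)..(2 * Real.pi),
      ((2 * Real.pi * Complex.I : ℂ)⁻¹ * (deriv (circleMap 0 r) θ *
        ((circleMap 0 r θ) ^ 2)⁻¹)) * f (x + circleMap 0 r θ • v)) z := by
    refine differentiableAt_intervalIntegral_translate hU hf (γ := fun θ => circleMap 0 r θ • v)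
      ?_ ?_ ?_
    · exact (continuous_circleMap 0 r).smul continuous_const
    · simp only [deriv_circleMap]
      refine continuous_const.mul (Continuous.mul ?_ (Continuous.inv₀ ?_ ?_))
      · exact (continuous_circleMap 0 r).mul continuous_const
      · exact (continuous_circleMap 0 r).pow 2
      · intro θ; simp [hr.ne']
    · intro θ _
      exact hrU z (Metric.mem_ball_self hr) _ (circleMap_mem_closedBall 0 hr.le θ)
  refine (hI.congr_of_eventuallyEq ?_).differentiableWithinAt
  filter_upwards [Metric.ball_mem_nhds z hr] with x hx
  have hd : ∀ τ ∈ Metric.closedBall (0 : ℂ) r, DifferentiableAt ℂ f (x + τ • v) :=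
    fun τ hτ => hf.differentiableAt (hU.mem_nhds (hrU x hx τ hτ))
  have h1 : deriv (fun τ : ℂ => f (x + τ • v)) 0 = fderiv ℂ f x v := by
    have h2 := (hd 0 (Metric.mem_closedBall_self hr.le)).hasFDerivAt
    have h3 : HasDerivAt (fun τ : ℂ => x + τ • v) v 0 := by
      simpa using ((hasDerivAt_id (0 : ℂ)).smul_const v).const_add x
    have := h2.comp_hasDerivAt (0 : ℂ) h3
    simpa [Function.comp_def] using this.deriv
  have hdc : DiffContOnCl ℂ (fun τ : ℂ => f (x + τ • v)) (Metric.ball 0 r) := by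
    refine DifferentiableOn.diffContOnCl fun τ hτ => ?_
    rw [closure_ball _ hr.ne'] at hτ
    exact (differentiableAt_slice (hd τ hτ)).differentiableWithinAt
  have hC := Complex.differentiable_on_off_countable_deriv_eq_smul_circleIntegral hr
    Set.countable_empty hdc.continuousOn_ball
    fun _ hx => hdc.differentiableAt Metric.isOpen_ball hx.1
  rw [smul_eq_mul, mul_comm, ← mul_inv_eq_iff_eq_mul₀ Complex.two_pi_I_ne_zero] at hC
  rw [← h1, ← hC, circleIntegral, mul_comm]
  simp only [mul_assoc]
  rw [intervalIntegral.integral_const_mul]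
  congr 1
  refine intervalIntegral.integral_congr fun θ _ => ?_
  simp

end CircleIntegrals

theorem measurable_indicator_of_continuousOn {X Y : Type*} [TopologicalSpace X]
    [MeasurableSpace X] [OpensMeasurableSpace X] [TopologicalSpace Y] [MeasurableSpace Y]
    [BorelSpace Y] [Zero Y] {s : Set X} {f : X → Y} (hs : MeasurableSet s)
    (hf : ContinuousOn f s) : Measurable (s.indicator f) := by
  classical
  rw [← Set.piecewise_eq_indicator]
  exact hf.measurable_piecewise continuousOn_const hs

/-! ### The sub-mean value inequality over balls. -/

section MeanValue

variable {V : Type*} [NormedAddCommGroup V] [NormedSpace ℂ V] [FiniteDimensional ℂ V]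
  [MeasurableSpace V] [BorelSpace V] (μ : Measure V) [μ.IsAddHaarMeasure]

/-- The image measure is again a Haar measure, hence a multiple of `μ`; the factor is 1 because the
unit ball is invariant and has positive finite measure. -/
theorem measurePreserving_smul_of_norm_eq_one {τ : ℂ} (hτ : ‖τ‖ = 1) :
    MeasurePreserving (fun v : V => τ • v) μ μ := by
  have : FiniteDimensional ℝ V := FiniteDimensional.trans ℝ ℂ V
  have hτ0 : τ ≠ 0 := by rintro rfl; simp at hτ
  let e : V ≃L[ℝ] V :=
    (ContinuousLinearEquiv.smulLeft (M₁ := V) (R₁ := ℂ) (Units.mk0 τ hτ0)).restrictScalars ℝ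
  have he : (e : V → V) = fun v => τ • v := rfl
  have : (μ.map e).IsAddHaarMeasure := e.isAddHaarMeasure_map μ
  have h1 := Measure.isAddLeftInvariant_eq_smul (μ.map e) μ
  refine ⟨by fun_prop, ?_⟩
  rw [← he, h1]
  have hb : (e : V → V) ⁻¹' Metric.ball 0 1 = Metric.ball 0 1 := by
    ext v; simp [he, norm_smul, hτ]
  have h2 := congrArg (fun ν : Measure V => ν (Metric.ball 0 1)) h1
  simp only [Measure.smul_apply] at h2
  rw [Measure.map_apply (by rw [he]; fun_prop) Metric.isOpen_ball.measurableSet, hb] at h2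
  have h3 : μ (Metric.ball (0 : V) 1) ≠ 0 := (Metric.measure_ball_pos μ 0 one_pos).ne'
  have : ProperSpace V := FiniteDimensional.proper ℂ V
  have h4 : μ (Metric.ball (0 : V) 1) ≠ ∞ := measure_ball_lt_top.ne
  rw [ENNReal.smul_def, smul_eq_mul] at h2
  have h5 : ((Measure.addHaarScalarFactor (μ.map e) μ : NNReal) : ℝ≥0∞) = 1 := by
    have := (ENNReal.mul_eq_right h3 h4).1 h2.symm
    exact this
  have h6 : Measure.addHaarScalarFactor (μ.map e) μ = 1 := by exact_mod_cast h5
  rw [h6, one_smul]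

/-- The sub-mean value property of `|f|²` over balls. -/
theorem measure_ball_mul_enorm_sq_le {f : V → ℂ} {c : V} {R : ℝ}
    (hf : DifferentiableOn ℂ f (Metric.ball c R)) :
    μ (Metric.ball c R) * ‖f c‖ₑ ^ 2 ≤ ∫⁻ z in Metric.ball c R, ‖f z‖ₑ ^ 2 ∂μ := by
  have : ProperSpace V := FiniteDimensional.proper ℂ V
  rcases le_or_gt R 0 with hR | hR
  · simp [Metric.ball_eq_empty.2 hR]
  set F : V → ℂ := (Metric.ball c R).indicator f with hF
  have hFm : Measurable F :=
    measurable_indicator_of_continuousOn Metric.isOpen_ball.measurableSet hf.continuousOn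
  -- On each complex line through `c`, `f c ^ 2` is the mean of `f ^ 2` over a circle. After
  -- integration over `w` and an exchange of integrals, rotations preserve `μ` (`hinv`), so the θ
  -- integral contributes only the factor 2π.
  have hpt : ∀ w ∈ Metric.ball (0 : V) R, ENNReal.ofReal (2 * Real.pi) * ‖f c‖ₑ ^ 2 ≤
      ∫⁻ θ in Set.Ioc 0 (2 * Real.pi), ‖F (c + circleMap 0 1 θ • w)‖ₑ ^ 2 := by
    intro w hw
    have hmem : ∀ τ ∈ Metric.closedBall (0 : ℂ) 1, c + τ • w ∈ Metric.ball c R := by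
      intro τ hτ
      rw [mem_ball_iff_norm, add_sub_cancel_left, norm_smul]
      rw [mem_closedBall_zero_iff] at hτ
      rw [mem_ball_zero_iff] at hw
      calc ‖τ‖ * ‖w‖ ≤ 1 * ‖w‖ := by gcongr
        _ < R := by simpa
    have hdc : DiffContOnCl ℂ (fun τ : ℂ => f (c + τ • w) ^ 2) (Metric.ball 0 |1|) := by
      refine DifferentiableOn.diffContOnCl fun τ hτ => ?_
      rw [abs_one, closure_ball _ one_ne_zero] at hτ
      exact ((differentiableAt_slice (hf.differentiableAt
        (Metric.isOpen_ball.mem_nhds (hmem τ hτ)))).pow 2).differentiableWithinAt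
    have h1 := hdc.circleAverage
    rw [Real.circleAverage_def] at h1
    simp only [zero_smul, add_zero] at h1
    have h2 : (∫ θ in (0 : ℝ)..2 * Real.pi, f (c + circleMap 0 1 θ • w) ^ 2) =
        (2 * Real.pi) • f c ^ 2 := by
      rw [← h1, smul_smul, mul_inv_cancel₀ Real.two_pi_pos.ne', one_smul]
    have h3 : ‖(2 * Real.pi) • f c ^ 2‖ₑ = ENNReal.ofReal (2 * Real.pi) * ‖f c‖ₑ ^ 2 := by
      rw [enorm_smul, enorm_pow, Real.enorm_of_nonneg Real.two_pi_pos.le]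
    rw [← h3, ← h2, intervalIntegral.integral_of_le Real.two_pi_pos.le]
    refine (enorm_integral_le_lintegral_enorm _).trans (le_of_eq ?_)
    refine lintegral_congr fun θ => ?_
    rw [enorm_pow, hF, Set.indicator_of_mem (hmem _ (circleMap_mem_closedBall 0 zero_le_one θ))]
  have hmeas : Measurable fun p : V × ℝ => ‖F (c + circleMap 0 1 p.2 • p.1)‖ₑ ^ 2 := by
    refine Measurable.pow_const (Measurable.enorm (hFm.comp ?_)) 2
    have : Continuous fun p : V × ℝ => c + circleMap 0 1 p.2 • p.1 :=
      continuous_const.add (((continuous_circleMap 0 1).comp continuous_snd).smul continuous_fst)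
    exact this.measurable
  have hinv : ∀ θ : ℝ, ∫⁻ w, ‖F (c + circleMap 0 1 θ • w)‖ₑ ^ 2 ∂μ = ∫⁻ w, ‖F w‖ₑ ^ 2 ∂μ := by
    intro θ
    have h1 := (measurePreserving_smul_of_norm_eq_one μ (τ := circleMap 0 1 θ) (by simp)).lintegral_comp
      (f := fun w => ‖F (c + w)‖ₑ ^ 2) (by fun_prop)
    rw [h1]
    exact lintegral_add_left_eq_self (fun w => ‖F w‖ₑ ^ 2) c
  have hF2 : ∫⁻ w, ‖F w‖ₑ ^ 2 ∂μ = ∫⁻ z in Metric.ball c R, ‖f z‖ₑ ^ 2 ∂μ := by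
    rw [← lintegral_indicator Metric.isOpen_ball.measurableSet]
    refine lintegral_congr fun w => ?_
    by_cases hw : w ∈ Metric.ball c R <;> simp [hF, hw]
  have hball : μ (Metric.ball c R) = μ (Metric.ball (0 : V) R) := Measure.addHaar_ball_center μ c R
  have h2pi : ENNReal.ofReal (2 * Real.pi) ≠ 0 := by simp [Real.pi_pos]
  rw [← ENNReal.mul_le_mul_iff_right h2pi ENNReal.ofReal_ne_top]
  calc ENNReal.ofReal (2 * Real.pi) * (μ (Metric.ball c R) * ‖f c‖ₑ ^ 2)
      = ∫⁻ _ in Metric.ball (0 : V) R, ENNReal.ofReal (2 * Real.pi) * ‖f c‖ₑ ^ 2 ∂μ := by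
        rw [setLIntegral_const, hball]; ring
    _ ≤ ∫⁻ w in Metric.ball (0 : V) R, (∫⁻ θ in Set.Ioc 0 (2 * Real.pi),
          ‖F (c + circleMap 0 1 θ • w)‖ₑ ^ 2) ∂μ :=
        setLIntegral_mono' Metric.isOpen_ball.measurableSet hpt
    _ ≤ ∫⁻ w, (∫⁻ θ in Set.Ioc 0 (2 * Real.pi), ‖F (c + circleMap 0 1 θ • w)‖ₑ ^ 2) ∂μ :=
        setLIntegral_le_lintegral _ _
    _ = ∫⁻ θ in Set.Ioc 0 (2 * Real.pi), (∫⁻ w, ‖F (c + circleMap 0 1 θ • w)‖ₑ ^ 2 ∂μ) :=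
        lintegral_lintegral_swap (f := fun w θ => ‖F (c + circleMap 0 1 θ • w)‖ₑ ^ 2)
          hmeas.aemeasurable
    _ = ENNReal.ofReal (2 * Real.pi) * ∫⁻ z in Metric.ball c R, ‖f z‖ₑ ^ 2 ∂μ := by
        simp only [hinv, hF2, setLIntegral_const, Real.volume_Ioc, sub_zero]
        ring

end MeanValue

/-! ### Square integrable singularities in one variable. -/

section OneVariable

/-- A square integrable quotient of holomorphic functions has a removable singularity. -/
theorem differentiableAt_update_limUnder_of_sq_integrable {φ : ℂ → ℂ} {c : ℂ} {r : ℝ} (hr : 0 < r)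
    (hd : DifferentiableOn ℂ φ (Metric.ball c r \ {c}))
    (hint : ∫⁻ z in Metric.ball c r, ‖φ z‖ₑ ^ 2 ≠ ∞) :
    DifferentiableAt ℂ (Function.update φ c (limUnder (𝓝[≠] c) φ)) c := by
  have hnh : Metric.ball c r ∈ 𝓝 c := Metric.ball_mem_nhds c hr
  refine (Complex.differentiableOn_update_limUnder_of_isLittleO hnh hd ?_).differentiableAt hnh
  -- The ball around `z` of radius ‖z - c‖ avoids `c`, so the sub-mean value inequality holds on it.
  -- As `z → c` its volume tends to zero, hence so does the energy on it; this gives φ = o(1/‖z -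
  -- c‖), which is enough for Riemann's removability criterion.
  have key : ∀ z ∈ Metric.ball c (r / 2), z ≠ c →
      ENNReal.ofReal ‖z - c‖ ^ 2 * NNReal.pi * ‖φ z‖ₑ ^ 2 ≤
        ∫⁻ x in Metric.ball z ‖z - c‖, ‖φ x‖ₑ ^ 2 ∂(volume.restrict (Metric.ball c r)) := by
    intro z hz hzc
    have hz' : ‖z - c‖ < r / 2 := mem_ball_iff_norm.1 hz
    have hsub : Metric.ball z ‖z - c‖ ⊆ Metric.ball c r \ {c} := by
      intro x hx
      refine ⟨?_, ?_⟩
      · rw [mem_ball_iff_norm] at hx ⊢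
        have : ‖x - c‖ ≤ ‖x - z‖ + ‖z - c‖ := by
          simpa using norm_add_le (x - z) (z - c)
        linarith
      · rintro rfl
        rw [mem_ball_iff_norm, norm_sub_rev] at hx
        exact lt_irrefl _ hx
    have h1 := measure_ball_mul_enorm_sq_le (volume : Measure ℂ) (hd.mono hsub)
    rw [Complex.volume_ball] at h1
    rw [Measure.restrict_restrict Metric.isOpen_ball.measurableSet,
      Set.inter_eq_self_of_subset_left (hsub.trans Set.sdiff_subset)]
    exact h1
  have htend : Tendsto (fun z => ∫⁻ x in Metric.ball z ‖z - c‖, ‖φ x‖ₑ ^ 2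
      ∂(volume.restrict (Metric.ball c r))) (𝓝[≠] c) (𝓝 0) := by
    refine tendsto_setLIntegral_zero hint ?_
    have h1 : Tendsto (fun z : ℂ => ENNReal.ofReal ‖z - c‖ ^ 2 * NNReal.pi) (𝓝[≠] c) (𝓝 0) := by
      have h2 : Tendsto (fun z : ℂ => ENNReal.ofReal ‖z - c‖ ^ 2 * NNReal.pi) (𝓝 c)
          (𝓝 (ENNReal.ofReal ‖c - c‖ ^ 2 * NNReal.pi)) := by
        refine ENNReal.Tendsto.mul_const ?_ (Or.inr ENNReal.coe_ne_top)
        exact ((ENNReal.continuous_pow 2).comp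
          (ENNReal.continuous_ofReal.comp (continuous_id.sub continuous_const).norm)).tendsto c
      simp only [sub_self, norm_zero, ENNReal.ofReal_zero] at h2
      simpa using h2.mono_left nhdsWithin_le_nhds
    refine tendsto_of_tendsto_of_tendsto_of_le_of_le tendsto_const_nhds h1 (fun _ => zero_le) ?_
    intro z
    refine (Measure.restrict_apply_le _ _).trans ?_
    rw [Complex.volume_ball]
  have h3 : Tendsto (fun z => ‖z - c‖ * ‖φ z‖) (𝓝[≠] c) (𝓝 0) := by
    have h4 : Tendsto (fun z => ENNReal.ofReal ‖z - c‖ ^ 2 * NNReal.pi * ‖φ z‖ₑ ^ 2) (𝓝[≠] c)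
        (𝓝 0) := by
      refine tendsto_of_tendsto_of_tendsto_of_le_of_le' tendsto_const_nhds htend
        (Eventually.of_forall fun _ => zero_le) ?_
      filter_upwards [self_mem_nhdsWithin,
        mem_nhdsWithin_of_mem_nhds (Metric.ball_mem_nhds c (half_pos hr))] with z h5 h6
      exact key z h6 h5
    have h5 := (ENNReal.tendsto_toReal ENNReal.zero_ne_top).comp h4
    simp only [Function.comp_def, ENNReal.toReal_mul, ENNReal.toReal_pow, toReal_enorm,
      ENNReal.toReal_ofReal (norm_nonneg _), ENNReal.coe_toReal, ENNReal.toReal_zero] at h5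
    have h6 := (h5.div_const Real.pi).sqrt
    simp only [zero_div, Real.sqrt_zero] at h6
    refine h6.congr fun z => ?_
    have : ‖z - c‖ ^ 2 * (NNReal.pi : ℝ) * ‖φ z‖ ^ 2 / Real.pi = (‖z - c‖ * ‖φ z‖) ^ 2 := by
      rw [NNReal.coe_real_pi]; field_simp [Real.pi_ne_zero]
    rw [this, Real.sqrt_sq (by positivity)]
  rw [Asymptotics.isLittleO_iff_tendsto']
  · rw [tendsto_zero_iff_norm_tendsto_zero]
    have h7 : Tendsto (fun z => ‖z - c‖ * ‖φ c‖) (𝓝[≠] c) (𝓝 0) := by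
      have : Tendsto (fun z : ℂ => ‖z - c‖ * ‖φ c‖) (𝓝 c) (𝓝 (‖c - c‖ * ‖φ c‖)) :=
        (((continuous_id.sub continuous_const).norm).mul continuous_const).tendsto c
      simp only [sub_self, norm_zero, zero_mul] at this
      exact this.mono_left nhdsWithin_le_nhds
    have h8 := h3.add h7
    rw [add_zero] at h8
    refine squeeze_zero (fun _ => norm_nonneg _) (fun z => ?_) h8
    rw [div_inv_eq_mul, norm_mul, mul_comm, ← mul_add]
    gcongr
    exact norm_sub_le _ _
  · filter_upwards [self_mem_nhdsWithin] with z hz hz0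
    exact absurd (inv_eq_zero.1 hz0) (sub_ne_zero.2 hz)

variable {q h : ℂ → ℂ} {U : Set ℂ} {r : ℝ}

theorem eventually_nhdsNE_ne_zero (hU : IsOpen U) (hr : Metric.closedBall 0 r ⊆ U)
    (hh : DifferentiableOn ℂ h U) {a : ℂ} (ha : a ∈ Metric.closedBall 0 r) (h0 : h a ≠ 0) :
    ∀ x ∈ Metric.closedBall 0 r, ∀ᶠ z in 𝓝[≠] x, h z ≠ 0 := by
  intro x hx
  have han : AnalyticOnNhd ℂ h (Metric.closedBall 0 r) := (hh.analyticOnNhd hU).mono hr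
  by_contra hne
  have h1 : ∃ᶠ z in 𝓝[≠] x, h z = 0 := hne
  exact h0 (han.eqOn_zero_of_preconnected_of_frequently_eq_zero
    (convex_closedBall 0 r).isPreconnected hx h1 ha)

/-- The mean value property over a circle for square integrable quotients of holomorphic
functions. -/
theorem circleAverage_div_of_sq_integrable (hU : IsOpen U) (hr : Metric.closedBall 0 r ⊆ U)
    (hr0 : 0 < r) (hq : DifferentiableOn ℂ q U) (hh : DifferentiableOn ℂ h U) (h0 : h 0 ≠ 0)
    (hs : ∀ τ ∈ Metric.sphere (0 : ℂ) r, h τ ≠ 0)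
    (hint : ∫⁻ τ in Metric.ball 0 r, ‖q τ / h τ‖ₑ ^ 2 ≠ ∞) :
    Real.circleAverage (fun τ => q τ / h τ) 0 r = q 0 / h 0 := by
  set φ : ℂ → ℂ := fun τ => q τ / h τ with hφ
  -- Taking the punctured limit at every point removes all singularities at once and leaves φ
  -- unchanged where `h` does not vanish.
  set Φ : ℂ → ℂ := fun z => limUnder (𝓝[≠] z) φ with hΦ
  have hφd : ∀ z ∈ U, h z ≠ 0 → DifferentiableAt ℂ φ z := fun z hz hz0 =>
    (hq.differentiableAt (hU.mem_nhds hz)).div (hh.differentiableAt (hU.mem_nhds hz)) hz0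
  have hΦeq : ∀ z ∈ U, h z ≠ 0 → Φ z = φ z := fun z hz hz0 =>
    ((hφd z hz hz0).continuousAt.tendsto.mono_left nhdsWithin_le_nhds).limUnder_eq
  have hΦd : ∀ x ∈ Metric.closedBall 0 r, DifferentiableAt ℂ Φ x := by
    intro x hx
    have hne := eventually_nhdsNE_ne_zero hU hr hh (Metric.mem_closedBall_self hr0.le) h0 x hx
    have hUx : U ∈ 𝓝 x := hU.mem_nhds (hr hx)
    by_cases hhx : h x = 0
    · have hxb : x ∈ Metric.ball (0 : ℂ) r := by
        rw [mem_ball_zero_iff]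
        refine lt_of_le_of_ne (mem_closedBall_zero_iff.1 hx) fun h' => ?_
        exact hs x (mem_sphere_zero_iff_norm.2 h') hhx
      have hU' : U ∩ Metric.ball 0 r ∈ 𝓝 x := inter_mem hUx (Metric.isOpen_ball.mem_nhds hxb)
      have h1 : ∀ᶠ z in 𝓝 x, z ∈ U ∩ Metric.ball 0 r ∧ (z ≠ x → h z ≠ 0) :=
        (eventually_of_mem hU' fun _ hz => hz).and (eventually_nhdsWithin_iff.1 hne)
      obtain ⟨ε, hε, hball⟩ := Metric.eventually_nhds_iff_ball.1 h1
      have h2 : DifferentiableAt ℂ (Function.update φ x (limUnder (𝓝[≠] x) φ)) x := by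
        refine differentiableAt_update_limUnder_of_sq_integrable hε ?_ ?_
        · intro z hz
          exact (hφd z (hball z hz.1).1.1 ((hball z hz.1).2 hz.2)).differentiableWithinAt
        · refine ne_top_of_le_ne_top hint (lintegral_mono_set fun z hz => (hball z hz).1.2)
      refine h2.congr_of_eventuallyEq ?_
      filter_upwards [h1] with z hz
      by_cases hzx : z = x
      · subst hzx; simp [hΦ]
      · rw [Function.update_of_ne hzx, hΦeq z hz.1.1 (hz.2 hzx)]
    · refine (hφd x (hr hx) hhx).congr_of_eventuallyEq ?_
      have hc : ∀ᶠ z in 𝓝 x, h z ≠ 0 :=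
        (hh.differentiableAt hUx).continuousAt.eventually_ne hhx
      filter_upwards [hc, hUx] with z hz hzU
      exact hΦeq z hzU hz
  have hdc : DiffContOnCl ℂ Φ (Metric.ball 0 |r|) := by
    refine DifferentiableOn.diffContOnCl fun τ hτ => ?_
    rw [abs_of_pos hr0, closure_ball _ hr0.ne'] at hτ
    exact (hΦd τ hτ).differentiableWithinAt
  change _ = φ 0
  rw [← hΦeq 0 (hr (Metric.mem_closedBall_self hr0.le)) h0, ← hdc.circleAverage]
  refine Real.circleAverage_congr_sphere fun τ hτ => ?_
  rw [abs_of_pos hr0] at hτ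
  exact (hΦeq τ (hr (Metric.sphere_subset_closedBall hτ)) (hs τ hτ)).symm

end OneVariable

/-! ### Zero sets and square integrable quotients in several variables. -/

section Removable

variable {V : Type*} [NormedAddCommGroup V] [NormedSpace ℂ V] [FiniteDimensional ℂ V]
  {Ω : Set V} {q h : V → ℂ}

/-- Restrict to the complex line through the centre and `w` and use the identity theorem in one
variable. -/
theorem eqOn_ball_of_eventuallyEq_zero {a : V} {ε : ℝ} (hh : DifferentiableOn ℂ h (Metric.ball a ε))
    (h0 : ∀ᶠ z in 𝓝 a, h z = 0) : ∀ w ∈ Metric.ball a ε, h w = 0 := by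
  intro w hw
  set v := w - a with hv
  set L : ℂ → V := fun τ => a + τ • v with hL
  have hLc : Continuous L := by fun_prop
  have hU : IsOpen (L ⁻¹' Metric.ball a ε) := Metric.isOpen_ball.preimage hLc
  have hsub : Metric.closedBall (0 : ℂ) 1 ⊆ L ⁻¹' Metric.ball a ε := by
    intro τ hτ
    rw [mem_closedBall_zero_iff] at hτ
    rw [mem_ball_iff_norm] at hw
    rw [Set.mem_preimage, hL, mem_ball_iff_norm, add_sub_cancel_left, norm_smul]
    calc ‖τ‖ * ‖v‖ ≤ 1 * ‖v‖ := by gcongr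
      _ < ε := by simpa [hv] using hw
  have hd : DifferentiableOn ℂ (fun τ => h (L τ)) (L ⁻¹' Metric.ball a ε) := fun τ hτ =>
    (differentiableAt_slice (hh.differentiableAt
      (Metric.isOpen_ball.mem_nhds hτ))).differentiableWithinAt
  have h1 : ∀ᶠ τ in 𝓝 (0 : ℂ), h (L τ) = 0 := by
    have : Tendsto L (𝓝 0) (𝓝 a) := by simpa [hL] using hLc.tendsto 0
    exact this.eventually h0
  have h2 : Set.EqOn (fun τ => h (L τ)) 0 (Metric.closedBall 0 1) :=
    ((hd.analyticOnNhd hU).mono hsub).eqOn_zero_of_preconnected_of_eventuallyEq_zero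
      (convex_closedBall 0 1).isPreconnected (Metric.mem_closedBall_self zero_le_one) h1
  have h3 := h2 (show (1 : ℂ) ∈ Metric.closedBall 0 1 by simp)
  simpa [hL, hv] using h3

/-- The identity theorem for holomorphic functions of several variables. -/
theorem frequently_ne_zero_of_isPreconnected (hΩ : IsOpen Ω) (hc : IsPreconnected Ω)
    (hh : DifferentiableOn ℂ h Ω) {z₀ : V} (hz₀ : z₀ ∈ Ω) (h0 : h z₀ ≠ 0) {a : V} (ha : a ∈ Ω) :
    ∃ᶠ z in 𝓝 a, h z ≠ 0 := by
  intro hne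
  have hne : ∀ᶠ z in 𝓝 a, h z = 0 := by simpa using hne
  set A : Set V := {z | ∀ᶠ w in 𝓝 z, h w = 0} with hA
  have hAo : IsOpen A := isOpen_setOfPred_eventually_nhds
  -- Relative closedness of `A`: a point `b` of `A` within ε/2 of `z` has a ball of radius ε/2
  -- inside `Ω`, on which `h` vanishes and which contains `z`.
  have hcl : closure A ∩ Ω ⊆ A := by
    rintro z ⟨hzA, hzΩ⟩
    obtain ⟨ε, hε, hεΩ⟩ := Metric.isOpen_iff.1 hΩ z hzΩ
    obtain ⟨b, hbA, hb⟩ := Metric.mem_closure_iff.1 hzA (ε / 2) (by positivity)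
    have hsub : Metric.ball b (ε / 2) ⊆ Ω := by
      refine fun w hw => hεΩ ?_
      have h1 := dist_triangle w b z
      rw [Metric.mem_ball] at hw ⊢
      rw [dist_comm] at hb
      linarith
    have h1 := eqOn_ball_of_eventuallyEq_zero (hh.mono hsub) hbA
    exact eventually_of_mem (Metric.isOpen_ball.mem_nhds hb) h1
  have := hc.subset_of_closure_inter_subset hAo ⟨a, ha, hne⟩ hcl
  exact h0 (this hz₀).self_of_nhds

/-- Near every point of the domain there is a direction in which `h` does not vanish on small
circles. -/
theorem exists_direction_ne_zero (hΩ : IsOpen Ω) (hc : IsPreconnected Ω)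
    (hh : DifferentiableOn ℂ h Ω) {z₀ : V} (hz₀ : z₀ ∈ Ω) (h0 : h z₀ ≠ 0) {a : V} (ha : a ∈ Ω) :
    ∃ v : V, ∃ r > 0, ∃ δ > 0, (∀ z ∈ Metric.ball a δ, ∀ τ ∈ Metric.closedBall (0 : ℂ) r,
      z + τ • v ∈ Ω) ∧ ∀ z ∈ Metric.ball a δ, ∀ τ ∈ Metric.sphere (0 : ℂ) r, h (z + τ • v) ≠ 0 := by
  obtain ⟨ε, hε, hεΩ⟩ := Metric.isOpen_iff.1 hΩ a ha
  obtain ⟨w, hw, hwε⟩ := ((frequently_ne_zero_of_isPreconnected hΩ hc hh hz₀ h0 ha).and_eventually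
    (Metric.ball_mem_nhds a hε)).exists
  set v := w - a with hv
  set L : ℂ → V := fun τ => a + τ • v with hL
  have hLc : Continuous L := by fun_prop
  have hU : IsOpen (L ⁻¹' Ω) := hΩ.preimage hLc
  have hsub : Metric.closedBall (0 : ℂ) 1 ⊆ L ⁻¹' Ω := by
    intro τ hτ
    rw [mem_closedBall_zero_iff] at hτ
    rw [dist_eq_norm] at hwε
    refine hεΩ ?_
    rw [hL, mem_ball_iff_norm, add_sub_cancel_left, norm_smul]
    calc ‖τ‖ * ‖v‖ ≤ 1 * ‖v‖ := by gcongr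
      _ < ε := by simpa [hv] using hwε
  have hd : DifferentiableOn ℂ (fun τ => h (L τ)) (L ⁻¹' Ω) := fun τ hτ =>
    (differentiableAt_slice (hh.differentiableAt (hΩ.mem_nhds hτ))).differentiableWithinAt
  -- On the line through `a` and `w` the function is nonzero at parameter 1, so parameter 0 is at
  -- worst an isolated zero and small circles around it avoid the zeros.
  have h1 := eventually_nhdsNE_ne_zero hU hsub hd (a := 1) (by simp) (by simpa [hL, hv] using hw)
    0 (by simp)
  obtain ⟨r₀, hr₀, hball⟩ := Metric.mem_nhdsWithin_iff.1 h1
  obtain ⟨r₁, hr₁, hr₁Ω⟩ := exists_ball_add_circleMap_mem hΩ ha v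
  set r := min (r₀ / 2) r₁ with hr
  have hrpos : 0 < r := lt_min (by positivity) hr₁
  -- Compactness of the circle makes the nonvanishing persist for all nearby centres.
  have htube : ∀ᶠ z in 𝓝 a, ∀ τ ∈ Metric.sphere (0 : ℂ) r, h (z + τ • v) ≠ 0 := by
    refine (isCompact_sphere (0 : ℂ) r).eventually_forall_of_forall_eventually fun τ hτ => ?_
    have hτr : ‖τ‖ = r := mem_sphere_zero_iff_norm.1 hτ
    have hmem : a + τ • v ∈ Ω := hr₁Ω a (Metric.mem_ball_self hr₁) τ
      (by rw [mem_closedBall_zero_iff, hτr]; exact min_le_right _ _)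
    have hcont : ContinuousAt (fun p : V × ℂ => h (p.1 + p.2 • v)) (a, τ) :=
      ContinuousAt.comp (g := h) (f := fun p : V × ℂ => p.1 + p.2 • v)
        (hh.differentiableAt (hΩ.mem_nhds hmem)).continuousAt (by fun_prop)
    refine hcont.eventually_ne (hball ⟨?_, ?_⟩)
    · rw [mem_ball_zero_iff, hτr]
      exact (min_le_left _ _).trans_lt (by linarith)
    · rintro rfl
      simp [hrpos.ne] at hτr
  obtain ⟨δ, hδ, hδball⟩ := Metric.eventually_nhds_iff_ball.1 htube
  refine ⟨v, r, hrpos, min δ r₁, lt_min hδ hr₁, fun z hz τ hτ => ?_, fun z hz => ?_⟩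
  · exact hr₁Ω z (Metric.ball_subset_ball (min_le_right _ _) hz) τ
      (Metric.closedBall_subset_closedBall (min_le_right _ _) hτ)
  · exact hδball z (Metric.ball_subset_ball (min_le_left _ _) hz)

variable [MeasurableSpace V] [BorelSpace V] (μ : Measure V) [μ.IsAddHaarMeasure]

/-- Integrals over two-dimensional slices in a fixed direction. -/
theorem lintegral_lintegral_slice_le {g : V → ℝ≥0∞} (hg : Measurable g) (v a : V) (δ r : ℝ) :
    ∫⁻ z in Metric.ball a δ, (∫⁻ τ in Metric.ball (0 : ℂ) r, g (z + τ • v)) ∂μ ≤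
      volume (Metric.ball (0 : ℂ) r) * ∫⁻ z, g z ∂μ := by
  have : ProperSpace V := FiniteDimensional.proper ℂ V
  have hm : Measurable fun p : V × ℂ => g (p.1 + p.2 • v) := by
    have : Continuous fun p : V × ℂ => p.1 + p.2 • v := by fun_prop
    exact hg.comp this.measurable
  rw [lintegral_lintegral_swap (f := fun z (τ : ℂ) => g (z + τ • v)) hm.aemeasurable]
  calc ∫⁻ τ in Metric.ball (0 : ℂ) r, ∫⁻ z in Metric.ball a δ, g (z + τ • v) ∂μ
      ≤ ∫⁻ _ in Metric.ball (0 : ℂ) r, ∫⁻ z, g z ∂μ := by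
        refine lintegral_mono fun τ => (setLIntegral_le_lintegral _ _).trans ?_
        exact (lintegral_add_right_eq_self g (τ • v)).le
    _ = _ := by rw [setLIntegral_const, mul_comm]

/-- The zero set of a nonzero holomorphic function is a null set. -/
theorem measure_zeroSet_eq_zero (hΩ : IsOpen Ω) (hc : IsPreconnected Ω)
    (hh : DifferentiableOn ℂ h Ω) {z₀ : V} (hz₀ : z₀ ∈ Ω) (h0 : h z₀ ≠ 0) :
    μ {z | z ∈ Ω ∧ h z = 0} = 0 := by
  have : ProperSpace V := FiniteDimensional.proper ℂ V
  set N : Set V := {z | z ∈ Ω ∧ h z = 0} with hN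
  have hNm : MeasurableSet N := by
    have h1 : N = Ω ∩ (Ω.indicator h) ⁻¹' {0} := by
      ext z
      simp only [hN, Set.mem_ofPred_eq, Set.mem_inter_iff, Set.mem_preimage, Set.mem_singleton_iff]
      refine and_congr_right fun hz => ?_
      rw [Set.indicator_of_mem hz]
    rw [h1]
    exact hΩ.measurableSet.inter
      (measurable_indicator_of_continuousOn hΩ.measurableSet hh.continuousOn
        (measurableSet_singleton 0))
  refine measure_null_of_locally_null N fun a ha => ?_
  obtain ⟨v, r, hr, δ, hδ, hmem, hne⟩ := exists_direction_ne_zero hΩ hc hh hz₀ h0 ha.1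
  set g : V → ℝ≥0∞ := N.indicator 1 with hg
  have hgm : Measurable g := measurable_one.indicator hNm
  have hm : Measurable fun p : V × ℂ => g (p.1 + p.2 • v) := by
    have : Continuous fun p : V × ℂ => p.1 + p.2 • v := by fun_prop
    exact hgm.comp this.measurable
  have hslice : ∀ z ∈ Metric.ball a δ, ∫⁻ τ in Metric.ball (0 : ℂ) r, g (z + τ • v) = 0 := by
    intro z hz
    set L : ℂ → V := fun τ => z + τ • v with hL
    have hU : IsOpen (L ⁻¹' Ω) := hΩ.preimage (by fun_prop)
    have hd : DifferentiableOn ℂ (fun τ => h (L τ)) (L ⁻¹' Ω) := fun τ hτ =>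
      (differentiableAt_slice (hh.differentiableAt (hΩ.mem_nhds hτ))).differentiableWithinAt
    have hsub : Metric.closedBall (0 : ℂ) r ⊆ L ⁻¹' Ω := fun τ hτ => hmem z hz τ hτ
    have hrs : (r : ℂ) ∈ Metric.sphere (0 : ℂ) r := by simp [hr.le]
    have h1 := eventually_nhdsNE_ne_zero hU hsub hd (Metric.sphere_subset_closedBall hrs)
      (hne z hz _ hrs)
    have h2 : {τ | h (L τ) ≠ 0} ∈ codiscreteWithin (Metric.ball (0 : ℂ) r) := by
      rw [mem_codiscreteWithin_iff_forall_mem_nhdsNE]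
      intro x hx
      filter_upwards [h1 x (Metric.ball_subset_closedBall hx)] with τ hτ using Or.inl hτ
    have h3 := ae_restrict_le_codiscreteWithin (μ := (volume : Measure ℂ))
      Metric.isOpen_ball.measurableSet h2
    refine (lintegral_congr_ae ?_).trans lintegral_zero
    filter_upwards [h3] with τ hτ
    exact Set.indicator_of_notMem (fun hm => hτ hm.2) _
  have hzero : ∫⁻ z in Metric.ball a δ, (∫⁻ τ in Metric.ball (0 : ℂ) r, g (z + τ • v)) ∂μ = 0 := by
    rw [setLIntegral_congr_fun Metric.isOpen_ball.measurableSet hslice, lintegral_zero]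
  rw [lintegral_lintegral_swap (f := fun z (τ : ℂ) => g (z + τ • v)) hm.aemeasurable,
    lintegral_eq_zero_iff hm.lintegral_prod_left'] at hzero
  have hpos : 0 < δ / (2 * (‖v‖ + 1)) := by positivity
  -- By Fubini almost every translate of `N` in direction `v` is null inside the ball around `a`.
  -- One such translation is chosen so short that it moves points by at most δ/2, and it carries the
  -- nullity back to `N` near `a`.
  have hae : ∃ τ ∈ Metric.ball (0 : ℂ) (min r (δ / (2 * (‖v‖ + 1)))),
      ∫⁻ z in Metric.ball a δ, g (z + τ • v) ∂μ = 0 := by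
    have h1 : ∀ᵐ τ ∂(volume.restrict (Metric.ball (0 : ℂ) (min r (δ / (2 * (‖v‖ + 1)))))),
        ∫⁻ z in Metric.ball a δ, g (z + τ • v) ∂μ = 0 :=
      ae_mono (Measure.restrict_mono (Metric.ball_subset_ball (min_le_left _ _)) le_rfl) hzero
    have h2 : (volume.restrict (Metric.ball (0 : ℂ) (min r (δ / (2 * (‖v‖ + 1)))))) ≠ 0 := by
      rw [Ne, Measure.restrict_eq_zero]
      exact (Metric.measure_ball_pos volume 0 (lt_min hr hpos)).ne'
    have : (ae (volume.restrict (Metric.ball (0 : ℂ) (min r (δ / (2 * (‖v‖ + 1))))))).NeBot :=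
      ae_neBot.2 h2
    obtain ⟨τ, hτ1, hτ2⟩ := (h1.and (ae_restrict_mem Metric.isOpen_ball.measurableSet)).exists
    exact ⟨τ, hτ2, hτ1⟩
  obtain ⟨τ, hτ, hτ0⟩ := hae
  refine ⟨N ∩ Metric.ball a (δ / 2), inter_mem_nhdsWithin N (Metric.ball_mem_nhds a (by positivity)),
    ?_⟩
  have hτn : ‖τ • v‖ ≤ δ / 2 := by
    rw [norm_smul]
    have h1 : ‖τ‖ ≤ δ / (2 * (‖v‖ + 1)) :=
      (mem_ball_zero_iff.1 hτ).le.trans (min_le_right _ _)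
    calc ‖τ‖ * ‖v‖ ≤ δ / (2 * (‖v‖ + 1)) * (‖v‖ + 1) := by gcongr; linarith
      _ = δ / 2 := by field_simp
  have h4 : μ (N ∩ Metric.ball a (δ / 2)) = ∫⁻ z, (Metric.ball a (δ / 2)).indicator g z ∂μ := by
    rw [lintegral_indicator Metric.isOpen_ball.measurableSet, hg, lintegral_indicator_one hNm,
      Measure.restrict_apply hNm]
  refine le_antisymm ?_ zero_le
  rw [h4, ← lintegral_add_right_eq_self _ (τ • v), ← hτ0,
    ← lintegral_indicator Metric.isOpen_ball.measurableSet]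
  refine lintegral_mono fun z => ?_
  by_cases hz : z + τ • v ∈ Metric.ball a (δ / 2)
  · have hz' : z ∈ Metric.ball a δ := by
      rw [mem_ball_iff_norm] at hz ⊢
      calc ‖z - a‖ = ‖(z + τ • v - a) - τ • v‖ := by congr 1; abel
        _ ≤ ‖z + τ • v - a‖ + ‖τ • v‖ := norm_sub_le _ _
        _ < δ := by linarith
    simp [Set.indicator_of_mem hz, Set.indicator_of_mem hz']
  · simp [Set.indicator_of_notMem hz]

/-- The extension is the average of q/h over circles in a fixed direction on which `h` has no zeros,
hence holomorphic in the centre. By Fubini q/h is square integrable on almost every slice, where the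
one-variable mean value property identifies the average with q/h. The exceptional set `B` is open
and null, hence empty. -/
theorem exists_local_extension (hΩ : IsOpen Ω) (hc : IsPreconnected Ω)
    (hq : DifferentiableOn ℂ q Ω) (hh : DifferentiableOn ℂ h Ω) {z₀ : V} (hz₀ : z₀ ∈ Ω)
    (h0 : h z₀ ≠ 0) (hint : ∫⁻ z in Ω, ‖q z / h z‖ₑ ^ 2 ∂μ ≠ ∞) {a : V} (ha : a ∈ Ω) :
    ∃ F : V → ℂ, ∃ δ > 0, Metric.ball a δ ⊆ Ω ∧ DifferentiableOn ℂ F (Metric.ball a δ) ∧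
      ∀ z ∈ Metric.ball a δ, h z ≠ 0 → F z = q z / h z := by
  have : ProperSpace V := FiniteDimensional.proper ℂ V
  obtain ⟨v, r, hr, δ, hδ, hmem, hne⟩ := exists_direction_ne_zero hΩ hc hh hz₀ h0 ha
  set f : V → ℂ := fun z => q z / h z with hf
  set U : Set V := {z | z ∈ Ω ∧ h z ≠ 0} with hU
  have hUo : IsOpen U := by
    have := hh.continuousOn.isOpen_inter_preimage hΩ (isOpen_compl_singleton (x := (0 : ℂ)))
    exact this
  have hUΩ : U ⊆ Ω := fun z hz => hz.1
  have hfd : DifferentiableOn ℂ f U := by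
    simp only [hf, div_eq_mul_inv]
    exact (hq.mono hUΩ).fun_mul ((hh.mono hUΩ).fun_inv fun z hz => hz.2)
  set F : V → ℂ := fun z =>
    (2 * Real.pi : ℝ)⁻¹ • ∫ θ in (0 : ℝ)..(2 * Real.pi), 1 * f (z + circleMap 0 r θ • v) with hF
  have hball : Metric.ball a δ ⊆ Ω := fun z hz => by
    simpa using hmem z hz 0 (Metric.mem_closedBall_self hr.le)
  have hFd : DifferentiableOn ℂ F (Metric.ball a δ) := by
    intro z hz
    refine (DifferentiableAt.const_smul (differentiableAt_intervalIntegral_translate hUo hfd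
      (γ := fun θ => circleMap 0 r θ • v) (w := fun _ => 1)
      ((continuous_circleMap 0 r).smul continuous_const) continuous_const ?_)
      ((2 * Real.pi : ℝ)⁻¹)).differentiableWithinAt
    exact fun θ _ => ⟨hmem z hz _ (circleMap_mem_closedBall 0 hr.le θ),
      hne z hz _ (circleMap_mem_sphere 0 hr.le θ)⟩
  refine ⟨F, δ, hδ, hball, hFd, ?_⟩
  set g : V → ℝ≥0∞ := Ω.indicator fun z => ‖f z‖ₑ ^ 2 with hg
  have hgm : Measurable g := by
    have h1 : g = fun z => ‖Ω.indicator q z / Ω.indicator h z‖ₑ ^ 2 := by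
      ext z
      by_cases hz : z ∈ Ω <;> simp [hg, hf, hz]
    rw [h1]
    exact ((measurable_indicator_of_continuousOn hΩ.measurableSet hq.continuousOn).div
      (measurable_indicator_of_continuousOn hΩ.measurableSet hh.continuousOn)).enorm.pow_const 2
  have hm : Measurable fun p : V × ℂ => g (p.1 + p.2 • v) := by
    have : Continuous fun p : V × ℂ => p.1 + p.2 • v := by fun_prop
    exact hgm.comp this.measurable
  have hfin : ∫⁻ z in Metric.ball a δ, (∫⁻ τ in Metric.ball (0 : ℂ) r, g (z + τ • v)) ∂μ ≠ ∞ := by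
    refine ne_top_of_le_ne_top ?_ (lintegral_lintegral_slice_le μ hgm v a δ r)
    rw [hg, lintegral_indicator hΩ.measurableSet]
    exact ENNReal.mul_ne_top measure_ball_lt_top.ne hint
  have hae : ∀ᵐ z ∂(μ.restrict (Metric.ball a δ)),
      ∫⁻ τ in Metric.ball (0 : ℂ) r, g (z + τ • v) < ∞ :=
    ae_lt_top hm.lintegral_prod_right' hfin
  have hgood : ∀ z ∈ Metric.ball a δ, ∫⁻ τ in Metric.ball (0 : ℂ) r, g (z + τ • v) < ∞ →
      h z ≠ 0 → F z = f z := by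
    intro z hz hzfin hz0
    have h1 := circleAverage_div_of_sq_integrable
      (U := (fun τ : ℂ => z + τ • v) ⁻¹' Ω) (q := fun τ => q (z + τ • v))
      (h := fun τ => h (z + τ • v)) (r := r) (hΩ.preimage (by fun_prop))
      (fun τ hτ => hmem z hz τ hτ) hr
      (fun τ hτ => (differentiableAt_slice
        (hq.differentiableAt (hΩ.mem_nhds hτ))).differentiableWithinAt)
      (fun τ hτ => (differentiableAt_slice
        (hh.differentiableAt (hΩ.mem_nhds hτ))).differentiableWithinAt)
      (by simpa using hz0) (hne z hz) ?_
    · simp only [zero_smul, add_zero] at h1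
      rw [Real.circleAverage_def] at h1
      simp only [hF, one_mul]
      exact h1
    · refine ne_of_lt (lt_of_eq_of_lt ?_ hzfin)
      refine setLIntegral_congr_fun Metric.isOpen_ball.measurableSet fun τ hτ => ?_
      simp only [hg]
      rw [Set.indicator_of_mem (hmem z hz τ (Metric.ball_subset_closedBall hτ))]
  set B : Set V := {z | z ∈ Metric.ball a δ ∩ U ∧ F z - f z ≠ 0} with hB
  have hBo : IsOpen B :=
    ((hFd.continuousOn.mono Set.inter_subset_left).sub
      (hfd.continuousOn.mono Set.inter_subset_right)).isOpen_inter_preimage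
      (Metric.isOpen_ball.inter hUo) (isOpen_compl_singleton (x := (0 : ℂ)))
  have hB0 : μ B = 0 := by
    rw [ae_restrict_iff' Metric.isOpen_ball.measurableSet] at hae
    refine measure_mono_null (fun z hz => ?_) (ae_iff.1 hae)
    simp only [Set.mem_ofPred_eq, Classical.not_imp]
    exact ⟨hz.1.1, fun hfin => hz.2 (sub_eq_zero.2 (hgood z hz.1.1 hfin hz.1.2.2))⟩
  have hBe : B = ∅ := (hBo.measure_eq_zero_iff μ).1 hB0
  intro z hz hz0
  by_contra hcon
  have : z ∈ B := ⟨⟨hz, hball hz, hz0⟩, sub_ne_zero.2 hcon⟩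
  rw [hBe] at this
  exact this

/-- A quotient of holomorphic functions that is square integrable is holomorphic. -/
theorem exists_extension_of_sq_integrable (hΩ : IsOpen Ω) (hc : IsPreconnected Ω)
    (hq : DifferentiableOn ℂ q Ω) (hh : DifferentiableOn ℂ h Ω) {z₀ : V} (hz₀ : z₀ ∈ Ω)
    (h0 : h z₀ ≠ 0) (hint : ∫⁻ z in Ω, ‖q z / h z‖ₑ ^ 2 ∂μ ≠ ∞) :
    ∃ F : V → ℂ, DifferentiableOn ℂ F Ω ∧ ∀ z ∈ Ω, h z ≠ 0 → F z = q z / h z := by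
  choose! G δ hδ hball hGd hGeq using fun a (ha : a ∈ Ω) =>
    exists_local_extension μ hΩ hc hq hh hz₀ h0 hint ha
  refine ⟨fun z => G z z, ?_, fun z hz hz0 => hGeq z hz z (Metric.mem_ball_self (hδ z hz)) hz0⟩
  intro a ha
  have hda : DifferentiableAt ℂ (G a) a :=
    (hGd a ha).differentiableAt (Metric.ball_mem_nhds a (hδ a ha))
  refine (hda.congr_of_eventuallyEq ?_).differentiableWithinAt
  filter_upwards [Metric.ball_mem_nhds a (hδ a ha)] with z hz
  have hzΩ := hball a ha hz
  -- Two local extensions both equal q/h at points arbitrarily close to `z`, so continuity makes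
  -- them agree at `z`.
  have hfr : ∃ᶠ w in 𝓝 z, G z w = G a w := by
    refine ((frequently_ne_zero_of_isPreconnected hΩ hc hh hz₀ h0 hzΩ).and_eventually
      (inter_mem (Metric.ball_mem_nhds z (hδ z hzΩ)) (Metric.isOpen_ball.mem_nhds hz))).mono ?_
    rintro w ⟨hw0, hw1, hw2⟩
    rw [hGeq z hzΩ w hw1 hw0, hGeq a ha w hw2 hw0]
  exact tendsto_nhds_unique_of_frequently_eq
    ((hGd z hzΩ).differentiableAt (Metric.ball_mem_nhds z (hδ z hzΩ))).continuousAt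
    ((hGd a ha).differentiableAt (Metric.isOpen_ball.mem_nhds hz)).continuousAt hfr

end Removable

/-! ### Pointwise limits of bounded holomorphic functions. -/

section Limits

variable {V : Type*} [NormedAddCommGroup V] [NormedSpace ℂ V] [FiniteDimensional ℂ V]

/-- A pointwise limit of uniformly bounded holomorphic functions is holomorphic. -/
theorem differentiableAt_of_tendsto_of_norm_le {g : ℕ → V → ℂ} {G : V → ℂ} {z : V} {R M : ℝ}
    (hR : 0 < R) (hd : ∀ m, DifferentiableOn ℂ (g m) (Metric.ball z R))
    (hM : ∀ m, ∀ w ∈ Metric.ball z R, ‖g m w‖ ≤ M)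
    (hlim : ∀ w ∈ Metric.ball z R, Tendsto (fun m => g m w) atTop (𝓝 (G w))) :
    DifferentiableAt ℂ G z := by
  have : ProperSpace (V →L[ℂ] ℂ) := FiniteDimensional.proper ℂ _
  -- The derivatives at `z` are bounded, so a subsequence converges to some `A`. The quadratic
  -- remainder estimate is uniform along the sequence and passes to the limit, which identifies `A`
  -- as the derivative of `G`.
  obtain ⟨A, -, φ, hφ, hA⟩ := (isCompact_closedBall (0 : V →L[ℂ] ℂ) (2 * M / R)).tendsto_subseq
    (x := fun m => fderiv ℂ (g m) z) fun m => by
      rw [mem_closedBall_zero_iff]; exact norm_fderiv_le_of_norm_le (hd m) (hM m) hR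
  have hbound : ∀ w ∈ Metric.ball z R, ‖G w - G z - A (w - z)‖ ≤ 4 * M * (‖w - z‖ / R) ^ 2 := by
    intro w hw
    have h1 : Tendsto (fun m => ‖g (φ m) w - g (φ m) z - fderiv ℂ (g (φ m)) z (w - z)‖) atTop
        (𝓝 ‖G w - G z - A (w - z)‖) := by
      refine (((hlim w hw).comp hφ.tendsto_atTop).sub
        ((hlim z (Metric.mem_ball_self hR)).comp hφ.tendsto_atTop)).sub ?_ |>.norm
      exact ((ContinuousLinearMap.apply ℂ ℂ (w - z)).continuous.tendsto A).comp hA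
    exact le_of_tendsto h1 (Eventually.of_forall fun m =>
      norm_sub_sub_fderiv_le (hd (φ m)) (hM (φ m)) hw)
  refine HasFDerivAt.differentiableAt (f' := A) (HasFDerivAt.of_isLittleO ?_)
  have h2 : (fun w => G w - G z - A (w - z)) =O[𝓝 z] fun w => ‖w - z‖ ^ 2 := by
    refine Asymptotics.IsBigO.of_bound (4 * M / R ^ 2) ?_
    filter_upwards [Metric.ball_mem_nhds z hR] with w hw
    refine (hbound w hw).trans (le_of_eq ?_)
    rw [Real.norm_of_nonneg (by positivity)]
    field_simp
  refine h2.trans_isLittleO ?_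
  have := Asymptotics.isLittleO_pow_sub_sub (E' := V) z (m := 2) (by norm_num)
  exact this

end Limits

/-! ### The Bergman space as a Hilbert space. -/

section BergmanSpace

variable {n : ℕ} {Ω : Set (Fin n → ℂ)}

theorem MemBergmanSpace.volume_ball_mul_le {f : (Fin n → ℂ) → ℂ} (hf : MemBergmanSpace Ω f)
    {z : Fin n → ℂ} {r : ℝ} (hz : Metric.ball z r ⊆ Ω) :
    volume (Metric.ball (0 : Fin n → ℂ) r) * ‖f z‖ₑ ^ 2 ≤ ∫⁻ ξ in Ω, ‖f ξ‖ₑ ^ 2 := by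
  have h1 := measure_ball_mul_enorm_sq_le volume (hf.1.mono hz)
  rw [Measure.addHaar_ball_center] at h1
  exact h1.trans (lintegral_mono_set hz)

theorem lintegral_enorm_sq_eq {f : (Fin n → ℂ) → ℂ} :
    ∫⁻ ξ in Ω, ‖f ξ‖ₑ ^ 2 = eLpNorm f 2 (volume.restrict Ω) ^ 2 := by
  have := eLpNorm_nnreal_pow_eq_lintegral (f := f) (p := 2) (μ := volume.restrict Ω) two_ne_zero
  simpa using this.symm

/-- The constant in the bound for point evaluations on the Bergman space at points with distance at
least `r` from the boundary. -/
noncomputable def evalBound (n : ℕ) (r : ℝ) : ℝ :=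
  (Real.sqrt (volume (Metric.ball (0 : Fin n → ℂ) r)).toReal)⁻¹

theorem evalBound_nonneg {n : ℕ} (r : ℝ) : 0 ≤ evalBound n r := by
  unfold evalBound; positivity

theorem MemBergmanSpace.norm_apply_le {f : (Fin n → ℂ) → ℂ} (hf : MemBergmanSpace Ω f)
    {z : Fin n → ℂ} {r : ℝ} (hr : 0 < r) (hz : Metric.ball z r ⊆ Ω) :
    ‖f z‖ ≤ evalBound n r * (eLpNorm f 2 (volume.restrict Ω)).toReal := by
  have h1 := hf.volume_ball_mul_le hz
  rw [lintegral_enorm_sq_eq] at h1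
  have h2 := ENNReal.toReal_mono (ENNReal.pow_ne_top hf.2.2.ne) h1
  rw [ENNReal.toReal_mul, ENNReal.toReal_pow, ENNReal.toReal_pow, toReal_enorm] at h2
  have hpos : 0 < (volume (Metric.ball (0 : Fin n → ℂ) r)).toReal :=
    ENNReal.toReal_pos (Metric.measure_ball_pos volume 0 hr).ne' measure_ball_lt_top.ne
  have h3 := Real.sqrt_le_sqrt h2
  rw [Real.sqrt_mul hpos.le, Real.sqrt_sq (norm_nonneg _), Real.sqrt_sq ENNReal.toReal_nonneg] at h3
  rw [evalBound, inv_mul_eq_div, le_div_iff₀ (Real.sqrt_pos.2 hpos), mul_comm]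
  exact h3

theorem eqOn_of_ae_eq (hΩ : IsOpen Ω) {f g : (Fin n → ℂ) → ℂ} (hf : ContinuousOn f Ω)
    (hg : ContinuousOn g Ω) (h : f =ᵐ[volume.restrict Ω] g) : Set.EqOn f g Ω :=
  Measure.eqOn_of_ae_eq (μ := volume) h hf hg (by rw [hΩ.interior_eq]; exact subset_closure)

/-- The Bergman space as a subspace of `L²`. -/
def bergmanSubmodule (Ω : Set (Fin n → ℂ)) : Submodule ℂ (Lp ℂ 2 (volume.restrict Ω)) where
  carrier := {φ | ∃ g : (Fin n → ℂ) → ℂ, DifferentiableOn ℂ g Ω ∧ φ =ᵐ[volume.restrict Ω] g}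
  add_mem' := by
    rintro φ ψ ⟨g, hg, hφ⟩ ⟨h, hh, hψ⟩
    exact ⟨g + h, hg.add hh, (Lp.coeFn_add φ ψ).trans (hφ.add hψ)⟩
  zero_mem' := ⟨0, differentiableOn_const 0, Lp.coeFn_zero ℂ 2 _⟩
  smul_mem' := by
    rintro c φ ⟨g, hg, hφ⟩
    exact ⟨c • g, hg.const_smul c, (Lp.coeFn_smul c φ).trans (hφ.const_smul c)⟩

/-- The holomorphic representative of an element of the Bergman space. -/
noncomputable def holoRep (φ : bergmanSubmodule Ω) : (Fin n → ℂ) → ℂ := φ.2.choose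

theorem holoRep_differentiableOn (φ : bergmanSubmodule Ω) : DifferentiableOn ℂ (holoRep φ) Ω :=
  φ.2.choose_spec.1

theorem coe_ae_eq_holoRep (φ : bergmanSubmodule Ω) :
    (φ : Lp ℂ 2 (volume.restrict Ω)) =ᵐ[volume.restrict Ω] holoRep φ :=
  φ.2.choose_spec.2

theorem holoRep_memBergmanSpace (φ : bergmanSubmodule Ω) : MemBergmanSpace Ω (holoRep φ) :=
  ⟨holoRep_differentiableOn φ, (Lp.memLp φ.1).ae_eq (coe_ae_eq_holoRep φ)⟩

theorem holoRep_eqOn (hΩ : IsOpen Ω) (φ : bergmanSubmodule Ω) {g : (Fin n → ℂ) → ℂ}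
    (hg : DifferentiableOn ℂ g Ω)
    (h : (φ : Lp ℂ 2 (volume.restrict Ω)) =ᵐ[volume.restrict Ω] g) :
    Set.EqOn (holoRep φ) g Ω :=
  eqOn_of_ae_eq hΩ (holoRep_differentiableOn φ).continuousOn hg.continuousOn
    ((coe_ae_eq_holoRep φ).symm.trans h)

theorem norm_holoRep_apply_le (φ : bergmanSubmodule Ω) {z : Fin n → ℂ} {r : ℝ} (hr : 0 < r)
    (hz : Metric.ball z r ⊆ Ω) : ‖holoRep φ z‖ ≤ evalBound n r * ‖φ‖ := by
  refine ((holoRep_memBergmanSpace φ).norm_apply_le hr hz).trans (le_of_eq ?_)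
  rw [← eLpNorm_congr_ae (coe_ae_eq_holoRep φ)]
  rfl

theorem holoRep_sub (hΩ : IsOpen Ω) (φ ψ : bergmanSubmodule Ω) :
    Set.EqOn (holoRep (φ - ψ)) (holoRep φ - holoRep ψ) Ω :=
  holoRep_eqOn hΩ _ ((holoRep_differentiableOn φ).sub (holoRep_differentiableOn ψ))
    ((Lp.coeFn_sub φ.1 ψ.1).trans ((coe_ae_eq_holoRep φ).sub (coe_ae_eq_holoRep ψ)))

/-- Bounded point evaluations turn L² convergence into pointwise convergence of the holomorphic
representatives with local uniform bounds, so the pointwise limit is holomorphic. An almost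
everywhere convergent subsequence identifies it with the L² limit. -/
theorem isClosed_bergmanSubmodule (hΩ : IsOpen Ω) :
    IsClosed (bergmanSubmodule Ω : Set (Lp ℂ 2 (volume.restrict Ω))) := by
  refine isClosed_of_closure_subset fun φ hφ => ?_
  obtain ⟨s, hs, hlim⟩ := mem_closure_iff_seq_limit.1 hφ
  set σ : ℕ → bergmanSubmodule Ω := fun m => ⟨s m, hs m⟩ with hσ
  have hcs : CauchySeq σ := by
    have h1 : CauchySeq s := hlim.cauchySeq
    rw [Metric.cauchySeq_iff] at h1 ⊢
    exact h1
  have hptc : ∀ z ∈ Ω, CauchySeq fun m => holoRep (σ m) z := by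
    intro z hz
    obtain ⟨r, hr, hrΩ⟩ := Metric.isOpen_iff.1 hΩ z hz
    rw [Metric.cauchySeq_iff'] at hcs ⊢
    intro ε hε
    obtain ⟨N, hN⟩ := hcs (ε / (evalBound n r + 1))
      (div_pos hε (by linarith [evalBound_nonneg (n := n) r]))
    refine ⟨N, fun m hm => ?_⟩
    have h2 := norm_holoRep_apply_le (σ m - σ N) hr hrΩ
    rw [holoRep_sub hΩ _ _ hz] at h2
    have h3 := hN m hm
    rw [dist_eq_norm] at h3 ⊢
    have hb := evalBound_nonneg (n := n) r
    calc ‖holoRep (σ m) z - holoRep (σ N) z‖ ≤ evalBound n r * ‖σ m - σ N‖ := h2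
      _ ≤ (evalBound n r) * (ε / (evalBound n r + 1)) := by gcongr
      _ < (evalBound n r + 1) * (ε / (evalBound n r + 1)) := by
          have : 0 < ε / (evalBound n r + 1) := by positivity
          nlinarith
      _ = ε := by field_simp
  set g : (Fin n → ℂ) → ℂ := fun z => limUnder atTop fun m => holoRep (σ m) z with hg
  have hgl : ∀ z ∈ Ω, Tendsto (fun m => holoRep (σ m) z) atTop (𝓝 (g z)) := fun z hz =>
    (hptc z hz).tendsto_limUnder
  refine ⟨g, fun z hz => ?_, ?_⟩
  · obtain ⟨r, hr, hrΩ⟩ := Metric.isOpen_iff.1 hΩ z hz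
    obtain ⟨B, hB⟩ := hcs.isBounded_range.exists_norm_le
    have hsub : ∀ w ∈ Metric.ball z (r / 2), Metric.ball w (r / 2) ⊆ Ω := fun w hw =>
      (Metric.ball_subset_ball' (by linarith [Metric.mem_ball.1 hw])).trans hrΩ
    refine (differentiableAt_of_tendsto_of_norm_le (g := fun m => holoRep (σ m))
      (M := evalBound n (r / 2) * B) (half_pos hr) (fun m => (holoRep_differentiableOn _).mono
        ((Metric.ball_subset_ball (by linarith)).trans hrΩ)) (fun m w hw => ?_)
      (fun w hw => hgl w (hrΩ (Metric.ball_subset_ball (by linarith) hw)))).differentiableWithinAt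
    refine (norm_holoRep_apply_le _ (half_pos hr) (hsub w hw)).trans ?_
    have := evalBound_nonneg (n := n) (r / 2)
    gcongr
    exact hB _ ⟨m, rfl⟩
  · obtain ⟨ns, hns, hae⟩ := (tendstoInMeasure_of_tendsto_Lp hlim).exists_seq_tendsto_ae
    have hall : ∀ᵐ ξ ∂(volume.restrict Ω), ∀ m, s m ξ = holoRep (σ m) ξ :=
      ae_all_iff.2 fun m => coe_ae_eq_holoRep (σ m)
    filter_upwards [hae, hall, ae_restrict_mem hΩ.measurableSet] with ξ h1 h2 h3
    refine tendsto_nhds_unique h1 ?_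
    simp only [h2]
    exact (hgl ξ h3).comp hns.tendsto_atTop

/-- Point evaluation on the Bergman space. -/
noncomputable def bergmanEval (hΩ : IsOpen Ω) {w : Fin n → ℂ} (hw : w ∈ Ω) : StrongDual ℂ (bergmanSubmodule Ω) :=
  LinearMap.mkContinuousOfExistsBound
    { toFun := fun φ => holoRep φ w
      map_add' := fun φ ψ => holoRep_eqOn hΩ (φ + ψ)
        ((holoRep_differentiableOn φ).add (holoRep_differentiableOn ψ))
        ((Lp.coeFn_add φ.1 ψ.1).trans ((coe_ae_eq_holoRep φ).add (coe_ae_eq_holoRep ψ))) hw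
      map_smul' := fun c φ => holoRep_eqOn hΩ (c • φ)
        ((holoRep_differentiableOn φ).const_smul c)
        ((Lp.coeFn_smul c φ.1).trans ((coe_ae_eq_holoRep φ).const_smul c)) hw }
    (by
      obtain ⟨r, hr, hrΩ⟩ := Metric.isOpen_iff.1 hΩ w hw
      exact ⟨evalBound n r, fun φ => norm_holoRep_apply_le φ hr hrΩ⟩)

/-- Riesz representation of point evaluation on the complete space `bergmanSubmodule Ω`. -/
theorem exists_representsEval (hΩ : IsOpen Ω) {w : Fin n → ℂ} (hw : w ∈ Ω) :
    ∃ k, RepresentsEval Ω w k := by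
  have : CompleteSpace (bergmanSubmodule Ω) := (isClosed_bergmanSubmodule hΩ).completeSpace_coe
  set κ := (InnerProductSpace.toDual ℂ (bergmanSubmodule Ω)).symm (bergmanEval hΩ hw) with hκ
  refine ⟨holoRep κ, holoRep_memBergmanSpace κ, fun f hf => ?_⟩
  set φ : bergmanSubmodule Ω := ⟨hf.2.toLp f, f, hf.1, hf.2.coeFn_toLp⟩ with hφ
  have h1 : inner ℂ κ φ = holoRep φ w := InnerProductSpace.toDual_symm_apply
  have h2 : holoRep φ w = f w := holoRep_eqOn hΩ φ hf.1 hf.2.coeFn_toLp hw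
  rw [← h2, ← h1, Submodule.coe_inner, L2.inner_def]
  refine integral_congr_ae ?_
  filter_upwards [coe_ae_eq_holoRep κ, hf.2.coeFn_toLp] with ξ h3 h4
  rw [h3]
  change inner ℂ (holoRep κ ξ) (hf.2.toLp f ξ) = _
  rw [h4]
  simp

end BergmanSpace

/-! ### Basic properties of the Bergman kernel. -/

section BergmanKernel

variable {n : ℕ} {Ω : Set (Fin n → ℂ)}

theorem representsEval_bergmanKernel (hΩ : IsOpen Ω) {w : Fin n → ℂ} (hw : w ∈ Ω) :
    RepresentsEval Ω w fun z => bergmanKernel Ω z w := by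
  have h := exists_representsEval hΩ hw
  simp only [bergmanKernel, dif_pos h]
  exact Classical.choose_spec h

theorem differentiableOn_bergmanKernel (hΩ : IsOpen Ω) {w : Fin n → ℂ} (hw : w ∈ Ω) :
    DifferentiableOn ℂ (fun z => bergmanKernel Ω z w) Ω :=
  (representsEval_bergmanKernel hΩ hw).1.1

theorem memLp_bergmanKernel (hΩ : IsOpen Ω) {w : Fin n → ℂ} (hw : w ∈ Ω) :
    MemLp (fun z => bergmanKernel Ω z w) 2 (volume.restrict Ω) :=
  (representsEval_bergmanKernel hΩ hw).1.2

theorem MemBergmanSpace.apply_eq_integral (hΩ : IsOpen Ω) {f : (Fin n → ℂ) → ℂ}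
    (hf : MemBergmanSpace Ω f) {w : Fin n → ℂ} (hw : w ∈ Ω) :
    f w = ∫ ξ in Ω, f ξ * conj (bergmanKernel Ω ξ w) :=
  (representsEval_bergmanKernel hΩ hw).2 f hf

theorem bergmanKernel_eq_integral (hΩ : IsOpen Ω) {z w : Fin n → ℂ} (hz : z ∈ Ω) (hw : w ∈ Ω) :
    bergmanKernel Ω z w = ∫ ξ in Ω, bergmanKernel Ω ξ w * conj (bergmanKernel Ω ξ z) :=
  (representsEval_bergmanKernel hΩ hw).1.apply_eq_integral hΩ hz

theorem conj_bergmanKernel (hΩ : IsOpen Ω) {z w : Fin n → ℂ} (hz : z ∈ Ω) (hw : w ∈ Ω) :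
    conj (bergmanKernel Ω z w) = bergmanKernel Ω w z := by
  rw [bergmanKernel_eq_integral hΩ hz hw, bergmanKernel_eq_integral hΩ hw hz, ← integral_conj]
  refine integral_congr_ae (ae_of_all _ fun ξ => ?_)
  simp [mul_comm]

theorem norm_bergmanKernel_comm (hΩ : IsOpen Ω) {z w : Fin n → ℂ} (hz : z ∈ Ω) (hw : w ∈ Ω) :
    ‖bergmanKernel Ω z w‖ = ‖bergmanKernel Ω w z‖ := by
  rw [← conj_bergmanKernel hΩ hz hw, RCLike.norm_conj]

theorem bergmanKernel_self_eq_integral (hΩ : IsOpen Ω) {w : Fin n → ℂ} (hw : w ∈ Ω) :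
    bergmanKernel Ω w w = ((∫ ξ in Ω, ‖bergmanKernel Ω ξ w‖ ^ 2 : ℝ) : ℂ) := by
  rw [bergmanKernel_eq_integral hΩ hw hw, ← integral_complex_ofReal]
  refine integral_congr_ae (ae_of_all _ fun ξ => ?_)
  simp [Complex.mul_conj, Complex.normSq_eq_norm_sq]

theorem re_bergmanKernel_self (hΩ : IsOpen Ω) {w : Fin n → ℂ} (hw : w ∈ Ω) :
    (bergmanKernel Ω w w).re = ∫ ξ in Ω, ‖bergmanKernel Ω ξ w‖ ^ 2 := by
  rw [bergmanKernel_self_eq_integral hΩ hw, Complex.ofReal_re]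

theorem ofReal_re_bergmanKernel_self (hΩ : IsOpen Ω) {w : Fin n → ℂ} (hw : w ∈ Ω) :
    (((bergmanKernel Ω w w).re : ℝ) : ℂ) = bergmanKernel Ω w w := by
  rw [re_bergmanKernel_self hΩ hw, bergmanKernel_self_eq_integral hΩ hw]

theorem re_bergmanKernel_self_nonneg (hΩ : IsOpen Ω) {w : Fin n → ℂ} (hw : w ∈ Ω) :
    0 ≤ (bergmanKernel Ω w w).re := by
  rw [re_bergmanKernel_self hΩ hw]; positivity

theorem lintegral_bergmanKernel_sq (hΩ : IsOpen Ω) {w : Fin n → ℂ} (hw : w ∈ Ω) :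
    ∫⁻ ξ in Ω, ‖bergmanKernel Ω ξ w‖ₑ ^ 2 = ENNReal.ofReal (bergmanKernel Ω w w).re := by
  rw [re_bergmanKernel_self hΩ hw, ofReal_integral_eq_lintegral_ofReal
    ((memLp_bergmanKernel hΩ hw).integrable_norm_pow two_ne_zero)
    (ae_of_all _ fun ξ => by positivity)]
  refine lintegral_congr fun ξ => ?_
  rw [ENNReal.ofReal_pow (norm_nonneg _), ofReal_norm]

theorem memBergmanSpace_of_bounded (hΩ : IsOpen Ω) (hb : Bornology.IsBounded Ω)
    {f : (Fin n → ℂ) → ℂ} (hf : DifferentiableOn ℂ f Ω) {C : ℝ} (hC : ∀ z ∈ Ω, ‖f z‖ ≤ C) :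
    MemBergmanSpace Ω f := by
  have : IsFiniteMeasure (volume.restrict Ω) := ⟨by simpa using hb.measure_lt_top⟩
  refine ⟨hf, MemLp.of_bound (hf.continuousOn.aestronglyMeasurable hΩ.measurableSet) C ?_⟩
  filter_upwards [ae_restrict_mem hΩ.measurableSet] with z hz using hC z hz

/-- If K(w, w) were 0, then K(·, w) would vanish almost everywhere, contradicting the reproducing
property for the constant 1, which is square integrable because `Ω` is bounded. -/
theorem re_bergmanKernel_self_pos (hΩ : IsOpen Ω) (hb : Bornology.IsBounded Ω) {w : Fin n → ℂ}
    (hw : w ∈ Ω) : 0 < (bergmanKernel Ω w w).re := by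
  refine lt_of_le_of_ne (re_bergmanKernel_self_nonneg hΩ hw) fun h0 => ?_
  have h1 := lintegral_bergmanKernel_sq hΩ hw
  rw [← h0, ENNReal.ofReal_zero, lintegral_enorm_sq_eq, pow_eq_zero_iff two_ne_zero,
    eLpNorm_eq_zero_iff (memLp_bergmanKernel hΩ hw).1 two_ne_zero] at h1
  have h2 := (memBergmanSpace_of_bounded hΩ hb (f := fun _ => (1 : ℂ)) (C := 1)
    (differentiableOn_const 1) (by simp)).apply_eq_integral hΩ hw
  rw [integral_congr_ae (g := fun _ => (0 : ℂ))] at h2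
  · simp at h2
  · filter_upwards [h1] with ξ hξ
    simp only [Pi.zero_apply] at hξ
    simp [hξ]

theorem norm_sq_bergmanKernel_le (hΩ : IsOpen Ω) {z w : Fin n → ℂ} (hw : w ∈ Ω) {r : ℝ} (hr : 0 < r)
    (hz : Metric.ball z r ⊆ Ω) :
    ‖bergmanKernel Ω z w‖ ^ 2 ≤ evalBound n r ^ 2 * (bergmanKernel Ω w w).re := by
  have h1 := (representsEval_bergmanKernel hΩ hw).1.norm_apply_le hr hz
  have h2 : (eLpNorm (fun ξ => bergmanKernel Ω ξ w) 2 (volume.restrict Ω)).toReal ^ 2 =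
      (bergmanKernel Ω w w).re := by
    rw [← ENNReal.toReal_pow, ← lintegral_enorm_sq_eq, lintegral_bergmanKernel_sq hΩ hw,
      ENNReal.toReal_ofReal (re_bergmanKernel_self_nonneg hΩ hw)]
  rw [← h2, ← mul_pow]
  gcongr

theorem re_bergmanKernel_self_le (hΩ : IsOpen Ω) {w : Fin n → ℂ} {r : ℝ}
    (hr : 0 < r) (hw : Metric.ball w r ⊆ Ω) :
    (bergmanKernel Ω w w).re ≤ evalBound n r ^ 2 := by
  have hwΩ : w ∈ Ω := hw (Metric.mem_ball_self hr)
  have h1 := norm_sq_bergmanKernel_le hΩ hwΩ hr hw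
  have h0 := re_bergmanKernel_self_nonneg hΩ hwΩ
  have h2 : (bergmanKernel Ω w w).re ^ 2 ≤ ‖bergmanKernel Ω w w‖ ^ 2 := by
    rw [sq_le_sq, abs_of_nonneg h0, abs_norm]
    exact Complex.re_le_norm _
  rcases h0.eq_or_lt with h | h
  · rw [← h]; positivity
  · nlinarith

theorem norm_bergmanKernel_le (hΩ : IsOpen Ω) {z w : Fin n → ℂ} {r : ℝ} (hr : 0 < r)
    (hz : Metric.ball z r ⊆ Ω) (hw : Metric.ball w r ⊆ Ω) :
    ‖bergmanKernel Ω z w‖ ≤ evalBound n r ^ 2 := by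
  have h1 := norm_sq_bergmanKernel_le hΩ (hw (Metric.mem_ball_self hr)) hr hz
  have h2 := re_bergmanKernel_self_le hΩ hr hw
  refine abs_le_of_sq_le_sq' ?_ (by positivity) |>.2
  calc ‖bergmanKernel Ω z w‖ ^ 2 ≤ evalBound n r ^ 2 * (bergmanKernel Ω w w).re := h1
    _ ≤ evalBound n r ^ 2 * evalBound n r ^ 2 := by gcongr
    _ = (evalBound n r ^ 2) ^ 2 := by ring

theorem exists_ball_subset_of_isOpen (hΩ : IsOpen Ω) {z : Fin n → ℂ} (hz : z ∈ Ω) :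
    ∃ r > 0, ∀ w ∈ Metric.ball z r, Metric.ball w r ⊆ Ω := by
  obtain ⟨r, hr, hrΩ⟩ := Metric.isOpen_iff.1 hΩ z hz
  exact ⟨r / 2, by positivity, fun w hw =>
    (Metric.ball_subset_ball' (by linarith [Metric.mem_ball.1 hw])).trans hrΩ⟩

/-- Local bounds and the Schwarz lemma give a Lipschitz estimate in the first variable, uniform in
the second; Hermitian symmetry gives the estimate in the second variable. -/
theorem continuousOn_bergmanKernel (hΩ : IsOpen Ω) :
    ContinuousOn (fun p : (Fin n → ℂ) × (Fin n → ℂ) => bergmanKernel Ω p.1 p.2) (Ω ×ˢ Ω) := by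
  rintro ⟨z, w⟩ ⟨hz, hw⟩
  obtain ⟨r₁, hr₁, h₁⟩ := exists_ball_subset_of_isOpen hΩ hz
  obtain ⟨r₂, hr₂, h₂⟩ := exists_ball_subset_of_isOpen hΩ hw
  simp only at hz hw
  set r := min r₁ r₂ with hr
  have hrpos : 0 < r := lt_min hr₁ hr₂
  have hb₁ : ∀ x ∈ Metric.ball z r, Metric.ball x r ⊆ Ω := fun x hx =>
    (Metric.ball_subset_ball (min_le_left _ _)).trans
      (h₁ x (Metric.ball_subset_ball (min_le_left _ _) hx))
  have hb₂ : ∀ x ∈ Metric.ball w r, Metric.ball x r ⊆ Ω := fun x hx =>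
    (Metric.ball_subset_ball (min_le_right _ _)).trans
      (h₂ x (Metric.ball_subset_ball (min_le_right _ _) hx))
  set M := evalBound n r ^ 2
  have hlip : ∀ x ∈ Metric.ball z r, ∀ y ∈ Metric.ball w r,
      ‖bergmanKernel Ω x y - bergmanKernel Ω z w‖ ≤
        2 * M / r * ‖x - z‖ + 2 * M / r * ‖y - w‖ := by
    intro x hx y hy
    have hyΩ : y ∈ Ω := hb₂ y hy (Metric.mem_ball_self hrpos)
    have e1 : ‖bergmanKernel Ω x y - bergmanKernel Ω z y‖ ≤ 2 * M / r * ‖x - z‖ :=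
      norm_sub_le_of_norm_le (f := fun z => bergmanKernel Ω z y)
        ((differentiableOn_bergmanKernel hΩ hyΩ).mono (hb₁ z (Metric.mem_ball_self hrpos)))
        (fun x' hx' => norm_bergmanKernel_le hΩ hrpos (hb₁ x' hx') (hb₂ y hy)) hx
    have e2 : ‖bergmanKernel Ω y z - bergmanKernel Ω w z‖ ≤ 2 * M / r * ‖y - w‖ :=
      norm_sub_le_of_norm_le (f := fun x => bergmanKernel Ω x z)
        ((differentiableOn_bergmanKernel hΩ hz).mono (hb₂ w (Metric.mem_ball_self hrpos)))
        (fun y' hy' => norm_bergmanKernel_le hΩ hrpos (hb₂ y' hy')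
          (hb₁ z (Metric.mem_ball_self hrpos))) hy
    have e3 : ‖bergmanKernel Ω z y - bergmanKernel Ω z w‖ =
        ‖bergmanKernel Ω y z - bergmanKernel Ω w z‖ := by
      rw [← conj_bergmanKernel hΩ hz hyΩ, ← conj_bergmanKernel hΩ hz hw, ← map_sub,
        RCLike.norm_conj]
    calc ‖bergmanKernel Ω x y - bergmanKernel Ω z w‖
        ≤ ‖bergmanKernel Ω x y - bergmanKernel Ω z y‖ +
          ‖bergmanKernel Ω z y - bergmanKernel Ω z w‖ := norm_sub_le_norm_sub_add_norm_sub _ _ _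
      _ ≤ _ := by rw [e3]; gcongr
  refine ContinuousAt.continuousWithinAt ?_
  rw [ContinuousAt, tendsto_iff_norm_sub_tendsto_zero]
  have hlim : Tendsto (fun p : (Fin n → ℂ) × (Fin n → ℂ) =>
      2 * M / r * ‖p.1 - z‖ + 2 * M / r * ‖p.2 - w‖) (𝓝 (z, w)) (𝓝 0) := by
    have : Continuous fun p : (Fin n → ℂ) × (Fin n → ℂ) =>
      2 * M / r * ‖p.1 - z‖ + 2 * M / r * ‖p.2 - w‖ := by fun_prop
    simpa using this.tendsto (z, w)
  refine squeeze_zero' (Eventually.of_forall fun _ => norm_nonneg _) ?_ hlim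
  have hnh : Metric.ball z r ×ˢ Metric.ball w r ∈ 𝓝 (z, w) :=
    prod_mem_nhds (Metric.ball_mem_nhds z hrpos) (Metric.ball_mem_nhds w hrpos)
  filter_upwards [hnh] with p hp
  exact hlip p.1 hp.1 p.2 hp.2

/-- The Bergman kernel extended by zero. -/
noncomputable def bergmanKernelExt (Ω : Set (Fin n → ℂ)) (p : (Fin n → ℂ) × (Fin n → ℂ)) : ℂ :=
  (Ω ×ˢ Ω).indicator (fun p : (Fin n → ℂ) × (Fin n → ℂ) => bergmanKernel Ω p.1 p.2) p

theorem measurable_bergmanKernelExt (hΩ : IsOpen Ω) : Measurable (bergmanKernelExt Ω) :=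
  measurable_indicator_of_continuousOn (hΩ.prod hΩ).measurableSet (continuousOn_bergmanKernel hΩ)

theorem bergmanKernelExt_of_mem {z w : Fin n → ℂ} (hz : z ∈ Ω) (hw : w ∈ Ω) :
    bergmanKernelExt Ω (z, w) = bergmanKernel Ω z w :=
  Set.indicator_of_mem (Set.mk_mem_prod hz hw) _

/-- Locally in the first variable, the Bergman kernel is dominated by a square integrable
function. -/
theorem exists_memLp_bound_bergmanKernel (hΩ : IsOpen Ω) {z₀ : Fin n → ℂ} (hz₀ : z₀ ∈ Ω) :
    ∃ ρ > 0, Metric.ball z₀ ρ ⊆ Ω ∧ ∃ G : (Fin n → ℂ) → ℝ, Measurable G ∧ (∀ ξ, 0 ≤ G ξ) ∧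
      MemLp G 2 (volume.restrict Ω) ∧
      ∀ z ∈ Metric.ball z₀ ρ, ∀ ξ ∈ Ω, ‖bergmanKernel Ω z ξ‖ ≤ G ξ := by
  obtain ⟨r, hr, hrΩ⟩ := exists_ball_subset_of_isOpen hΩ hz₀
  set B := Metric.ball z₀ r with hB
  have hBΩ : B ⊆ Ω := hrΩ z₀ (Metric.mem_ball_self hr)
  set v : ℝ≥0∞ := volume (Metric.ball (0 : Fin n → ℂ) (r / 2)) with hv
  have hv0 : v ≠ 0 := (Metric.measure_ball_pos volume 0 (half_pos hr)).ne'
  have hvt : v ≠ ∞ := measure_ball_lt_top.ne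
  -- The sub-mean value inequality in `z` bounds |K(z, ξ)|² by v⁻¹ Γ(ξ) for all `z` in the smaller
  -- ball. By Tonelli the integral of Γ over `Ω` is that of K(w, w) over `B`, which is finite.
  set Γ : (Fin n → ℂ) → ℝ≥0∞ := fun ξ => ∫⁻ w in B, ‖bergmanKernelExt Ω (w, ξ)‖ₑ ^ 2 with hΓ
  have hm : Measurable fun p : (Fin n → ℂ) × (Fin n → ℂ) => ‖bergmanKernelExt Ω (p.2, p.1)‖ₑ ^ 2 :=
    ((measurable_bergmanKernelExt hΩ).comp measurable_swap).enorm.pow_const 2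
  have hΓm : Measurable Γ := hm.lintegral_prod_right'
  have hΓeq : ∀ ξ ∈ Ω, Γ ξ = ∫⁻ w in B, ‖bergmanKernel Ω w ξ‖ₑ ^ 2 := fun ξ hξ =>
    setLIntegral_congr_fun Metric.isOpen_ball.measurableSet fun w hw => by
      simp only [bergmanKernelExt_of_mem (hBΩ hw) hξ]
  have hΓfin : ∀ ξ ∈ Ω, Γ ξ ≠ ∞ := by
    intro ξ hξ
    rw [hΓeq ξ hξ]
    refine ne_top_of_le_ne_top ?_ (lintegral_mono_set hBΩ)
    rw [lintegral_bergmanKernel_sq hΩ hξ]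
    exact ENNReal.ofReal_ne_top
  have hΓint : ∫⁻ ξ in Ω, Γ ξ ≠ ∞ := by
    have h1 : ∫⁻ ξ in Ω, Γ ξ = ∫⁻ w in B, ∫⁻ ξ in Ω, ‖bergmanKernelExt Ω (w, ξ)‖ₑ ^ 2 :=
      lintegral_lintegral_swap (f := fun ξ w => ‖bergmanKernelExt Ω (w, ξ)‖ₑ ^ 2) hm.aemeasurable
    rw [h1]
    refine ne_top_of_le_ne_top (b := ∫⁻ _ in B, ENNReal.ofReal (evalBound n r ^ 2)) ?_ ?_
    · rw [setLIntegral_const]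
      exact ENNReal.mul_ne_top ENNReal.ofReal_ne_top measure_ball_lt_top.ne
    · refine setLIntegral_mono' Metric.isOpen_ball.measurableSet fun w hw => ?_
      have h2 : ∫⁻ ξ in Ω, ‖bergmanKernelExt Ω (w, ξ)‖ₑ ^ 2 =
          ∫⁻ ξ in Ω, ‖bergmanKernel Ω ξ w‖ₑ ^ 2 :=
        setLIntegral_congr_fun hΩ.measurableSet fun ξ hξ => by
          simp only [bergmanKernelExt_of_mem (hBΩ hw) hξ]
          rw [← ofReal_norm, norm_bergmanKernel_comm hΩ (hBΩ hw) hξ, ofReal_norm]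
      rw [h2, lintegral_bergmanKernel_sq hΩ (hBΩ hw)]
      exact ENNReal.ofReal_le_ofReal (re_bergmanKernel_self_le hΩ hr (hrΩ w hw))
  set G : (Fin n → ℂ) → ℝ := fun ξ => Real.sqrt ((v⁻¹ * Γ ξ).toReal) with hG
  have hGm : Measurable G := ((hΓm.const_mul v⁻¹).ennreal_toReal).sqrt
  refine ⟨r / 2, half_pos hr, (Metric.ball_subset_ball (by linarith)).trans hBΩ, G, hGm,
    fun ξ => Real.sqrt_nonneg _, ?_, ?_⟩
  · refine ⟨hGm.aestronglyMeasurable, ?_⟩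
    have h3 : ∫⁻ ξ in Ω, ‖G ξ‖ₑ ^ 2 ≠ ∞ := by
      refine ne_top_of_le_ne_top (b := v⁻¹ * ∫⁻ ξ in Ω, Γ ξ) ?_ ?_
      · exact ENNReal.mul_ne_top (ENNReal.inv_ne_top.2 hv0) hΓint
      · rw [← lintegral_const_mul _ hΓm]
        refine lintegral_mono fun ξ => ?_
        rw [hG, Real.enorm_of_nonneg (Real.sqrt_nonneg _),
          ← ENNReal.ofReal_pow (Real.sqrt_nonneg _), Real.sq_sqrt ENNReal.toReal_nonneg]
        exact ENNReal.ofReal_toReal_le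
    have h4 := eLpNorm_nnreal_pow_eq_lintegral (f := G) (p := 2) (μ := volume.restrict Ω) two_ne_zero
    simp only [NNReal.coe_ofNat, ENNReal.rpow_ofNat, ENNReal.coe_ofNat] at h4
    rw [← h4] at h3
    exact lt_top_iff_ne_top.2 fun h => h3 (by rw [h]; simp)
  · intro z hz ξ hξ
    have hzB : Metric.ball z (r / 2) ⊆ B :=
      Metric.ball_subset_ball' (by linarith [Metric.mem_ball.1 hz])
    have h5 := measure_ball_mul_enorm_sq_le volume
      ((differentiableOn_bergmanKernel hΩ hξ).mono (hzB.trans hBΩ))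
    rw [Measure.addHaar_ball_center] at h5
    have h6 : v * ‖bergmanKernel Ω z ξ‖ₑ ^ 2 ≤ Γ ξ := by
      rw [hΓeq ξ hξ]; exact h5.trans (lintegral_mono_set hzB)
    have h7 : ‖bergmanKernel Ω z ξ‖ₑ ^ 2 ≤ v⁻¹ * Γ ξ := by
      calc ‖bergmanKernel Ω z ξ‖ₑ ^ 2 = v⁻¹ * (v * ‖bergmanKernel Ω z ξ‖ₑ ^ 2) := by
            rw [← mul_assoc, ENNReal.inv_mul_cancel hv0 hvt, one_mul]
        _ ≤ v⁻¹ * Γ ξ := by gcongr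
    have h8 := ENNReal.toReal_mono
      (ENNReal.mul_ne_top (ENNReal.inv_ne_top.2 hv0) (hΓfin ξ hξ)) h7
    rw [ENNReal.toReal_pow, toReal_enorm] at h8
    exact Real.le_sqrt_of_sq_le h8

end BergmanKernel

/-! ### From pointwise holomorphy to differentiability in L². -/

section LpValued

variable {V : Type*} [NormedAddCommGroup V] [NormedSpace ℂ V] [FiniteDimensional ℂ V]
  {X : Type*} [MeasurableSpace X] {μ : Measure X} {f : V → X → ℂ} {G : X → ℝ} {z₀ : V} {ρ : ℝ}

theorem tendsto_differenceQuotient {g : V → ℂ} {z : V} (hg : DifferentiableAt ℂ g z) (v : V) :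
    Tendsto (fun m : ℕ => ((m : ℂ) + 1) * (g (z + ((m : ℂ) + 1)⁻¹ • v) - g z)) atTop
      (𝓝 (fderiv ℂ g z v)) := by
  refine hg.hasFDerivAt.lim v (c := fun m : ℕ => ((m : ℂ) + 1)) ?_
  have : Tendsto (fun m : ℕ => ((m : ℝ) + 1)) atTop atTop :=
    tendsto_atTop_add_const_right _ _ tendsto_natCast_atTop_atTop
  refine this.congr fun m => ?_
  have : ((m : ℂ) + 1) = ((m + 1 : ℝ) : ℂ) := by push_cast; ring
  rw [this, Complex.norm_real, Real.norm_of_nonneg (by positivity)]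

theorem exists_forall_add_smul_mem_ball {z : V} (hρ : 0 < ρ) (v : V) :
    ∃ N : ℕ, ∀ m ≥ N, z + ((m : ℂ) + 1)⁻¹ • v ∈ Metric.ball z ρ := by
  have hlim0 : Tendsto (fun m : ℕ => ((m : ℂ) + 1)⁻¹) atTop (𝓝 0) := by
    have := tendsto_one_div_add_atTop_nhds_zero_nat (𝕜 := ℂ)
    simpa using this
  have hz : Tendsto (fun m : ℕ => z + ((m : ℂ) + 1)⁻¹ • v) atTop (𝓝 z) := by
    simpa using (hlim0.smul_const v).const_add z
  exact eventually_atTop.1 (hz.eventually (Metric.ball_mem_nhds z hρ))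

theorem aestronglyMeasurable_fderiv_apply {z : V} (hρ : 0 < ρ)
    (hd : ∀ᵐ ξ ∂μ, DifferentiableOn ℂ (fun x => f x ξ) (Metric.ball z ρ))
    (hm : ∀ x ∈ Metric.ball z ρ, AEStronglyMeasurable (f x) μ) (v : V) :
    AEStronglyMeasurable (fun ξ => fderiv ℂ (fun x => f x ξ) z v) μ := by
  -- The derivative is a limit of difference quotients; the shift by `N` keeps all the points used
  -- inside the ball where measurability is known.
  obtain ⟨N, hN⟩ := exists_forall_add_smul_mem_ball (z := z) hρ v
  refine aestronglyMeasurable_of_tendsto_ae (u := atTop)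
    (f := fun (m : ℕ) ξ => (((m + N : ℕ) : ℂ) + 1) *
      (f (z + (((m + N : ℕ) : ℂ) + 1)⁻¹ • v) ξ - f z ξ)) (fun m => ?_) ?_
  · exact ((hm _ (hN _ (Nat.le_add_left N m))).sub (hm z (Metric.mem_ball_self hρ))).const_mul _
  · filter_upwards [hd] with ξ hξ
    exact (tendsto_differenceQuotient (hξ.differentiableAt (Metric.ball_mem_nhds z hρ)) v).comp
      (tendsto_add_atTop_nat N)

/-- A pointwise holomorphic family that is dominated by a square integrable function is
differentiable as a map into `L²`. -/
theorem exists_hasFDerivAt_Lp (hG : MemLp G 2 μ)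
    (hd : ∀ᵐ ξ ∂μ, DifferentiableOn ℂ (fun x => f x ξ) (Metric.ball z₀ ρ))
    (hb : ∀ᵐ ξ ∂μ, ∀ x ∈ Metric.ball z₀ ρ, ‖f x ξ‖ ≤ G ξ)
    (hm : ∀ x ∈ Metric.ball z₀ ρ, AEStronglyMeasurable (f x) μ)
    {Ψ : V → Lp ℂ 2 μ} (hΨ : ∀ x ∈ Metric.ball z₀ ρ, Ψ x =ᵐ[μ] f x) {z : V}
    (hz : z ∈ Metric.ball z₀ ρ) :
    ∃ L : V →L[ℂ] Lp ℂ 2 μ, HasFDerivAt Ψ L z ∧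
      ∀ v, L v =ᵐ[μ] fun ξ => fderiv ℂ (fun x => f x ξ) z v := by
  obtain ⟨r, hr, hrρ⟩ := Metric.isOpen_iff.1 Metric.isOpen_ball z hz
  have hd' : ∀ᵐ ξ ∂μ, DifferentiableOn ℂ (fun x => f x ξ) (Metric.ball z r) := by
    filter_upwards [hd] with ξ hξ using hξ.mono hrρ
  have hb' : ∀ᵐ ξ ∂μ, ∀ x ∈ Metric.ball z r, ‖f x ξ‖ ≤ G ξ := by
    filter_upwards [hb] with ξ hξ x hx using hξ x (hrρ hx)
  have hmem : ∀ v, MemLp (fun ξ => fderiv ℂ (fun x => f x ξ) z v) 2 μ := by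
    intro v
    refine hG.of_le_mul (c := 2 / r * ‖v‖)
      (aestronglyMeasurable_fderiv_apply hr hd' (fun x hx => hm x (hrρ hx)) v) ?_
    filter_upwards [hd', hb'] with ξ h1 h2
    calc ‖fderiv ℂ (fun x => f x ξ) z v‖ ≤ ‖fderiv ℂ (fun x => f x ξ) z‖ * ‖v‖ :=
          ContinuousLinearMap.le_opNorm _ _
      _ ≤ 2 * G ξ / r * ‖v‖ := by gcongr; exact norm_fderiv_le_of_norm_le h1 h2 hr
      _ = 2 / r * ‖v‖ * G ξ := by ring
      _ ≤ 2 / r * ‖v‖ * ‖G ξ‖ := by gcongr; exact le_abs_self _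
  set L₀ : V →ₗ[ℂ] Lp ℂ 2 μ :=
    { toFun := fun v => (hmem v).toLp _
      map_add' := fun v w => by
        refine Lp.ext ?_
        filter_upwards [(hmem (v + w)).coeFn_toLp, (hmem v).coeFn_toLp, (hmem w).coeFn_toLp,
          Lp.coeFn_add ((hmem v).toLp _) ((hmem w).toLp _)] with ξ h1 h2 h3 h4
        rw [h1, h4, Pi.add_apply, h2, h3, map_add]
      map_smul' := fun c v => by
        refine Lp.ext ?_
        filter_upwards [(hmem (c • v)).coeFn_toLp, (hmem v).coeFn_toLp,
          Lp.coeFn_smul c ((hmem v).toLp _)] with ξ h1 h2 h3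
        rw [h1, RingHom.id_apply, h3, Pi.smul_apply, h2, map_smul] } with hL₀
  set L : V →L[ℂ] Lp ℂ 2 μ := LinearMap.toContinuousLinearMap L₀ with hL
  have hLv : ∀ v, L v =ᵐ[μ] fun ξ => fderiv ℂ (fun x => f x ξ) z v := fun v =>
    (hmem v).coeFn_toLp
  refine ⟨L, HasFDerivAt.of_isLittleO ?_, hLv⟩
  -- The pointwise second order remainder is a multiple of `G ξ`, so it integrates to a quadratic
  -- remainder in L² norm.
  have hbound : ∀ w ∈ Metric.ball z r,
      ‖Ψ w - Ψ z - L (w - z)‖ ≤ 4 / r ^ 2 * ‖w - z‖ ^ 2 * ‖hG.toLp G‖ := by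
    intro w hw
    refine Lp.norm_le_mul_norm_of_ae_le_mul ?_
    filter_upwards [hd', hb', Lp.coeFn_sub (Ψ w - Ψ z) (L (w - z)), Lp.coeFn_sub (Ψ w) (Ψ z),
      hΨ w (hrρ hw), hΨ z hz, hLv (w - z), hG.coeFn_toLp] with ξ h1 h2 h3 h4 h5 h6 h7 h8
    rw [h3, Pi.sub_apply, h4, Pi.sub_apply, h5, h6, h7, h8]
    refine (norm_sub_sub_fderiv_le h1 h2 hw).trans ?_
    calc 4 * G ξ * (‖w - z‖ / r) ^ 2 = 4 / r ^ 2 * ‖w - z‖ ^ 2 * G ξ := by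
          field_simp
      _ ≤ 4 / r ^ 2 * ‖w - z‖ ^ 2 * ‖G ξ‖ := by gcongr; exact le_abs_self _
  have h2 : (fun w => Ψ w - Ψ z - L (w - z)) =O[𝓝 z] fun w => ‖w - z‖ ^ 2 := by
    refine Asymptotics.IsBigO.of_bound (4 / r ^ 2 * ‖hG.toLp G‖) ?_
    filter_upwards [Metric.ball_mem_nhds z hr] with w hw
    refine (hbound w hw).trans (le_of_eq ?_)
    rw [Real.norm_of_nonneg (by positivity)]
    ring
  exact h2.trans_isLittleO (Asymptotics.isLittleO_pow_sub_sub (E' := V) z (m := 2) (by norm_num))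

end LpValued

/-! ### Wirtinger derivatives of the logarithm of a squared norm. -/

section LogNorm

variable {n : ℕ} {E : Type*} [NormedAddCommGroup E] [InnerProductSpace ℂ E]

theorem single_I_eq {n : ℕ} (α : Fin n) :
    (Pi.single α Complex.I : Fin n → ℂ) = Complex.I • Pi.single α 1 := by
  rw [← Pi.single_smul]; simp

theorem hasFDerivAt_ofReal_log_norm_sq {Ψ : (Fin n → ℂ) → E} {L : (Fin n → ℂ) →L[ℂ] E}
    {z : Fin n → ℂ} (hΨ : HasFDerivAt Ψ L z) (h0 : Ψ z ≠ 0) :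
    ∃ D : (Fin n → ℂ) →L[ℝ] ℂ,
      HasFDerivAt (fun ζ => ((Real.log (‖Ψ ζ‖ ^ 2) : ℝ) : ℂ)) D z ∧
      ∀ v, D v = (inner ℂ (Ψ z) (L v) + inner ℂ (L v) (Ψ z)) / ((‖Ψ z‖ ^ 2 : ℝ) : ℂ) := by
  let _ : InnerProductSpace ℝ E := InnerProductSpace.rclikeToReal ℂ E
  have h1 : HasFDerivAt Ψ (L.restrictScalars ℝ) z := hΨ.restrictScalars ℝ
  have h2 := h1.norm_sq
  have h3 := h2.log (by simpa using h0)
  have h4 := (Complex.ofRealCLM.hasFDerivAt).comp z h3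
  refine ⟨_, h4, fun v => ?_⟩
  have h5 : (inner ℂ (Ψ z) (L v) + inner ℂ (L v) (Ψ z)) =
      ((2 * inner ℝ (Ψ z) (L v) : ℝ) : ℂ) := by
    rw [← inner_conj_symm (L v) (Ψ z), Complex.add_conj]
    rfl
  rw [h5]
  simp [div_eq_inv_mul]

/-- The real derivative of ‖Ψ‖² has a part complex linear in the direction and a conjugate linear
one. The conjugate Wirtinger operator kills the former and keeps the latter; `wirtinger_log_norm_sq`
is the mirror image. -/
theorem wirtingerBar_log_norm_sq {Ψ : (Fin n → ℂ) → E} {L : (Fin n → ℂ) →L[ℂ] E}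
    {z : Fin n → ℂ} (hΨ : HasFDerivAt Ψ L z) (h0 : Ψ z ≠ 0) (β : Fin n) :
    wirtingerBar β (fun ζ => ((Real.log (‖Ψ ζ‖ ^ 2) : ℝ) : ℂ)) z =
      inner ℂ (L (Pi.single β 1)) (Ψ z) / ((‖Ψ z‖ ^ 2 : ℝ) : ℂ) := by
  obtain ⟨D, hD, hDv⟩ := hasFDerivAt_ofReal_log_norm_sq hΨ h0
  rw [wirtingerBar, hD.fderiv, hDv, hDv, single_I_eq, map_smul, inner_smul_left, inner_smul_right,
    Complex.conj_I]
  linear_combination (-inner ℂ (Ψ z) (L (Pi.single β 1)) + inner ℂ (L (Pi.single β 1)) (Ψ z)) / 2 /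
    ((‖Ψ z‖ ^ 2 : ℝ) : ℂ) * Complex.I_sq * (-1)

theorem wirtinger_log_norm_sq {Ψ : (Fin n → ℂ) → E} {L : (Fin n → ℂ) →L[ℂ] E}
    {z : Fin n → ℂ} (hΨ : HasFDerivAt Ψ L z) (h0 : Ψ z ≠ 0) (β : Fin n) :
    wirtinger β (fun ζ => ((Real.log (‖Ψ ζ‖ ^ 2) : ℝ) : ℂ)) z =
      inner ℂ (Ψ z) (L (Pi.single β 1)) / ((‖Ψ z‖ ^ 2 : ℝ) : ℂ) := by
  obtain ⟨D, hD, hDv⟩ := hasFDerivAt_ofReal_log_norm_sq hΨ h0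
  rw [wirtinger, hD.fderiv, hDv, hDv, single_I_eq, map_smul, inner_smul_left, inner_smul_right,
    Complex.conj_I]
  linear_combination (-inner ℂ (Ψ z) (L (Pi.single β 1)) + inner ℂ (L (Pi.single β 1)) (Ψ z)) / 2 /
    ((‖Ψ z‖ ^ 2 : ℝ) : ℂ) * Complex.I_sq

/-- The complex Hessian of `log ‖Ψ‖²` for a holomorphic map `Ψ` into a Hilbert space. -/
theorem wirtinger_wirtingerBar_log_norm_sq {Ψ : (Fin n → ℂ) → E}
    {L : (Fin n → ℂ) → (Fin n → ℂ) →L[ℂ] E} {z : Fin n → ℂ}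
    (hΨ : ∀ᶠ ζ in 𝓝 z, HasFDerivAt Ψ (L ζ) ζ) (h0 : Ψ z ≠ 0) (α β : Fin n)
    (hL : DifferentiableAt ℂ (fun ζ => L ζ (Pi.single β 1)) z) :
    wirtinger α (wirtingerBar β fun ζ => ((Real.log (‖Ψ ζ‖ ^ 2) : ℝ) : ℂ)) z =
      inner ℂ (L z (Pi.single β 1)) (L z (Pi.single α 1)) / ((‖Ψ z‖ ^ 2 : ℝ) : ℂ) -
      inner ℂ (L z (Pi.single β 1)) (Ψ z) * inner ℂ (Ψ z) (L z (Pi.single α 1)) /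
        ((‖Ψ z‖ ^ 2 : ℝ) : ℂ) ^ 2 := by
  have hz := hΨ.self_of_nhds
  have hcont : ∀ᶠ ζ in 𝓝 z, Ψ ζ ≠ 0 := hz.continuousAt.eventually_ne h0
  have hN : ∀ ζ, ((‖Ψ ζ‖ ^ 2 : ℝ) : ℂ) = inner ℂ (Ψ ζ) (Ψ ζ) := fun ζ => by
    rw [inner_self_eq_norm_sq_to_K]; simp
  have hev : (wirtingerBar β fun ζ => ((Real.log (‖Ψ ζ‖ ^ 2) : ℝ) : ℂ)) =ᶠ[𝓝 z]
      fun ζ => inner ℂ (L ζ (Pi.single β 1)) (Ψ ζ) * (inner ℂ (Ψ ζ) (Ψ ζ))⁻¹ := by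
    filter_upwards [hΨ, hcont] with ζ h1 h2
    rw [wirtingerBar_log_norm_sq h1 h2, hN, div_eq_mul_inv]
  set e : Fin n → ℂ := Pi.single β 1 with he
  have hLr : HasFDerivAt (fun ζ => L ζ e) ((fderiv ℂ (fun ζ => L ζ e) z).restrictScalars ℝ) z :=
    hL.hasFDerivAt.restrictScalars ℝ
  have hΨr : HasFDerivAt Ψ ((L z).restrictScalars ℝ) z := hz.restrictScalars ℝ
  have h1 := hLr.inner ℂ hΨr
  have h2 := hΨr.inner ℂ hΨr
  have h3 : inner ℂ (Ψ z) (Ψ z) ≠ (0 : ℂ) := by simpa using h0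
  have h4 := h1.mul ((hasFDerivAt_inv (𝕜 := ℂ) h3).restrictScalars ℝ |>.comp z h2)
  have h5 := h4.congr_of_eventuallyEq hev
  rw [wirtinger, h5.fderiv, single_I_eq, hN]
  set c := inner ℂ (Ψ z) (Ψ z) with hc
  set M := fderiv ℂ (fun ζ => L ζ e) z with hM
  simp only [add_apply, smul_apply,
    ContinuousLinearMap.comp_apply, ContinuousLinearMap.coe_restrictScalars', fderivInnerCLM_apply,
    ContinuousLinearMap.prod_apply, ContinuousLinearMap.toSpanSingleton_apply, map_smul,
    inner_smul_left, inner_smul_right, Complex.conj_I, smul_eq_mul, Function.comp_apply]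
  rw [← hc]
  generalize inner ℂ (L z e) (Ψ z) = A
  generalize inner ℂ (Ψ z) (L z (Pi.single α 1)) = x
  generalize inner ℂ (L z (Pi.single α 1)) (Ψ z) = x'
  generalize inner ℂ (L z e) (L z (Pi.single α 1)) = y
  generalize inner ℂ (M (Pi.single α 1)) (Ψ z) = w
  -- The terms `w` and `x'` are conjugate linear in the direction, so they drop out of the
  -- holomorphic Wirtinger derivative; no second derivative of `Ψ` survives.
  linear_combination -(A * (-(c ^ 2)⁻¹) * (x - x') + c⁻¹ * (y - w)) / 2 * Complex.I_sq

end LogNorm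

/-! ### Calculus rules for Wirtinger derivatives. -/

section Wirtinger

variable {n : ℕ} {f g : (Fin n → ℂ) → ℂ} {z : Fin n → ℂ}

theorem wirtinger_congr (h : f =ᶠ[𝓝 z] g) (α : Fin n) : wirtinger α f z = wirtinger α g z := by
  rw [wirtinger, wirtinger, h.fderiv_eq]

theorem wirtingerBar_congr (h : f =ᶠ[𝓝 z] g) (α : Fin n) :
    wirtingerBar α f =ᶠ[𝓝 z] wirtingerBar α g := by
  filter_upwards [h.eventuallyEq_nhds] with ζ hζ
  rw [wirtingerBar, wirtingerBar, hζ.fderiv_eq]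

theorem wirtinger_sub (hf : DifferentiableAt ℝ f z) (hg : DifferentiableAt ℝ g z) (α : Fin n) :
    wirtinger α (fun ζ => f ζ - g ζ) z = wirtinger α f z - wirtinger α g z := by
  rw [wirtinger, wirtinger, wirtinger, fderiv_fun_sub hf hg]
  simp only [sub_apply]
  ring

end Wirtinger

/-! ### The kernel as a holomorphic map into L², and the Bergman metric as a Gram matrix. -/

section KernelDerivatives

variable {n : ℕ} {Ω : Set (Fin n → ℂ)} {z₀ : Fin n → ℂ}

/-- A Hilbert space model of the Bergman kernel near a point: `Ψ z` is the class of `K(z, ·)` and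
`L z v` the class of its derivative in direction `v`. -/
structure KernelModel (Ω : Set (Fin n → ℂ)) (z₀ : Fin n → ℂ) where
  radius : ℝ
  bound : (Fin n → ℂ) → ℝ
  Ψ : (Fin n → ℂ) → Lp ℂ 2 (volume.restrict Ω)
  L : (Fin n → ℂ) → (Fin n → ℂ) →L[ℂ] Lp ℂ 2 (volume.restrict Ω)
  isOpen : IsOpen Ω
  isBounded : Bornology.IsBounded Ω
  radius_pos : 0 < radius
  ball_subset : Metric.ball z₀ radius ⊆ Ω
  bound_measurable : Measurable bound
  bound_nonneg : ∀ ξ, 0 ≤ bound ξ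
  bound_memLp : MemLp bound 2 (volume.restrict Ω)
  norm_le : ∀ z ∈ Metric.ball z₀ radius, ∀ ξ ∈ Ω, ‖bergmanKernel Ω z ξ‖ ≤ bound ξ
  Ψ_ae : ∀ z ∈ Metric.ball z₀ radius, Ψ z =ᵐ[volume.restrict Ω] fun ξ => bergmanKernel Ω z ξ
  hasFDerivAt : ∀ z ∈ Metric.ball z₀ radius, HasFDerivAt Ψ (L z) z
  L_ae : ∀ z ∈ Metric.ball z₀ radius, ∀ v,
    L z v =ᵐ[volume.restrict Ω] fun ξ => fderiv ℂ (fun x => bergmanKernel Ω x ξ) z v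
  differentiableAt_L : ∀ v, DifferentiableAt ℂ (fun z => L z v) z₀

/-- Local domination by a square integrable function makes `z ↦ K(z, ·)` differentiable into L². The
same criterion, applied to the directional derivatives on the ball of half the radius with a
Cauchy-type bound, gives differentiability of `L` at the centre. -/
theorem nonempty_kernelModel (hΩ : IsOpen Ω) (hb : Bornology.IsBounded Ω) (hz₀ : z₀ ∈ Ω) :
    Nonempty (KernelModel Ω z₀) := by
  classical
  obtain ⟨ρ, hρ, hρΩ, G, hGm, hG0, hGL, hGb⟩ := exists_memLp_bound_bergmanKernel hΩ hz₀
  have hd : ∀ᵐ ξ ∂(volume.restrict Ω),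
      DifferentiableOn ℂ (fun x => bergmanKernel Ω x ξ) (Metric.ball z₀ ρ) := by
    filter_upwards [ae_restrict_mem hΩ.measurableSet] with ξ hξ
    exact (differentiableOn_bergmanKernel hΩ hξ).mono hρΩ
  have hbd : ∀ᵐ ξ ∂(volume.restrict Ω), ∀ x ∈ Metric.ball z₀ ρ, ‖bergmanKernel Ω x ξ‖ ≤ G ξ := by
    filter_upwards [ae_restrict_mem hΩ.measurableSet] with ξ hξ x hx using hGb x hx ξ hξ
  have hmem : ∀ z ∈ Ω, MemLp (fun ξ => bergmanKernel Ω z ξ) 2 (volume.restrict Ω) := by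
    intro z hz
    refine (memLp_bergmanKernel hΩ hz).star.ae_eq ?_
    filter_upwards [ae_restrict_mem hΩ.measurableSet] with ξ hξ
    exact conj_bergmanKernel hΩ hξ hz
  set Ψ : (Fin n → ℂ) → Lp ℂ 2 (volume.restrict Ω) := fun z =>
    if hz : z ∈ Ω then (hmem z hz).toLp _ else 0 with hΨdef
  have hΨ : ∀ z ∈ Metric.ball z₀ ρ, Ψ z =ᵐ[volume.restrict Ω] fun ξ => bergmanKernel Ω z ξ := by
    intro z hz
    simp only [hΨdef, dif_pos (hρΩ hz)]
    exact (hmem z (hρΩ hz)).coeFn_toLp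
  have hm : ∀ x ∈ Metric.ball z₀ ρ,
      AEStronglyMeasurable (fun ξ => bergmanKernel Ω x ξ) (volume.restrict Ω) :=
    fun x hx => (hmem x (hρΩ hx)).1
  choose! L hL hLae using fun z (hz : z ∈ Metric.ball z₀ ρ) =>
    exists_hasFDerivAt_Lp hGL hd hbd hm hΨ hz
  refine ⟨⟨ρ, G, Ψ, L, hΩ, hb, hρ, hρΩ, hGm, hG0, hGL, hGb, hΨ, hL, hLae, fun v => ?_⟩⟩
  have hsub : ∀ x ∈ Metric.ball z₀ (ρ / 2), Metric.ball x (ρ / 2) ⊆ Metric.ball z₀ ρ := fun x hx =>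
    Metric.ball_subset_ball' (by linarith [Metric.mem_ball.1 hx])
  have hmemx : ∀ x ∈ Metric.ball z₀ (ρ / 2), x ∈ Metric.ball z₀ ρ := fun x hx =>
    Metric.ball_subset_ball (by linarith) hx
  obtain ⟨L', hL', -⟩ := exists_hasFDerivAt_Lp (μ := volume.restrict Ω) (z₀ := z₀) (ρ := ρ / 2)
    (f := fun x ξ => fderiv ℂ (fun x => bergmanKernel Ω x ξ) x v)
    (G := fun ξ => 2 / (ρ / 2) * ‖v‖ * G ξ) (hGL.const_mul _)
    (by
      filter_upwards [ae_restrict_mem hΩ.measurableSet] with ξ hξ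
      exact (differentiableOn_fderiv_apply hΩ (differentiableOn_bergmanKernel hΩ hξ) v).mono
        fun x hx => hρΩ (hmemx x hx))
    (by
      filter_upwards [hd, hbd] with ξ h1 h2 x hx
      calc ‖fderiv ℂ (fun x => bergmanKernel Ω x ξ) x v‖
          ≤ ‖fderiv ℂ (fun x => bergmanKernel Ω x ξ) x‖ * ‖v‖ := ContinuousLinearMap.le_opNorm _ _
        _ ≤ 2 * G ξ / (ρ / 2) * ‖v‖ := by
            gcongr
            exact norm_fderiv_le_of_norm_le (h1.mono (hsub x hx)) (fun y hy => h2 y (hsub x hx hy))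
              (half_pos hρ)
        _ = 2 / (ρ / 2) * ‖v‖ * G ξ := by ring)
    (fun x hx => (Lp.aestronglyMeasurable _).congr (hLae x (hmemx x hx) v))
    (Ψ := fun z => L z v) (fun x hx => hLae x (hmemx x hx) v)
    (Metric.mem_ball_self (half_pos hρ))
  exact hL'.differentiableAt

namespace KernelModel

variable (k : KernelModel Ω z₀)

theorem mem_ball : z₀ ∈ Metric.ball z₀ k.radius := Metric.mem_ball_self k.radius_pos

include k in
theorem mem : z₀ ∈ Ω := k.ball_subset k.mem_ball

/-- The inner product of the conjugate of `f` with the kernel is evaluation of `f`. -/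
theorem integral_mul_eq {f : (Fin n → ℂ) → ℂ} (hf : MemBergmanSpace Ω f) {z : Fin n → ℂ}
    (hz : z ∈ Metric.ball z₀ k.radius) :
    inner ℂ (hf.2.star.toLp _) (k.Ψ z) = f z := by
  have hzΩ := k.ball_subset hz
  rw [hf.apply_eq_integral k.isOpen hzΩ, L2.inner_def]
  refine integral_congr_ae ?_
  filter_upwards [hf.2.star.coeFn_toLp, k.Ψ_ae z hz,
    ae_restrict_mem k.isOpen.measurableSet] with ξ h1 h2 h3
  rw [h1, h2, conj_bergmanKernel k.isOpen h3 hzΩ]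
  simp [mul_comm]

/-- Differentiate the reproducing identity under the inner product. -/
theorem inner_L_eq_fderiv {f : (Fin n → ℂ) → ℂ} (hf : MemBergmanSpace Ω f) {z : Fin n → ℂ}
    (hz : z ∈ Metric.ball z₀ k.radius) (v : Fin n → ℂ) :
    inner ℂ (hf.2.star.toLp _) (k.L z v) = fderiv ℂ f z v := by
  set w := hf.2.star.toLp _
  have h1 : HasFDerivAt (fun z => inner ℂ w (k.Ψ z)) ((innerSL ℂ w).comp (k.L z)) z :=
    (innerSL ℂ w).hasFDerivAt.comp z (k.hasFDerivAt z hz)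
  have h2 : f =ᶠ[𝓝 z] fun z => inner ℂ w (k.Ψ z) := by
    filter_upwards [Metric.isOpen_ball.mem_nhds hz] with ζ hζ
    exact (k.integral_mul_eq hf hζ).symm
  rw [(h1.congr_of_eventuallyEq h2).fderiv]
  rfl

theorem Ψ_eq_toLp {w : Fin n → ℂ} (hw : w ∈ Metric.ball z₀ k.radius) :
    k.Ψ w = ((memLp_bergmanKernel k.isOpen (k.ball_subset hw)).star.toLp _) := by
  refine Lp.ext ?_
  filter_upwards [k.Ψ_ae w hw,
    (memLp_bergmanKernel k.isOpen (k.ball_subset hw)).star.coeFn_toLp,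
    ae_restrict_mem k.isOpen.measurableSet] with ξ h1 h2 h3
  rw [h1, h2]
  exact (conj_bergmanKernel k.isOpen h3 (k.ball_subset hw)).symm

theorem inner_Ψ {z w : Fin n → ℂ} (hz : z ∈ Metric.ball z₀ k.radius)
    (hw : w ∈ Metric.ball z₀ k.radius) : inner ℂ (k.Ψ w) (k.Ψ z) = bergmanKernel Ω z w := by
  rw [k.Ψ_eq_toLp hw]
  exact k.integral_mul_eq (representsEval_bergmanKernel k.isOpen (k.ball_subset hw)).1 hz

theorem inner_Ψ_L {z w : Fin n → ℂ} (hz : z ∈ Metric.ball z₀ k.radius)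
    (hw : w ∈ Metric.ball z₀ k.radius) (v : Fin n → ℂ) :
    inner ℂ (k.Ψ w) (k.L z v) = fderiv ℂ (fun x => bergmanKernel Ω x w) z v := by
  rw [k.Ψ_eq_toLp hw]
  exact k.inner_L_eq_fderiv (representsEval_bergmanKernel k.isOpen (k.ball_subset hw)).1 hz v

theorem norm_Ψ_sq {z : Fin n → ℂ} (hz : z ∈ Metric.ball z₀ k.radius) :
    ‖k.Ψ z‖ ^ 2 = (bergmanKernel Ω z z).re := by
  rw [← k.inner_Ψ hz hz, inner_self_eq_norm_sq_to_K]
  norm_cast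

theorem Ψ_ne_zero {z : Fin n → ℂ} (hz : z ∈ Metric.ball z₀ k.radius) : k.Ψ z ≠ 0 := by
  intro h
  have h1 := k.norm_Ψ_sq hz
  rw [h, norm_zero] at h1
  have := re_bergmanKernel_self_pos k.isOpen k.isBounded (k.ball_subset hz)
  rw [← h1] at this
  simp at this

/-- The value `K(z₀, z₀)`. -/
noncomputable def diag (_ : KernelModel Ω z₀) : ℝ := (bergmanKernel Ω z₀ z₀).re

theorem diag_pos : 0 < k.diag := re_bergmanKernel_self_pos k.isOpen k.isBounded k.mem

theorem ofReal_diag : (k.diag : ℂ) = bergmanKernel Ω z₀ z₀ :=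
  ofReal_re_bergmanKernel_self k.isOpen k.mem

/-- The logarithmic derivative of `K(·, z₀)` at `z₀`. -/
noncomputable def logDerivDiag (v : Fin n → ℂ) : ℂ := inner ℂ (k.Ψ z₀) (k.L z₀ v) / k.diag

/-- The derivative of the kernel in direction `v`, made orthogonal to the kernel. -/
noncomputable def tangent (v : Fin n → ℂ) : Lp ℂ 2 (volume.restrict Ω) :=
  k.L z₀ v - k.logDerivDiag v • k.Ψ z₀

theorem logDerivDiag_eq (v : Fin n → ℂ) :
    k.logDerivDiag v = fderiv ℂ (fun x => bergmanKernel Ω x z₀) z₀ v / bergmanKernel Ω z₀ z₀ := by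
  rw [logDerivDiag, k.inner_Ψ_L k.mem_ball k.mem_ball, k.ofReal_diag]

theorem inner_Ψ_tangent (v : Fin n → ℂ) : inner ℂ (k.Ψ z₀) (k.tangent v) = 0 := by
  have h := k.diag_pos
  have h' : (k.diag : ℂ) ≠ 0 := by exact_mod_cast h.ne'
  rw [tangent, inner_sub_right, inner_smul_right, k.inner_Ψ k.mem_ball k.mem_ball, ← k.ofReal_diag,
    logDerivDiag, div_mul_cancel₀ _ h', sub_self]

/-- Since K(z, z) = ‖Ψ z‖², the metric is the complex Hessian of log ‖Ψ‖², and its formula is the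
inner product of the derivatives after projection off `Ψ z₀`: the Fubini–Study metric pulled back by
`Ψ`. -/
theorem bergmanMetric_apply (β α : Fin n) :
    bergmanMetric Ω z₀ β α =
      inner ℂ (k.tangent (Pi.single β 1)) (k.tangent (Pi.single α 1)) / k.diag := by
  have h' : (k.diag : ℂ) ≠ 0 := by exact_mod_cast k.diag_pos.ne'
  have h1 : (fun ζ => ((Real.log (bergmanKernel Ω ζ ζ).re : ℝ) : ℂ)) =ᶠ[𝓝 z₀]
      fun ζ => ((Real.log (‖k.Ψ ζ‖ ^ 2) : ℝ) : ℂ) := by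
    filter_upwards [Metric.ball_mem_nhds z₀ k.radius_pos] with ζ hζ
    rw [k.norm_Ψ_sq hζ]
  have h2 := wirtinger_wirtingerBar_log_norm_sq (Ψ := k.Ψ) (L := k.L) (z := z₀)
    (by filter_upwards [Metric.ball_mem_nhds z₀ k.radius_pos] with ζ hζ using k.hasFDerivAt ζ hζ)
    (k.Ψ_ne_zero k.mem_ball) α β (k.differentiableAt_L _)
  rw [bergmanMetric, Matrix.of_apply, wirtinger_congr (wirtingerBar_congr h1 β), h2,
    k.norm_Ψ_sq k.mem_ball, tangent, inner_sub_left, inner_smul_left, k.inner_Ψ_tangent, mul_zero,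
    sub_zero, tangent, inner_sub_right, inner_smul_right, logDerivDiag]
  change _ / (k.diag : ℂ) - _ / (k.diag : ℂ) ^ 2 = _
  field_simp

theorem tangent_add (u v : Fin n → ℂ) : k.tangent (u + v) = k.tangent u + k.tangent v := by
  simp only [tangent, logDerivDiag, map_add, inner_add_right, add_div, add_smul]; abel

theorem tangent_smul (c : ℂ) (v : Fin n → ℂ) : k.tangent (c • v) = c • k.tangent v := by
  simp only [tangent, logDerivDiag, map_smul, inner_smul_right, mul_div_assoc, smul_sub, smul_smul]

/-- `tangent` as a linear map. -/
noncomputable def tangentₗ : (Fin n → ℂ) →ₗ[ℂ] Lp ℂ 2 (volume.restrict Ω) where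
  toFun := k.tangent
  map_add' := k.tangent_add
  map_smul' := k.tangent_smul

theorem tangent_eq_sum (v : Fin n → ℂ) :
    k.tangent v = ∑ α, v α • k.tangent (Pi.single α 1) := by
  have h : v = ∑ α, v α • (Pi.single α 1 : Fin n → ℂ) := by
    ext i; simp [Finset.sum_apply, Pi.single_apply]
  conv_lhs => rw [h]
  change k.tangentₗ _ = _
  simp only [map_sum, map_smul]
  rfl

theorem inner_tangent (u v : Fin n → ℂ) :
    inner ℂ (k.tangent u) (k.tangent v) = k.diag * (star u ⬝ᵥ (bergmanMetric Ω z₀ *ᵥ v)) := by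
  have h' : (k.diag : ℂ) ≠ 0 := by exact_mod_cast k.diag_pos.ne'
  rw [k.tangent_eq_sum u, k.tangent_eq_sum v, sum_inner]
  simp only [inner_sum, inner_smul_left, inner_smul_right, dotProduct, Matrix.mulVec,
    Finset.mul_sum, k.bergmanMetric_apply, Pi.star_apply]
  refine Finset.sum_congr rfl fun β _ => Finset.sum_congr rfl fun α _ => ?_
  simp only [RCLike.star_def]
  field_simp

/-- A vanishing tangent means that ∂_v f = c f at `z₀` for every `f` in the Bergman space. The
constant 1 forces c = 0, and the coordinate functions, which belong to the space because `Ω` is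
bounded, force v = 0. -/
theorem tangent_eq_zero {v : Fin n → ℂ} (h : k.tangent v = 0) : v = 0 := by
  have hL : k.L z₀ v = k.logDerivDiag v • k.Ψ z₀ := sub_eq_zero.1 h
  have key : ∀ f : (Fin n → ℂ) → ℂ, MemBergmanSpace Ω f →
      fderiv ℂ f z₀ v = k.logDerivDiag v * f z₀ := by
    intro f hf
    rw [← k.inner_L_eq_fderiv hf k.mem_ball, hL, inner_smul_right, k.integral_mul_eq hf k.mem_ball]
  have h1 := key (fun _ => 1) (memBergmanSpace_of_bounded k.isOpen k.isBounded (C := 1)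
    (differentiableOn_const 1) (by simp))
  have hc : k.logDerivDiag v = 0 := by simpa using h1.symm
  obtain ⟨C, hC⟩ := k.isBounded.exists_norm_le
  ext α
  have h2 := key (fun z => z α) (memBergmanSpace_of_bounded k.isOpen k.isBounded (C := C)
    (by fun_prop) fun z hz => (norm_le_pi_norm z α).trans (hC z hz))
  have h3 : HasFDerivAt (fun z : Fin n → ℂ => z α)
    (ContinuousLinearMap.proj (R := ℂ) (φ := fun _ => ℂ) α) z₀ := hasFDerivAt_apply α z₀
  rw [h3.fderiv, hc, zero_mul] at h2
  exact h2

open scoped ComplexOrder in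
include k in
theorem bergmanMetric_posDef : (bergmanMetric Ω z₀).PosDef := by
  have h := k.diag_pos
  have hherm : (bergmanMetric Ω z₀).IsHermitian := by
    ext α β
    rw [Matrix.conjTranspose_apply, k.bergmanMetric_apply, k.bergmanMetric_apply, star_div₀,
      RCLike.star_def, inner_conj_symm, Complex.conj_ofReal]
  refine Matrix.PosDef.of_dotProduct_mulVec_pos hherm fun v hv => ?_
  have h1 := k.inner_tangent v v
  have h2 : k.tangent v ≠ 0 := fun h0 => hv (k.tangent_eq_zero h0)
  have h3 : star v ⬝ᵥ (bergmanMetric Ω z₀ *ᵥ v) = ((‖k.tangent v‖ ^ 2 / k.diag : ℝ) : ℂ) := by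
    have h' : (k.diag : ℂ) ≠ 0 := by exact_mod_cast h.ne'
    rw [inner_self_eq_norm_sq_to_K] at h1
    push_cast
    rw [eq_div_iff h', mul_comm, ← h1]
    rfl
  rw [h3]
  have : 0 < ‖k.tangent v‖ ^ 2 / k.diag := div_pos (pow_pos (norm_pos_iff.2 h2) 2) h
  exact_mod_cast this

end KernelModel

end KernelDerivatives

/-! ### Holomorphic representatives of the tangents and vanishing second moments of the score. -/

section TangentFunctions

variable {n : ℕ} {Ω : Set (Fin n → ℂ)} {z₀ : Fin n → ℂ}

/-- The conjugate of the derivative of the kernel in its first variable is holomorphic in the second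
variable. -/
theorem differentiableOn_conj_fderiv_bergmanKernel (hΩ : IsOpen Ω) (hz₀ : z₀ ∈ Ω)
    (v : Fin n → ℂ) :
    DifferentiableOn ℂ (fun ξ => conj (fderiv ℂ (fun x => bergmanKernel Ω x ξ) z₀ v)) Ω := by
  intro ξ₀ hξ₀
  refine DifferentiableAt.differentiableWithinAt ?_
  obtain ⟨r, hr, hrΩ⟩ : ∃ r > 0, Metric.ball z₀ r ⊆ Ω := Metric.isOpen_iff.1 hΩ z₀ hz₀
  obtain ⟨R, hR, hRΩ⟩ : ∃ r > 0, Metric.ball ξ₀ r ⊆ Ω := Metric.isOpen_iff.1 hΩ ξ₀ hξ₀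
  set s := min r R / 2 with hs
  have hs0 : 0 < s := by positivity
  have hsr : s + s ≤ r := by rw [hs]; linarith [min_le_left r R]
  have hsR : s + s ≤ R := by rw [hs]; linarith [min_le_right r R]
  have hz : ∀ x ∈ Metric.ball z₀ s, Metric.ball x s ⊆ Ω := fun x hx =>
    (Metric.ball_subset_ball' (by linarith [Metric.mem_ball.1 hx])).trans hrΩ
  have hξ : ∀ x ∈ Metric.ball ξ₀ s, Metric.ball x s ⊆ Ω := fun x hx =>
    (Metric.ball_subset_ball' (by linarith [Metric.mem_ball.1 hx])).trans hRΩ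
  have hzΩ : ∀ x ∈ Metric.ball z₀ s, x ∈ Ω := fun x hx => hz x hx (Metric.mem_ball_self hs0)
  have hξΩ : ∀ x ∈ Metric.ball ξ₀ s, x ∈ Ω := fun x hx => hξ x hx (Metric.mem_ball_self hs0)
  obtain ⟨N, hN⟩ := exists_forall_add_smul_mem_ball (z := z₀) hs0 v
  set M := evalBound n s ^ 2
  -- By Hermitian symmetry the conjugated derivative is the limit of difference quotients of K(ξ, ·)
  -- at `z₀`. These are holomorphic in `ξ` and uniformly bounded by the Lipschitz estimate in the
  -- other variable.
  refine differentiableAt_of_tendsto_of_norm_le (R := s) (M := 2 * M / s * ‖v‖)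
    (g := fun m ξ => (((m + N : ℕ) : ℂ) + 1) *
      (bergmanKernel Ω ξ (z₀ + (((m + N : ℕ) : ℂ) + 1)⁻¹ • v) - bergmanKernel Ω ξ z₀))
    hs0 (fun m => ?_) (fun m w hw => ?_) (fun w hw => ?_)
  · have h1 := differentiableOn_bergmanKernel hΩ (hzΩ _ (hN (m + N) (by omega)))
    have h2 := differentiableOn_bergmanKernel hΩ hz₀
    exact ((h1.sub h2).const_mul _).mono hξΩ
  · have hmem := hN (m + N) (by omega)
    have h1 := norm_sub_le_of_norm_le (f := fun x => bergmanKernel Ω x w) (c := z₀) (R := s) (M := M)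
      ((differentiableOn_bergmanKernel hΩ (hξΩ w hw)).mono hzΩ)
      (fun x hx => norm_bergmanKernel_le hΩ hs0 (hz x hx) (hξ w hw)) hmem
    rw [add_sub_cancel_left, norm_smul, norm_inv] at h1
    have hpos : (0 : ℝ) < ‖(((m + N : ℕ) : ℂ) + 1)‖ := norm_pos_iff.2 (Nat.cast_add_one_ne_zero _)
    have h2 : ‖bergmanKernel Ω w (z₀ + (((m + N : ℕ) : ℂ) + 1)⁻¹ • v) - bergmanKernel Ω w z₀‖ =
        ‖bergmanKernel Ω (z₀ + (((m + N : ℕ) : ℂ) + 1)⁻¹ • v) w - bergmanKernel Ω z₀ w‖ := by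
      rw [← conj_bergmanKernel hΩ (hzΩ _ hmem) (hξΩ w hw), ← conj_bergmanKernel hΩ hz₀ (hξΩ w hw),
        ← map_sub, RCLike.norm_conj]
    rw [norm_mul, h2]
    calc _ ≤ ‖(((m + N : ℕ) : ℂ) + 1)‖ *
          (2 * M / s * (‖(((m + N : ℕ) : ℂ) + 1)‖⁻¹ * ‖v‖)) := by gcongr
      _ = 2 * M / s * ‖v‖ := by field_simp
  · have h1 := tendsto_differenceQuotient (((differentiableOn_bergmanKernel hΩ
      (hξΩ w hw)).differentiableAt (hΩ.mem_nhds hz₀))) v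
    have h2 := ((Complex.continuous_conj.tendsto _).comp h1).comp (tendsto_add_atTop_nat N)
    refine h2.congr fun m => ?_
    have hmem := hN (m + N) (by omega)
    simp only [Function.comp_apply, map_mul, map_sub, map_add, map_one, map_natCast]
    rw [conj_bergmanKernel hΩ (hzΩ _ hmem) (hξΩ w hw), conj_bergmanKernel hΩ hz₀ (hξΩ w hw)]

namespace KernelModel

variable (k : KernelModel Ω z₀)

/-- The function of which `tangent` is the class. -/
noncomputable def tangentFun (v ξ : Fin n → ℂ) : ℂ :=
  fderiv ℂ (fun x => bergmanKernel Ω x ξ) z₀ v - k.logDerivDiag v * bergmanKernel Ω z₀ ξ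

theorem tangent_ae (v : Fin n → ℂ) : k.tangent v =ᵐ[volume.restrict Ω] k.tangentFun v := by
  rw [tangent]
  filter_upwards [Lp.coeFn_sub (k.L z₀ v) (k.logDerivDiag v • k.Ψ z₀),
    Lp.coeFn_smul (k.logDerivDiag v) (k.Ψ z₀), k.L_ae z₀ k.mem_ball v, k.Ψ_ae z₀ k.mem_ball]
    with ξ h1 h2 h3 h4
  rw [h1, Pi.sub_apply, h2, Pi.smul_apply, h3, h4]
  rfl

theorem memBergmanSpace_conj_tangentFun (v : Fin n → ℂ) :
    MemBergmanSpace Ω fun ξ => conj (k.tangentFun v ξ) := by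
  refine ⟨?_, ((Lp.memLp (k.tangent v)).ae_eq (k.tangent_ae v)).star⟩
  have h1 := differentiableOn_conj_fderiv_bergmanKernel k.isOpen k.mem v
  have h2 := (differentiableOn_bergmanKernel k.isOpen k.mem).const_mul (conj (k.logDerivDiag v))
  refine (h1.sub h2).congr fun ξ hξ => ?_
  simp only [tangentFun, map_sub, map_mul, Pi.sub_apply, conj_bergmanKernel k.isOpen k.mem hξ]

/-- This is orthogonality to the kernel read as a point evaluation; it makes the numerator in
`integral_tangentFun_mul` vanish at `z₀`. -/
theorem tangentFun_self (v : Fin n → ℂ) : k.tangentFun v z₀ = 0 := by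
  have h' : bergmanKernel Ω z₀ z₀ ≠ 0 := by
    rw [← k.ofReal_diag]; exact_mod_cast k.diag_pos.ne'
  rw [tangentFun, k.logDerivDiag_eq, div_mul_cancel₀ _ h', sub_self]

/-- Near `z₀`, log P is log|K(·, ξ)|² minus log K(z, z). The Wirtinger derivative of the first is
the logarithmic derivative of K(·, ξ), that of the second is `logDerivDiag`. -/
theorem score_eq {ξ : Fin n → ℂ} (hξ : ξ ∈ Ω) (h0 : bergmanKernel Ω z₀ ξ ≠ 0) (α : Fin n) :
    score Ω α z₀ ξ = k.tangentFun (Pi.single α 1) ξ / bergmanKernel Ω z₀ ξ := by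
  have hd := (differentiableOn_bergmanKernel k.isOpen hξ).differentiableAt
    (k.isOpen.mem_nhds k.mem)
  have h1 : (fun ζ => ((Real.log (poissonBergmanKernel Ω ζ ξ) : ℝ) : ℂ)) =ᶠ[𝓝 z₀]
      fun ζ => ((Real.log (‖bergmanKernel Ω ζ ξ‖ ^ 2) : ℝ) : ℂ) -
        ((Real.log (‖k.Ψ ζ‖ ^ 2) : ℝ) : ℂ) := by
    filter_upwards [Metric.ball_mem_nhds z₀ k.radius_pos, hd.continuousAt.eventually_ne h0]
      with ζ hζ hne
    rw [poissonBergmanKernel, ← k.norm_Ψ_sq hζ, Real.log_div, Complex.ofReal_sub]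
    · exact pow_ne_zero 2 (norm_ne_zero_iff.2 hne)
    · exact pow_ne_zero 2 (norm_ne_zero_iff.2 (k.Ψ_ne_zero hζ))
  obtain ⟨D1, hD1, -⟩ := hasFDerivAt_ofReal_log_norm_sq hd.hasFDerivAt h0
  obtain ⟨D2, hD2, -⟩ := hasFDerivAt_ofReal_log_norm_sq (k.hasFDerivAt z₀ k.mem_ball)
    (k.Ψ_ne_zero k.mem_ball)
  rw [score, wirtinger_congr h1, wirtinger_sub hD1.differentiableAt hD2.differentiableAt,
    wirtinger_log_norm_sq hd.hasFDerivAt h0,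
    wirtinger_log_norm_sq (k.hasFDerivAt z₀ k.mem_ball) (k.Ψ_ne_zero k.mem_ball),
    k.norm_Ψ_sq k.mem_ball]
  change _ - k.logDerivDiag (Pi.single α 1) = _
  have h2 : ((‖bergmanKernel Ω z₀ ξ‖ ^ 2 : ℝ) : ℂ) =
      bergmanKernel Ω z₀ ξ * conj (bergmanKernel Ω z₀ ξ) := by
    rw [Complex.mul_conj, Complex.normSq_eq_norm_sq]
  have h3 : conj (bergmanKernel Ω z₀ ξ) ≠ 0 := (map_ne_zero _).2 h0
  rw [h2, tangentFun, RCLike.inner_apply]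
  field_simp

include k in
theorem ae_bergmanKernel_ne_zero (hconn : IsConnected Ω) :
    ∀ᵐ ξ ∂(volume.restrict Ω), ξ ∈ Ω ∧ bergmanKernel Ω z₀ ξ ≠ 0 := by
  have h' : bergmanKernel Ω z₀ z₀ ≠ 0 := by
    rw [← k.ofReal_diag]; exact_mod_cast k.diag_pos.ne'
  have h := measure_zeroSet_eq_zero volume k.isOpen hconn.isPreconnected
    (differentiableOn_bergmanKernel k.isOpen k.mem) k.mem h'
  filter_upwards [ae_restrict_mem k.isOpen.measurableSet,
    ae_restrict_of_ae (compl_mem_ae_iff.2 h)] with ξ h1 h2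
  refine ⟨h1, fun h0 => h2 ⟨h1, ?_⟩⟩
  rw [← conj_bergmanKernel k.isOpen k.mem h1, h0, map_zero]

/-- This turns integrability of cubes of scores into integrability of products of two: x²/|h| ≤ x +
x³/|h|² follows from x (x - |h|/2)² ≥ 0, and the mixed product from |a||b| ≤ |a|² + |b|². -/
theorem norm_mul_div_le {a b h : ℂ} (h0 : h ≠ 0) :
    ‖a * b / h‖ ≤ ‖a‖ + ‖a ^ 3 / h ^ 2‖ + (‖b‖ + ‖b ^ 3 / h ^ 2‖) := by
  have hh : 0 < ‖h‖ := norm_pos_iff.2 h0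
  simp only [norm_div, norm_mul, norm_pow]
  have key : ∀ x : ℝ, 0 ≤ x → x ^ 2 / ‖h‖ ≤ x + x ^ 3 / ‖h‖ ^ 2 := by
    intro x hx
    have : 0 ≤ x * (x - ‖h‖ / 2) ^ 2 / ‖h‖ ^ 2 := by positivity
    have h2 : x * (x - ‖h‖ / 2) ^ 2 / ‖h‖ ^ 2 = x ^ 3 / ‖h‖ ^ 2 - x ^ 2 / ‖h‖ + x / 4 := by
      field_simp; ring
    linarith
  have h1 : ‖a‖ * ‖b‖ / ‖h‖ ≤ ‖a‖ ^ 2 / ‖h‖ + ‖b‖ ^ 2 / ‖h‖ := by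
    rw [← add_div]
    gcongr
    nlinarith [sq_nonneg (‖a‖ - ‖b‖), norm_nonneg a, norm_nonneg b]
  linarith [key _ (norm_nonneg a), key _ (norm_nonneg b)]

/-- The holomorphic second moments of the score vanish. -/
theorem integral_tangentFun_mul (hconn : IsConnected Ω)
    (hL2 : ∀ α : Fin n, MemLp (fun ξ => score Ω α z₀ ξ * score Ω α z₀ ξ * score Ω α z₀ ξ *
      bergmanKernel Ω ξ z₀) 2 (volume.restrict Ω)) (α β : Fin n) :
    ∫ ξ in Ω, k.tangentFun (Pi.single α 1) ξ * k.tangentFun (Pi.single β 1) ξ /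
      bergmanKernel Ω z₀ ξ * conj (bergmanKernel Ω z₀ ξ) = 0 := by
  set p : Fin n → (Fin n → ℂ) → ℂ := fun α => k.tangentFun (Pi.single α 1) with hp
  have hpB : ∀ α, MemBergmanSpace Ω fun ξ => conj (p α ξ) := fun α =>
    k.memBergmanSpace_conj_tangentFun _
  have h' : bergmanKernel Ω z₀ z₀ ≠ 0 := by
    rw [← k.ofReal_diag]; exact_mod_cast k.diag_pos.ne'
  have hne := k.ae_bergmanKernel_ne_zero hconn
  have hcube : ∀ α, MemLp (fun ξ => p α ξ ^ 3 / bergmanKernel Ω z₀ ξ ^ 2) 2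
      (volume.restrict Ω) := by
    intro α
    have hm : AEStronglyMeasurable (p α) (volume.restrict Ω) :=
      (Lp.aestronglyMeasurable _).congr (k.tangent_ae (Pi.single α 1))
    have hK : AEStronglyMeasurable (fun ξ => bergmanKernel Ω z₀ ξ) (volume.restrict Ω) :=
      (Lp.aestronglyMeasurable _).congr (k.Ψ_ae z₀ k.mem_ball)
    refine (hL2 α).of_le ((hm.pow 3).div₀ (hK.pow 2)) ?_
    filter_upwards [hne] with ξ ⟨h1, h2⟩
    rw [k.score_eq h1 h2, norm_mul, norm_bergmanKernel_comm k.isOpen h1 k.mem, ← norm_mul]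
    refine le_of_eq (congrArg _ ?_)
    field_simp
    rfl
  set q : (Fin n → ℂ) → ℂ := fun ξ => conj (p α ξ) * conj (p β ξ) with hq
  have hqd : DifferentiableOn ℂ q Ω := (hpB α).1.mul (hpB β).1
  have hdom : MemLp (fun ξ => ‖p α ξ‖ + ‖p α ξ ^ 3 / bergmanKernel Ω z₀ ξ ^ 2‖ +
      (‖p β ξ‖ + ‖p β ξ ^ 3 / bergmanKernel Ω z₀ ξ ^ 2‖)) 2 (volume.restrict Ω) := by
    have h1 : ∀ α, MemLp (fun ξ => ‖p α ξ‖) 2 (volume.restrict Ω) := fun α =>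
      ((Lp.memLp (k.tangent _)).ae_eq (k.tangent_ae (Pi.single α 1))).norm
    exact ((h1 α).add (hcube α).norm).add ((h1 β).add (hcube β).norm)
  have hqm : MemLp (fun ξ => q ξ / bergmanKernel Ω ξ z₀) 2 (volume.restrict Ω) := by
    refine hdom.of_le ?_ ?_
    · exact (hqd.continuousOn.aestronglyMeasurable k.isOpen.measurableSet).div₀
        ((differentiableOn_bergmanKernel k.isOpen k.mem).continuousOn.aestronglyMeasurable
          k.isOpen.measurableSet)
    · filter_upwards [hne] with ξ ⟨h1, h2⟩
      have h3 : q ξ / bergmanKernel Ω ξ z₀ = conj (p α ξ * p β ξ / bergmanKernel Ω z₀ ξ) := by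
        rw [map_div₀, conj_bergmanKernel k.isOpen k.mem h1, map_mul]
      rw [h3, RCLike.norm_conj]
      exact (norm_mul_div_le h2).trans (le_abs_self _)
  -- The moment is the conjugate of the integral of (q/K(·, z₀)) · conj K(·, z₀). Once the quotient
  -- extends to an element `F` of the Bergman space, the reproducing property makes that integral `F
  -- z₀`, which is 0.
  obtain ⟨F, hF, hFeq⟩ := exists_extension_of_sq_integrable volume k.isOpen hconn.isPreconnected hqd
    (differentiableOn_bergmanKernel k.isOpen k.mem) k.mem h' (by
      rw [lintegral_enorm_sq_eq]
      exact ENNReal.pow_ne_top hqm.2.ne)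
  have hae : F =ᵐ[volume.restrict Ω] fun ξ => q ξ / bergmanKernel Ω ξ z₀ := by
    filter_upwards [hne] with ξ ⟨h1, h2⟩
    refine hFeq ξ h1 fun h0 => h2 ?_
    rw [← conj_bergmanKernel k.isOpen h1 k.mem, h0, map_zero]
  have hFB : MemBergmanSpace Ω F := ⟨hF, hqm.ae_eq hae.symm⟩
  have hF0 : F z₀ = 0 := by
    rw [hFeq z₀ k.mem h', hq]
    simp [hp, k.tangentFun_self]
  rw [hFB.apply_eq_integral k.isOpen k.mem] at hF0
  have h4 := congrArg (starRingEnd ℂ) hF0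
  rw [← integral_conj, map_zero] at h4
  rw [← h4]
  refine integral_congr_ae ?_
  filter_upwards [hne, hae] with ξ ⟨h1, h2⟩ h3
  rw [h3, map_mul, map_div₀, conj_bergmanKernel k.isOpen h1 k.mem, hq, map_mul,
    Complex.conj_conj, Complex.conj_conj, conj_bergmanKernel k.isOpen k.mem h1]

end KernelModel

end TangentFunctions

/-! ### The abstract local model of the loss. -/

/-- A loss function `D` near the origin of `ℂⁿ` whose random part is the logarithm of the squared
modulus of a centered holomorphic function `1 + a`, and whose deterministic part `b` has the Hessian
`g`, the covariance matrix of the scores; the scores have vanishing holomorphic second moments. -/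
structure HolomorphicLossModel {X : Type*} [MeasurableSpace X] (ν : Measure X) {n : ℕ}
    (g : Matrix (Fin n) (Fin n) ℂ) (D : (Fin n → ℂ) → X → EReal) where
  radius : ℝ
  a : (Fin n → ℂ) → X → ℂ
  T : X → ℝ
  score : X → Fin n → ℂ
  good : Set X
  b : (Fin n → ℂ) → ℝ
  κ : X → ℝ
  radius_pos : 0 < radius
  measurable_a : Measurable fun p : (Fin n → ℂ) × X => a p.1 p.2
  measurable_T : Measurable T
  T_nonneg : ∀ x, 0 ≤ T x
  integrable_T_sq : Integrable (fun x => T x ^ 2) ν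
  measurable_score : Measurable score
  measurableSet_good : MeasurableSet good
  ae_good : ∀ᵐ x ∂ν, x ∈ good
  differentiableOn : ∀ x ∈ good, DifferentiableOn ℂ (fun v => a v x) (Metric.ball 0 radius)
  norm_le : ∀ x ∈ good, ∀ v ∈ Metric.ball 0 radius, ‖a v x‖ ≤ T x
  a_zero : ∀ x ∈ good, a 0 x = 0
  fderiv_eq : ∀ x ∈ good, ∀ v, fderiv ℂ (fun v => a v x) 0 v = score x ⬝ᵥ v
  integral_a : ∀ v ∈ Metric.ball 0 radius, ∫ x, a v x ∂ν = 0
  integral_score : ∀ α, ∫ x, score x α ∂ν = 0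
  integral_score_mul : ∀ α β, ∫ x, score x α * score x β ∂ν = 0
  integral_conj_score_mul : ∀ β α, ∫ x, conj (score x β) * score x α ∂ν = g β α
  measurable_b : Measurable b
  continuousOn_b : ContinuousOn b (Metric.ball 0 radius)
  b_expansion : (fun v => b v - (star v ⬝ᵥ (g *ᵥ v)).re) =o[𝓝 0] fun v => ‖v‖ ^ 2
  loss_eq : ∀ x ∈ good, ∀ v ∈ Metric.ball 0 radius, 1 + a v x ≠ 0 →
    D v x = ((b v - 2 * Real.log ‖1 + a v x‖ + κ x : ℝ) : EReal)

/-! ### Normalized kernels and the expansion of the diastasis. -/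

namespace KernelModel

variable {n : ℕ} {Ω : Set (Fin n → ℂ)} {z₀ : Fin n → ℂ} (k : KernelModel Ω z₀)

theorem diag_ne_zero : (k.diag : ℂ) ≠ 0 := by exact_mod_cast k.diag_pos.ne'

/-- `Ψ z` scaled to have the same inner product with `Ψ z₀` as `Ψ z₀`. -/
noncomputable def normalized (z : Fin n → ℂ) : Lp ℂ 2 (volume.restrict Ω) :=
  ((k.diag : ℂ) / inner ℂ (k.Ψ z₀) (k.Ψ z)) • k.Ψ z

theorem inner_Ψ_self : inner ℂ (k.Ψ z₀) (k.Ψ z₀) = (k.diag : ℂ) := by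
  rw [k.inner_Ψ k.mem_ball k.mem_ball, k.ofReal_diag]

theorem normalized_self : k.normalized z₀ = k.Ψ z₀ := by
  rw [normalized, k.inner_Ψ_self, div_self k.diag_ne_zero, one_smul]

theorem inner_normalized {z : Fin n → ℂ} (hz : z ∈ Metric.ball z₀ k.radius)
    (h : bergmanKernel Ω z z₀ ≠ 0) : inner ℂ (k.Ψ z₀) (k.normalized z) = (k.diag : ℂ) := by
  rw [normalized, inner_smul_right, k.inner_Ψ hz k.mem_ball, div_mul_cancel₀ _ h]

/-- The normalization fixes the component along `Ψ z₀`, so differentiating it removes that component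
of `L z₀ v`. -/
theorem hasFDerivAt_normalized : ∃ D : (Fin n → ℂ) →L[ℂ] Lp ℂ 2 (volume.restrict Ω),
    HasFDerivAt k.normalized D z₀ ∧ ∀ v, D v = k.tangent v := by
  have h1 := k.hasFDerivAt z₀ k.mem_ball
  have h2 : HasFDerivAt (fun z => inner ℂ (k.Ψ z₀) (k.Ψ z))
      ((innerSL ℂ (k.Ψ z₀)).comp (k.L z₀)) z₀ := (innerSL ℂ (k.Ψ z₀)).hasFDerivAt.comp z₀ h1
  have hne : inner ℂ (k.Ψ z₀) (k.Ψ z₀) ≠ (0 : ℂ) := by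
    rw [k.inner_Ψ_self]; exact k.diag_ne_zero
  have h3 := (((hasDerivAt_inv hne).comp_hasFDerivAt z₀ h2).const_mul (k.diag : ℂ)).smul h1
  refine ⟨_, h3.congr_of_eventuallyEq (Eventually.of_forall fun z => ?_), fun v => ?_⟩
  · simp [normalized, div_eq_mul_inv]
  · have h4 := k.diag_ne_zero
    have h6 : ((‖k.Ψ z₀‖ : ℂ) ^ 2) = k.diag := by
      rw [← k.inner_Ψ_self, inner_self_eq_norm_sq_to_K]; rfl
    have h5 : (k.diag : ℂ) * ((k.diag : ℂ) ^ 2)⁻¹ = (k.diag : ℂ)⁻¹ := by field_simp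
    simp [tangent, logDerivDiag]
    rw [h6, ← mul_assoc, h5, mul_inv_cancel₀ h4, one_smul, div_eq_inv_mul, sub_eq_add_neg]

/-- Pythagoras: the increment of the normalized kernel is orthogonal to `Ψ z₀`. -/
theorem norm_normalized_sq {z : Fin n → ℂ} (hz : z ∈ Metric.ball z₀ k.radius)
    (h : bergmanKernel Ω z z₀ ≠ 0) :
    ‖k.normalized z‖ ^ 2 = k.diag + ‖k.normalized z - k.Ψ z₀‖ ^ 2 := by
  have h1 : inner ℂ (k.Ψ z₀) (k.normalized z - k.Ψ z₀) = (0 : ℂ) := by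
    rw [inner_sub_right, k.inner_normalized hz h, k.inner_Ψ_self, sub_self]
  have h2 := norm_add_sq_eq_norm_sq_add_norm_sq_of_inner_eq_zero (𝕜 := ℂ) (k.Ψ z₀)
    (k.normalized z - k.Ψ z₀) h1
  rw [add_sub_cancel, ← pow_two, ← pow_two, ← pow_two, k.norm_Ψ_sq k.mem_ball] at h2
  exact h2

/-- No second derivative is needed: the increment is its linear part plus o(v), its squared norm is
therefore quadratic up to o(‖v‖²), and log(1 + x) = x + o(x) passes this on. -/
theorem normalized_expansion :
    (fun v => Real.log (1 + ‖k.normalized (z₀ + v) - k.Ψ z₀‖ ^ 2 / k.diag) -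
      (star v ⬝ᵥ (bergmanMetric Ω z₀ *ᵥ v)).re) =o[𝓝 0] fun v => ‖v‖ ^ 2 := by
  obtain ⟨D, hD, hDv⟩ := k.hasFDerivAt_normalized
  set r : (Fin n → ℂ) → Lp ℂ 2 (volume.restrict Ω) := fun v => k.normalized (z₀ + v) - k.Ψ z₀
    with hr
  have ho : (fun v => r v - D v) =o[𝓝 0] fun v => v := by
    have := hasFDerivAt_iff_isLittleO_nhds_zero.1 hD
    rwa [k.normalized_self] at this
  have hO : r =O[𝓝 0] fun v => v := by
    have := ho.isBigO.add (D.isBigO_id (𝓝 0))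
    simpa using this
  have hOD := D.isBigO_id (𝓝 (0 : Fin n → ℂ))
  have h0 : Tendsto (fun v => ‖r v‖ ^ 2 / k.diag) (𝓝 0) (𝓝 0) := by
    have : Tendsto r (𝓝 0) (𝓝 0) := hO.trans_tendsto tendsto_id
    simpa using (this.norm.pow 2).div_const k.diag
  have hlog : (fun x : ℝ => Real.log (1 + x) - x) =o[𝓝 0] fun x => x := by
    have h := hasDerivAt_iff_isLittleO.1
      (HasDerivAt.comp_const_add (f := Real.log) (1 : ℝ) 0 (by
        simpa using Real.hasDerivAt_log one_ne_zero))
    simpa using h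
  have hq : ∀ v, (star v ⬝ᵥ (bergmanMetric Ω z₀ *ᵥ v)).re = ‖D v‖ ^ 2 / k.diag := by
    intro v
    have h1 := k.inner_tangent v v
    rw [inner_self_eq_norm_sq_to_K] at h1
    have h2 : star v ⬝ᵥ (bergmanMetric Ω z₀ *ᵥ v) = ((‖D v‖ ^ 2 / k.diag : ℝ) : ℂ) := by
      push_cast
      rw [eq_div_iff k.diag_ne_zero, mul_comm, ← h1, hDv]
      rfl
    rw [h2, Complex.ofReal_re]
  have e1 : (fun v => Real.log (1 + ‖r v‖ ^ 2 / k.diag) - ‖r v‖ ^ 2 / k.diag)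
      =o[𝓝 0] fun v => ‖v‖ ^ 2 := by
    refine (hlog.comp_tendsto h0).trans_isBigO ?_
    refine ((hO.norm_norm.pow 2).const_mul_left k.diag⁻¹).congr_left fun v => ?_
    simp only [Function.comp_apply]
    ring
  have e2 : (fun v => ‖r v‖ ^ 2 / k.diag - ‖D v‖ ^ 2 / k.diag) =o[𝓝 0] fun v => ‖v‖ ^ 2 := by
    have h1 : (fun v => ‖r v‖ - ‖D v‖) =o[𝓝 0] fun v => ‖v‖ :=
      (Asymptotics.isBigO_of_le _ fun v => by
        simpa using abs_norm_sub_norm_le (r v) (D v)).trans_isLittleO ho.norm_right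
    have h2 : (fun v => ‖r v‖ + ‖D v‖) =O[𝓝 0] fun v => ‖v‖ := hO.norm_norm.add hOD.norm_norm
    refine ((h1.mul_isBigO h2).const_mul_left k.diag⁻¹).congr (fun v => ?_) fun v => ?_
    · ring
    · ring
  refine (e1.add e2).congr_left fun v => ?_
  rw [hq]
  ring

end KernelModel

/-! ### The diastasis satisfies the abstract model. -/

namespace KernelModel

variable {n : ℕ} {Ω : Set (Fin n → ℂ)} {z₀ : Fin n → ℂ} (k : KernelModel Ω z₀)

include k in
theorem aestronglyMeasurable_bergmanKernel :
    AEStronglyMeasurable (fun ξ => bergmanKernel Ω z₀ ξ) (volume.restrict Ω) :=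
  (Lp.aestronglyMeasurable _).congr (k.Ψ_ae z₀ k.mem_ball)

include k in
theorem aemeasurable_poissonBergmanKernel :
    AEMeasurable (fun ξ => poissonBergmanKernel Ω z₀ ξ) (volume.restrict Ω) := by
  unfold poissonBergmanKernel
  exact ((k.aestronglyMeasurable_bergmanKernel.norm.aemeasurable.pow_const 2).div_const _)

include k in
theorem poissonBergmanKernel_nonneg (ξ : Fin n → ℂ) : 0 ≤ poissonBergmanKernel Ω z₀ ξ :=
  div_nonneg (sq_nonneg _) k.diag_pos.le

include k in
theorem integral_poissonBergmanMeasure {E : Type*} [NormedAddCommGroup E] [NormedSpace ℝ E]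
    (f : (Fin n → ℂ) → E) :
    ∫ ξ, f ξ ∂(poissonBergmanMeasure Ω z₀) = ∫ ξ in Ω, poissonBergmanKernel Ω z₀ ξ • f ξ := by
  rw [poissonBergmanMeasure, integral_withDensity_eq_integral_toReal_smul₀
    k.aemeasurable_poissonBergmanKernel.ennreal_ofReal (by simp)]
  simp only [ENNReal.toReal_ofReal (k.poissonBergmanKernel_nonneg _)]

include k in
theorem integrable_poissonBergmanMeasure_iff {E : Type*} [NormedAddCommGroup E] [NormedSpace ℝ E]
    {f : (Fin n → ℂ) → E} :
    Integrable f (poissonBergmanMeasure Ω z₀) ↔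
      IntegrableOn (fun ξ => poissonBergmanKernel Ω z₀ ξ • f ξ) Ω := by
  rw [poissonBergmanMeasure, integrable_withDensity_iff_integrable_smul₀'
    k.aemeasurable_poissonBergmanKernel.ennreal_ofReal (by simp)]
  simp only [ENNReal.toReal_ofReal (k.poissonBergmanKernel_nonneg _)]
  rfl

theorem ofReal_poissonBergmanKernel (ξ : Fin n → ℂ) : (poissonBergmanKernel Ω z₀ ξ : ℂ) =
    bergmanKernel Ω z₀ ξ * conj (bergmanKernel Ω z₀ ξ) / k.diag := by
  rw [Complex.mul_conj, Complex.normSq_eq_norm_sq, ← Complex.ofReal_div]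
  rfl

/-- If `f` times the kernel is represented by `F` and `g` times the kernel by `G`, then the moment
`E[conj g f]` is an inner product. -/
theorem integral_conj_mul {f g : (Fin n → ℂ) → ℂ} {F G : Lp ℂ 2 (volume.restrict Ω)}
    (hF : F =ᵐ[volume.restrict Ω] fun ξ => f ξ * bergmanKernel Ω z₀ ξ)
    (hG : G =ᵐ[volume.restrict Ω] fun ξ => g ξ * bergmanKernel Ω z₀ ξ) :
    ∫ ξ, conj (g ξ) * f ξ ∂(poissonBergmanMeasure Ω z₀) = inner ℂ G F / k.diag := by
  rw [k.integral_poissonBergmanMeasure, L2.inner_def, ← integral_div]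
  refine integral_congr_ae ?_
  filter_upwards [hF, hG] with ξ h1 h2
  rw [h1, h2, RCLike.inner_apply, Complex.real_smul, k.ofReal_poissonBergmanKernel, map_mul]
  ring

theorem integral_eq_inner {f : (Fin n → ℂ) → ℂ} {F : Lp ℂ 2 (volume.restrict Ω)}
    (hF : F =ᵐ[volume.restrict Ω] fun ξ => f ξ * bergmanKernel Ω z₀ ξ) :
    ∫ ξ, f ξ ∂(poissonBergmanMeasure Ω z₀) = inner ℂ (k.Ψ z₀) F / k.diag := by
  have h := k.integral_conj_mul (g := fun _ => 1) hF
    ((k.Ψ_ae z₀ k.mem_ball).trans (by simp))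
  simpa using h

/-- The points where the likelihood ratio is finite. -/
def regularSet (Ω : Set (Fin n → ℂ)) (z₀ : Fin n → ℂ) : Set (Fin n → ℂ) :=
  {ξ | ξ ∈ Ω ∧ bergmanKernelExt Ω (z₀, ξ) ≠ 0}

include k in
theorem measurableSet_regularSet : MeasurableSet (regularSet Ω z₀) := by
  have h := (measurable_bergmanKernelExt k.isOpen).comp (measurable_prodMk_left (x := z₀))
  exact k.isOpen.measurableSet.inter (h (measurableSet_singleton 0).compl)

include k in
theorem mem_regularSet {ξ : Fin n → ℂ} :
    ξ ∈ regularSet Ω z₀ ↔ ξ ∈ Ω ∧ bergmanKernel Ω z₀ ξ ≠ 0 := by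
  refine and_congr_right fun h => ?_
  rw [bergmanKernelExt_of_mem k.mem h]

include k in
theorem ae_regularSet : ∀ᵐ ξ ∂(poissonBergmanMeasure Ω z₀), ξ ∈ regularSet Ω z₀ := by
  rw [poissonBergmanMeasure, ae_withDensity_iff' k.aemeasurable_poissonBergmanKernel.ennreal_ofReal]
  filter_upwards [ae_restrict_mem k.isOpen.measurableSet] with ξ hξ h
  refine k.mem_regularSet.2 ⟨hξ, fun h0 => h ?_⟩
  simp [poissonBergmanKernel, h0]

/-- The normalized kernel ratio minus `1`, as a function of the increment and the observation. -/
noncomputable def ratio (Ω : Set (Fin n → ℂ)) (z₀ v ξ : Fin n → ℂ) : ℂ :=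
  bergmanKernelExt Ω (z₀ + v, ξ) * bergmanKernelExt Ω (z₀, z₀) /
    (bergmanKernelExt Ω (z₀ + v, z₀) * bergmanKernelExt Ω (z₀, ξ)) - 1

include k in
theorem measurable_ratio : Measurable fun p : (Fin n → ℂ) × (Fin n → ℂ) => ratio Ω z₀ p.1 p.2 := by
  have h := measurable_bergmanKernelExt k.isOpen
  unfold ratio
  have h1 := h.comp ((measurable_fst.const_add z₀).prodMk
    (measurable_snd : Measurable fun p : (Fin n → ℂ) × (Fin n → ℂ) => p.2))
  have h2 := h.comp ((measurable_fst.const_add z₀).prodMk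
    (measurable_const : Measurable fun _ : (Fin n → ℂ) × (Fin n → ℂ) => z₀))
  have h3 := h.comp ((measurable_const (a := z₀)).prodMk
    (measurable_snd : Measurable fun p : (Fin n → ℂ) × (Fin n → ℂ) => p.2))
  exact ((h1.mul_const _).div (h2.mul h3)).sub_const 1

variable {r : ℝ}

theorem add_mem_ball {v : Fin n → ℂ} (hv : v ∈ Metric.ball (0 : Fin n → ℂ) r)
    (hr : r ≤ k.radius) : z₀ + v ∈ Metric.ball z₀ k.radius := by
  rw [mem_ball_iff_norm, add_sub_cancel_left]
  exact (mem_ball_zero_iff.1 hv).trans_le hr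

theorem ratio_eq {v ξ : Fin n → ℂ} (hv : z₀ + v ∈ Ω) (hξ : ξ ∈ Ω) :
    ratio Ω z₀ v ξ = bergmanKernel Ω (z₀ + v) ξ * k.diag /
      (bergmanKernel Ω (z₀ + v) z₀ * bergmanKernel Ω z₀ ξ) - 1 := by
  rw [ratio, bergmanKernelExt_of_mem hv hξ, bergmanKernelExt_of_mem hv k.mem,
    bergmanKernelExt_of_mem k.mem hξ, bergmanKernelExt_of_mem k.mem k.mem, k.ofReal_diag]

include k in
theorem ratio_zero {ξ : Fin n → ℂ} (hξ : ξ ∈ regularSet Ω z₀) : ratio Ω z₀ 0 ξ = 0 := by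
  obtain ⟨h1, h2⟩ := k.mem_regularSet.1 hξ
  rw [k.ratio_eq (by simpa using k.mem) h1, add_zero, ← k.ofReal_diag, mul_comm, div_self, sub_self]
  exact mul_ne_zero k.diag_ne_zero h2

theorem differentiableOn_ratio (hr : r ≤ k.radius)
    (hne : ∀ z ∈ Metric.ball z₀ r, bergmanKernel Ω z z₀ ≠ 0) {ξ : Fin n → ℂ}
    (hξ : ξ ∈ regularSet Ω z₀) :
    DifferentiableOn ℂ (fun v => ratio Ω z₀ v ξ) (Metric.ball 0 r) := by
  obtain ⟨h1, h2⟩ := k.mem_regularSet.1 hξ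
  have hmem : ∀ v ∈ Metric.ball (0 : Fin n → ℂ) r, z₀ + v ∈ Ω := fun v hv =>
    k.ball_subset (k.add_mem_ball hv hr)
  have hadd : DifferentiableOn ℂ (fun v : Fin n → ℂ => z₀ + v) (Metric.ball 0 r) := by fun_prop
  have hK : ∀ w ∈ Ω, DifferentiableOn ℂ (fun v => bergmanKernel Ω (z₀ + v) w) (Metric.ball 0 r) :=
    fun w hw => (differentiableOn_bergmanKernel k.isOpen hw).comp hadd hmem
  have h3 : DifferentiableOn ℂ (fun v => bergmanKernel Ω (z₀ + v) ξ * k.diag /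
      (bergmanKernel Ω (z₀ + v) z₀ * bergmanKernel Ω z₀ ξ) - 1) (Metric.ball 0 r) := by
    simp only [div_eq_mul_inv]
    refine (((hK ξ h1).mul_const _).mul (((hK z₀ k.mem).mul_const _).fun_inv
      fun v hv => ?_)).sub_const 1
    refine mul_ne_zero (hne _ ?_) h2
    rw [mem_ball_iff_norm, add_sub_cancel_left]
    exact mem_ball_zero_iff.1 hv
  exact h3.congr fun v hv => k.ratio_eq (hmem v hv) h1

/-- Quotient rule at v = 0: the factor K(z₀ + v, z₀) in the denominator contributes exactly the term
`logDerivDiag` that is subtracted in `tangentFun`. -/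
theorem fderiv_ratio {ξ : Fin n → ℂ} (hξ : ξ ∈ regularSet Ω z₀) (v : Fin n → ℂ) :
    fderiv ℂ (fun v => ratio Ω z₀ v ξ) 0 v = k.tangentFun v ξ / bergmanKernel Ω z₀ ξ := by
  obtain ⟨h1, h2⟩ := k.mem_regularSet.1 hξ
  have hK0 : bergmanKernel Ω z₀ z₀ ≠ 0 := by rw [← k.ofReal_diag]; exact k.diag_ne_zero
  have hK : ∀ w ∈ Ω, HasFDerivAt (fun v => bergmanKernel Ω (z₀ + v) w)
      (fderiv ℂ (fun x => bergmanKernel Ω x w) z₀) 0 := by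
    intro w hw
    have h := ((differentiableOn_bergmanKernel k.isOpen hw).differentiableAt
      (k.isOpen.mem_nhds k.mem)).hasFDerivAt
    have h' : HasFDerivAt (fun x => bergmanKernel Ω x w)
      (fderiv ℂ (fun x => bergmanKernel Ω x w) z₀) (z₀ + 0) := by simpa using h
    exact (hasFDerivAt_comp_add_left z₀).2 h'
  have hden : bergmanKernel Ω (z₀ + 0) z₀ * bergmanKernel Ω z₀ ξ ≠ 0 := by
    rw [add_zero]; exact mul_ne_zero hK0 h2
  have h3 := (((hK ξ h1).mul_const (k.diag : ℂ)).mul ((hasDerivAt_inv hden).comp_hasFDerivAt 0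
    ((hK z₀ k.mem).mul_const (bergmanKernel Ω z₀ ξ)))).sub_const 1
  have h4 : (fun v => ratio Ω z₀ v ξ) =ᶠ[𝓝 0] fun v => bergmanKernel Ω (z₀ + v) ξ * k.diag *
      (bergmanKernel Ω (z₀ + v) z₀ * bergmanKernel Ω z₀ ξ)⁻¹ - 1 := by
    filter_upwards [Metric.ball_mem_nhds (0 : Fin n → ℂ) k.radius_pos] with v hv
    rw [k.ratio_eq (k.ball_subset (k.add_mem_ball hv le_rfl)) h1, div_eq_mul_inv]
  rw [(h3.congr_of_eventuallyEq h4).fderiv, tangentFun, k.logDerivDiag_eq, k.ofReal_diag]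
  simp only [Function.comp_apply, add_zero, add_apply, smul_apply, smul_eq_mul]
  field_simp
  ring

theorem tangentFun_eq_sum (v ξ : Fin n → ℂ) :
    k.tangentFun v ξ = ∑ α, v α * k.tangentFun (Pi.single α 1) ξ := by
  have h : v = ∑ α, v α • (Pi.single α 1 : Fin n → ℂ) := by
    ext i; simp [Finset.sum_apply, Pi.single_apply]
  simp only [tangentFun, logDerivDiag]
  conv_lhs => rw [h]
  simp only [map_sum, map_smul, inner_sum, inner_smul_right, Finset.sum_div, Finset.sum_mul,
    ← Finset.sum_sub_distrib, smul_eq_mul]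
  refine Finset.sum_congr rfl fun α _ => ?_
  ring

open Classical in
/-- The score, extended by zero. -/
noncomputable def scoreFun (ξ : Fin n → ℂ) (α : Fin n) : ℂ :=
  (regularSet Ω z₀).indicator
    (fun ξ => k.tangentFun (Pi.single α 1) ξ / bergmanKernel Ω z₀ ξ) ξ

/-- The score is a pointwise limit of difference quotients of `ratio`, which is jointly measurable
because the kernel is extended by zero. -/
theorem measurable_scoreFun (hr0 : 0 < r) (hr : r ≤ k.radius)
    (hne : ∀ z ∈ Metric.ball z₀ r, bergmanKernel Ω z z₀ ≠ 0) : Measurable k.scoreFun := by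
  refine measurable_pi_iff.2 fun α => ?_
  have hf : ∀ m : ℕ, Measurable ((regularSet Ω z₀).indicator
      fun ξ => ((m : ℂ) + 1) * ratio Ω z₀ ((m + 1 : ℂ)⁻¹ • Pi.single α 1) ξ) := fun m =>
    ((k.measurable_ratio.comp measurable_prodMk_left).const_mul _).indicator
      k.measurableSet_regularSet
  refine measurable_of_tendsto_metrizable hf (tendsto_pi_nhds.2 fun ξ => ?_)
  by_cases hξ : ξ ∈ regularSet Ω z₀
  · have h := tendsto_differenceQuotient ((k.differentiableOn_ratio hr hne hξ).differentiableAt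
      (Metric.ball_mem_nhds _ hr0)) (Pi.single α 1)
    simp only [scoreFun, Set.indicator_of_mem hξ]
    rw [k.fderiv_ratio hξ] at h
    simpa [k.ratio_zero hξ] using h
  · simp [scoreFun, Set.indicator_of_notMem hξ]

theorem scoreFun_ae (hconn : IsConnected Ω) (α : Fin n) :
    k.tangent (Pi.single α 1) =ᵐ[volume.restrict Ω]
      fun ξ => k.scoreFun ξ α * bergmanKernel Ω z₀ ξ := by
  filter_upwards [k.tangent_ae (Pi.single α 1), k.ae_bergmanKernel_ne_zero hconn] with ξ h1 h2
  rw [h1, scoreFun, Set.indicator_of_mem (k.mem_regularSet.2 h2), div_mul_cancel₀ _ h2.2]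

/-- This links probability and geometry: moments of `ratio` under the Poisson–Bergman law become
inner products with the increment of the normalized kernel. -/
theorem ratio_ae (hconn : IsConnected Ω) {v : Fin n → ℂ} (hv : z₀ + v ∈ Metric.ball z₀ k.radius) :
    (k.normalized (z₀ + v) - k.Ψ z₀ : Lp ℂ 2 (volume.restrict Ω)) =ᵐ[volume.restrict Ω]
      fun ξ => ratio Ω z₀ v ξ * bergmanKernel Ω z₀ ξ := by
  filter_upwards [Lp.coeFn_sub (k.normalized (z₀ + v)) (k.Ψ z₀),
    Lp.coeFn_smul ((k.diag : ℂ) / inner ℂ (k.Ψ z₀) (k.Ψ (z₀ + v))) (k.Ψ (z₀ + v)),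
    k.Ψ_ae _ hv, k.Ψ_ae _ k.mem_ball, k.ae_bergmanKernel_ne_zero hconn] with ξ h1 h2 h3 h4 h5
  rw [h1, Pi.sub_apply, normalized, h2, Pi.smul_apply, h3, h4, k.inner_Ψ hv k.mem_ball,
    k.ratio_eq (k.ball_subset hv) h5.1, smul_eq_mul, sub_mul, one_mul]
  congr 1
  have := h5.2
  field_simp

/-- The deterministic part of the diastasis. -/
noncomputable def drift (v : Fin n → ℂ) : ℝ :=
  Real.log (bergmanKernelExt Ω (z₀ + v, z₀ + v)).re + Real.log k.diag -
    2 * Real.log ‖bergmanKernelExt Ω (z₀ + v, z₀)‖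

theorem measurable_drift : Measurable k.drift := by
  have h := measurable_bergmanKernelExt k.isOpen
  have h1 : Measurable fun v : Fin n → ℂ => bergmanKernelExt Ω (z₀ + v, z₀ + v) :=
    h.comp ((measurable_id.const_add z₀).prodMk (measurable_id.const_add z₀))
  have h2 : Measurable fun v : Fin n → ℂ => bergmanKernelExt Ω (z₀ + v, z₀) :=
    h.comp ((measurable_id.const_add z₀).prodMk measurable_const)
  unfold drift
  fun_prop

theorem continuousOn_drift (hr : r ≤ k.radius)
    (hne : ∀ z ∈ Metric.ball z₀ r, bergmanKernel Ω z z₀ ≠ 0) :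
    ContinuousOn k.drift (Metric.ball 0 r) := by
  have hmem : ∀ v ∈ Metric.ball (0 : Fin n → ℂ) r, z₀ + v ∈ Ω := fun v hv =>
    k.ball_subset (k.add_mem_ball hv hr)
  have hadd : ContinuousOn (fun v : Fin n → ℂ => z₀ + v) (Metric.ball 0 r) := by fun_prop
  have h1 : ContinuousOn (fun v => bergmanKernel Ω (z₀ + v) (z₀ + v)) (Metric.ball 0 r) :=
    (continuousOn_bergmanKernel k.isOpen).comp (hadd.prodMk hadd) fun v hv =>
      ⟨hmem v hv, hmem v hv⟩
  have h2 : ContinuousOn (fun v => bergmanKernel Ω (z₀ + v) z₀) (Metric.ball 0 r) :=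
    (continuousOn_bergmanKernel k.isOpen).comp (hadd.prodMk continuousOn_const) fun v hv =>
      ⟨hmem v hv, k.mem⟩
  have h3 : ContinuousOn (fun v => Real.log (bergmanKernel Ω (z₀ + v) (z₀ + v)).re +
      Real.log k.diag - 2 * Real.log ‖bergmanKernel Ω (z₀ + v) z₀‖) (Metric.ball 0 r) := by
    refine ((((Complex.continuous_re.comp_continuousOn h1).log fun v hv => ?_).add
      continuousOn_const).sub ((h2.norm.log fun v hv => ?_).const_mul 2))
    · exact (re_bergmanKernel_self_pos k.isOpen k.isBounded (hmem v hv)).ne'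
    · refine norm_ne_zero_iff.2 (hne _ ?_)
      rw [mem_ball_iff_norm, add_sub_cancel_left]
      exact mem_ball_zero_iff.1 hv
  refine h3.congr fun v hv => ?_
  rw [drift, bergmanKernelExt_of_mem (hmem v hv) (hmem v hv),
    bergmanKernelExt_of_mem (hmem v hv) k.mem]

/-- By Pythagoras, the quotient K(z, z) K(z₀, z₀) / |K(z, z₀)|² is 1 plus the squared norm of the
normalized increment over K(z₀, z₀). -/
theorem drift_eq {v : Fin n → ℂ} (hv : z₀ + v ∈ Metric.ball z₀ k.radius)
    (hne : bergmanKernel Ω (z₀ + v) z₀ ≠ 0) :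
    k.drift v = Real.log (1 + ‖k.normalized (z₀ + v) - k.Ψ z₀‖ ^ 2 / k.diag) := by
  have hmem := k.ball_subset hv
  have hd := k.diag_pos
  have hp := re_bergmanKernel_self_pos k.isOpen k.isBounded hmem
  have hn : 0 < ‖bergmanKernel Ω (z₀ + v) z₀‖ := norm_pos_iff.2 hne
  have h1 : 1 + ‖k.normalized (z₀ + v) - k.Ψ z₀‖ ^ 2 / k.diag =
      (bergmanKernel Ω (z₀ + v) (z₀ + v)).re * k.diag / ‖bergmanKernel Ω (z₀ + v) z₀‖ ^ 2 := by
    have h2 := k.norm_normalized_sq hv hne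
    have h3 : ‖k.normalized (z₀ + v)‖ ^ 2 = k.diag ^ 2 / ‖bergmanKernel Ω (z₀ + v) z₀‖ ^ 2 *
        (bergmanKernel Ω (z₀ + v) (z₀ + v)).re := by
      rw [normalized, norm_smul, mul_pow, k.norm_Ψ_sq hv, k.inner_Ψ hv k.mem_ball, norm_div,
        div_pow, Complex.norm_real, Real.norm_eq_abs, sq_abs]
    rw [h3] at h2
    have h4 : ‖k.normalized (z₀ + v) - k.Ψ z₀‖ ^ 2 = k.diag ^ 2 /
      ‖bergmanKernel Ω (z₀ + v) z₀‖ ^ 2 * (bergmanKernel Ω (z₀ + v) (z₀ + v)).re - k.diag := by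
      linarith
    rw [h4]
    field_simp
    ring
  rw [h1, Real.log_div (by positivity) (by positivity), Real.log_mul hp.ne' hd.ne', Real.log_pow,
    drift, bergmanKernelExt_of_mem hmem hmem, bergmanKernelExt_of_mem hmem k.mem]
  norm_num

/-- Substitute |K(z, ξ)| = |1 + a| |K(z, z₀)| |K(z₀, ξ)| / K(z₀, z₀). Only log|1 + a| depends on
both the parameter and the observation; the last bracket is the diastasis between `z₀` and `ξ`. -/
theorem diastasis_eq {v ξ : Fin n → ℂ} (hv : z₀ + v ∈ Metric.ball z₀ k.radius)
    (hne : bergmanKernel Ω (z₀ + v) z₀ ≠ 0) (hξ : ξ ∈ regularSet Ω z₀)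
    (h1 : 1 + ratio Ω z₀ v ξ ≠ 0) :
    diastasis Ω (z₀ + v) ξ = ((k.drift v - 2 * Real.log ‖1 + ratio Ω z₀ v ξ‖ +
      (Real.log (bergmanKernel Ω ξ ξ).re + Real.log k.diag -
        2 * Real.log ‖bergmanKernel Ω z₀ ξ‖) : ℝ) : EReal) := by
  obtain ⟨hξΩ, hξ0⟩ := k.mem_regularSet.1 hξ
  have hmem := k.ball_subset hv
  have hp := re_bergmanKernel_self_pos k.isOpen k.isBounded hmem
  have hq := re_bergmanKernel_self_pos k.isOpen k.isBounded hξΩ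
  have hd := k.diag_pos
  have hratio : 1 + ratio Ω z₀ v ξ = bergmanKernel Ω (z₀ + v) ξ * k.diag /
      (bergmanKernel Ω (z₀ + v) z₀ * bergmanKernel Ω z₀ ξ) := by
    rw [k.ratio_eq hmem hξΩ]; ring
  have hK : bergmanKernel Ω (z₀ + v) ξ ≠ 0 := by
    rintro h0
    rw [hratio, h0, zero_mul, zero_div] at h1
    exact h1 rfl
  have hKp : 0 < ‖bergmanKernel Ω (z₀ + v) ξ‖ := norm_pos_iff.2 hK
  have hKp0 : 0 < ‖bergmanKernel Ω (z₀ + v) z₀‖ := norm_pos_iff.2 hne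
  have hKpξ : 0 < ‖bergmanKernel Ω z₀ ξ‖ := norm_pos_iff.2 hξ0
  rw [diastasis, ← ENNReal.ofReal_div_of_pos (by positivity), ENNReal.log_ofReal_of_pos
    (by positivity), hratio, norm_div, norm_mul, norm_mul, Complex.norm_real,
    Real.norm_of_nonneg hd.le, Real.log_div (by positivity) (by positivity),
    Real.log_div (by positivity) (by positivity), Real.log_mul hp.ne' hq.ne',
    Real.log_mul hKp.ne' hd.ne', Real.log_mul hKp0.ne' hKpξ.ne', Real.log_pow, drift,
    bergmanKernelExt_of_mem hmem hmem, bergmanKernelExt_of_mem hmem k.mem]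
  congr 1
  push_cast
  ring

include k in
/-- The diastasis near a point is a holomorphic loss model. -/
theorem nonempty_holomorphicLossModel (hconn : IsConnected Ω)
    (hL2 : ∀ α : Fin n, MemLp (fun ξ => score Ω α z₀ ξ * score Ω α z₀ ξ * score Ω α z₀ ξ *
      bergmanKernel Ω ξ z₀) 2 (volume.restrict Ω)) :
    ∃ M : HolomorphicLossModel (poissonBergmanMeasure Ω z₀) (bergmanMetric Ω z₀)
      (fun v ξ => diastasis Ω (z₀ + v) ξ), Metric.ball z₀ M.radius ⊆ Ω := by
  have hd := k.diag_pos
  have hcont : ContinuousAt (fun z => bergmanKernel Ω z z₀) z₀ :=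
    ((differentiableOn_bergmanKernel k.isOpen k.mem).differentiableAt
      (k.isOpen.mem_nhds k.mem)).continuousAt
  -- A lower bound for |K(z, z₀)| keeps the denominator of the ratio away from zero and costs a
  -- factor 2 in the majorant.
  have hlow : ∀ᶠ z in 𝓝 z₀, k.diag / 2 < ‖bergmanKernel Ω z z₀‖ := by
    refine hcont.norm.eventually (lt_mem_nhds ?_)
    change k.diag / 2 < ‖bergmanKernel Ω z₀ z₀‖
    rw [← k.ofReal_diag, Complex.norm_real, Real.norm_of_nonneg hd.le]
    linarith
  obtain ⟨s, hs, hsb⟩ := Metric.eventually_nhds_iff_ball.1 hlow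
  set r := min s k.radius with hrdef
  have hr0 : 0 < r := lt_min hs k.radius_pos
  have hr : r ≤ k.radius := min_le_right _ _
  have hlb : ∀ z ∈ Metric.ball z₀ r, k.diag / 2 < ‖bergmanKernel Ω z z₀‖ := fun z hz =>
    hsb z (Metric.ball_subset_ball (min_le_left _ _) hz)
  have hne : ∀ z ∈ Metric.ball z₀ r, bergmanKernel Ω z z₀ ≠ 0 := fun z hz =>
    norm_pos_iff.1 ((half_pos hd).trans (hlb z hz))
  have hadd : ∀ v ∈ Metric.ball (0 : Fin n → ℂ) r, z₀ + v ∈ Metric.ball z₀ r := by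
    intro v hv
    rw [mem_ball_iff_norm, add_sub_cancel_left]
    exact mem_ball_zero_iff.1 hv
  have hKm : Measurable fun ξ => bergmanKernelExt Ω (z₀, ξ) :=
    (measurable_bergmanKernelExt k.isOpen).comp measurable_prodMk_left
  refine ⟨{
    radius := r
    a := ratio Ω z₀
    -- 3 = 2 + 1: the factor 2 for the ratio, and 1 for the subtracted constant, which is at most
    -- bound/|K(z₀, ξ)|. The density cancels the denominator of T², leaving a multiple of bound².
    T := fun ξ => 3 * (k.bound ξ / ‖bergmanKernelExt Ω (z₀, ξ)‖)
    score := k.scoreFun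
    good := regularSet Ω z₀
    b := k.drift
    κ := fun ξ => Real.log (bergmanKernel Ω ξ ξ).re + Real.log k.diag -
        2 * Real.log ‖bergmanKernel Ω z₀ ξ‖
    radius_pos := hr0
    measurable_a := k.measurable_ratio
    measurable_T := (k.bound_measurable.div hKm.norm).const_mul 3
    T_nonneg := fun ξ => mul_nonneg (by norm_num) (div_nonneg (k.bound_nonneg ξ) (norm_nonneg _))
    integrable_T_sq := ?_
    measurable_score := k.measurable_scoreFun hr0 hr hne
    measurableSet_good := k.measurableSet_regularSet
    ae_good := k.ae_regularSet
    differentiableOn := fun ξ hξ => k.differentiableOn_ratio hr hne hξ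
    norm_le := ?_
    a_zero := fun ξ hξ => k.ratio_zero hξ
    fderiv_eq := ?_
    integral_a := ?_
    integral_score := ?_
    integral_score_mul := ?_
    integral_conj_score_mul := ?_
    measurable_b := k.measurable_drift
    continuousOn_b := k.continuousOn_drift hr hne
    b_expansion := ?_
    loss_eq := fun ξ hξ v hv h1 => k.diastasis_eq (k.add_mem_ball hv hr) (hne _ (hadd v hv)) hξ h1
    }, (Metric.ball_subset_ball hr).trans k.ball_subset⟩
  · rw [k.integrable_poissonBergmanMeasure_iff]
    refine ((k.bound_memLp.integrable_sq).const_mul (9 / k.diag)).congr ?_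
    filter_upwards [k.ae_bergmanKernel_ne_zero hconn] with ξ ⟨h1, h2⟩
    have h3 : 0 < ‖bergmanKernel Ω z₀ ξ‖ := norm_pos_iff.2 h2
    rw [bergmanKernelExt_of_mem k.mem h1, poissonBergmanKernel, smul_eq_mul]
    change _ = ‖bergmanKernel Ω z₀ ξ‖ ^ 2 / k.diag * _
    field_simp
    ring
  · intro ξ hξ v hv
    obtain ⟨h1, h2⟩ := k.mem_regularSet.1 hξ
    have hp : 0 < ‖bergmanKernel Ω z₀ ξ‖ := norm_pos_iff.2 h2
    have hb0 := k.norm_le z₀ k.mem_ball ξ h1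
    have hb := k.norm_le _ (k.add_mem_ball hv hr) ξ h1
    have hl := hlb _ (hadd v hv)
    have hl0 : 0 < ‖bergmanKernel Ω (z₀ + v) z₀‖ := (half_pos hd).trans hl
    rw [k.ratio_eq (k.ball_subset (k.add_mem_ball hv hr)) h1, bergmanKernelExt_of_mem k.mem h1]
    refine (norm_sub_le _ _).trans ?_
    rw [norm_one, norm_div, norm_mul, norm_mul, Complex.norm_real, Real.norm_of_nonneg hd.le]
    have e1 : 1 ≤ k.bound ξ / ‖bergmanKernel Ω z₀ ξ‖ := (one_le_div hp).2 hb0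
    have e2 : ‖bergmanKernel Ω (z₀ + v) ξ‖ * k.diag /
        (‖bergmanKernel Ω (z₀ + v) z₀‖ * ‖bergmanKernel Ω z₀ ξ‖) ≤
        2 * (k.bound ξ / ‖bergmanKernel Ω z₀ ξ‖) := by
      have e3 : k.diag / ‖bergmanKernel Ω (z₀ + v) z₀‖ ≤ 2 := by
        rw [div_le_iff₀ hl0]; linarith
      calc _ = ‖bergmanKernel Ω (z₀ + v) ξ‖ / ‖bergmanKernel Ω z₀ ξ‖ *
            (k.diag / ‖bergmanKernel Ω (z₀ + v) z₀‖) := by field_simp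
        _ ≤ k.bound ξ / ‖bergmanKernel Ω z₀ ξ‖ * 2 := by gcongr
        _ = _ := mul_comm _ _
    linarith
  · intro ξ hξ v
    rw [k.fderiv_ratio hξ, k.tangentFun_eq_sum, Finset.sum_div, dotProduct]
    refine Finset.sum_congr rfl fun α _ => ?_
    rw [scoreFun, Set.indicator_of_mem hξ]
    ring
  · intro v hv
    rw [k.integral_eq_inner (k.ratio_ae hconn (k.add_mem_ball hv hr)), inner_sub_right,
      k.inner_normalized (k.add_mem_ball hv hr) (hne _ (hadd v hv)), k.inner_Ψ_self, sub_self,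
      zero_div]
  · intro α
    rw [k.integral_eq_inner (k.scoreFun_ae hconn α), k.inner_Ψ_tangent, zero_div]
  · intro α β
    rw [k.integral_poissonBergmanMeasure, ← mul_zero ((k.diag : ℂ)⁻¹),
      ← k.integral_tangentFun_mul hconn hL2 α β, ← integral_const_mul]
    refine integral_congr_ae ?_
    filter_upwards [k.ae_bergmanKernel_ne_zero hconn] with ξ h
    have h2 := h.2
    have hd' := k.diag_ne_zero
    rw [scoreFun, scoreFun, Set.indicator_of_mem (k.mem_regularSet.2 h),
      Set.indicator_of_mem (k.mem_regularSet.2 h), Complex.real_smul, k.ofReal_poissonBergmanKernel]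
    field_simp
  · intro β α
    rw [k.integral_conj_mul (k.scoreFun_ae hconn α) (k.scoreFun_ae hconn β), k.bergmanMetric_apply]
  · refine k.normalized_expansion.congr' ?_ EventuallyEq.rfl
    filter_upwards [Metric.ball_mem_nhds (0 : Fin n → ℂ) hr0] with v hv
    rw [k.drift_eq (k.add_mem_ball hv hr) (hne _ (hadd v hv))]

end KernelModel

/-! ### Measurable selection of minimizers. -/

section MeasurableArgmin

/-- A continuous function on a compact metric space that depends measurably on a parameter has a
minimizer that depends measurably on the parameter. -/
theorem exists_measurable_argmin {S K : Type*} [MeasurableSpace S] [MetricSpace K] [CompactSpace K]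
    [Nonempty K] [MeasurableSpace K] [BorelSpace K] {f : S → K → ℝ}
    (hf : ∀ x, Measurable fun s => f s x) (hc : ∀ s, Continuous (f s)) :
    ∃ w : S → K, Measurable w ∧ ∀ s x, f s (w s) ≤ f s x := by
  -- Parametrizing `K` by the Cantor set, a compact subset of ℝ, singles out a minimizer: the one
  -- with the least parameter.
  obtain ⟨ψ, hψ, hψs⟩ := exists_nat_bool_continuous_surjective_of_compact K
  set φ : cantorSet → K := ψ ∘ cantorSetHomeomorphNatToBool with hφdef
  have hφ : Continuous φ := hψ.comp cantorSetHomeomorphNatToBool.continuous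
  have hφs : Function.Surjective φ := hψs.comp cantorSetHomeomorphNatToBool.surjective
  set A : S → Set ℝ := fun s => Subtype.val '' {t : cantorSet | ∀ x, f s (φ t) ≤ f s x} with hA
  have hAc : ∀ s, IsCompact (A s) := by
    intro s
    refine IsCompact.image ?_ continuous_subtype_val
    have : CompactSpace cantorSet := isCompact_iff_compactSpace.1 isCompact_cantorSet
    refine IsClosed.isCompact ?_
    simp only [Set.ofPred_forall]
    exact isClosed_iInter fun x => isClosed_le ((hc s).comp hφ) continuous_const
  have hAne : ∀ s, (A s).Nonempty := by
    intro s
    obtain ⟨x, -, hx⟩ := isCompact_univ.exists_isMinOn Set.univ_nonempty (hc s).continuousOn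
    obtain ⟨t, rfl⟩ := hφs x
    exact ⟨t, t, fun y => hx (Set.mem_univ y), rfl⟩
  have hmem : ∀ s, ∃ t : cantorSet, (∀ x, f s (φ t) ≤ f s x) ∧ (t : ℝ) = sInf (A s) := fun s =>
    (hAc s).sInf_mem (hAne s)
  choose t ht hts using hmem
  refine ⟨fun s => φ (t s), hφ.measurable.comp ?_, fun s x => ht s x⟩
  refine (MeasurableEmbedding.subtype_coe isClosed_cantorSet.measurableSet).measurable_comp_iff.1
    (measurable_of_Iic fun r => ?_)
  change MeasurableSet ((fun s => (t s : ℝ)) ⁻¹' Set.Iic r)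
  obtain ⟨E, hE, hEd⟩ := TopologicalSpace.exists_countable_dense {u : cantorSet | (u : ℝ) ≤ r}
  obtain ⟨D, hD, hDd⟩ := TopologicalSpace.exists_countable_dense K
  -- The least parameter is at most `r` exactly when parameters up to `r` already come arbitrarily
  -- close to the minimum. By continuity and compactness this can be tested on countable dense sets.
  have key : (fun s => (t s : ℝ)) ⁻¹' Set.Iic r =
      ⋂ x ∈ D, ⋂ k : ℕ, ⋃ u ∈ E, {s | f s (φ u) < f s x + ((k : ℝ) + 1)⁻¹} := by
    ext s
    simp only [Set.mem_preimage, Set.mem_Iic, Set.mem_iInter, Set.mem_iUnion, Set.mem_ofPred_eq,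
      exists_prop]
    constructor
    · intro hr x _ k
      have hopen : IsOpen {u : {u : cantorSet | (u : ℝ) ≤ r} |
          f s (φ u) < f s x + ((k : ℝ) + 1)⁻¹} :=
        isOpen_lt ((hc s).comp (hφ.comp continuous_subtype_val)) continuous_const
      obtain ⟨u, hu, huE⟩ := hEd.inter_open_nonempty _ hopen ⟨⟨t s, hr⟩,
        (ht s x).trans_lt (lt_add_of_pos_right _ (by positivity))⟩
      exact ⟨u, huE, hu⟩
    · intro h
      have hcomp : IsCompact {u : cantorSet | (u : ℝ) ≤ r} := by
        have : CompactSpace cantorSet := isCompact_iff_compactSpace.1 isCompact_cantorSet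
        exact (isClosed_le continuous_subtype_val continuous_const).isCompact
      have hne : {u : cantorSet | (u : ℝ) ≤ r}.Nonempty := by
        obtain ⟨x, hx⟩ := hDd.nonempty
        obtain ⟨u, -, -⟩ := h x hx 0
        exact ⟨u, u.2⟩
      obtain ⟨u₀, hu₀, hmin⟩ := hcomp.exists_isMinOn hne ((hc s).comp hφ).continuousOn
      have h1 : ∀ x ∈ D, f s (φ u₀) ≤ f s x := by
        intro x hx
        refine le_of_forall_pos_lt_add fun ε hε => ?_
        obtain ⟨k, hk⟩ := exists_nat_one_div_lt hε
        obtain ⟨u, -, hu⟩ := h x hx k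
        have : f s (φ u₀) ≤ f s (φ u) := hmin u.2
        rw [one_div] at hk
        linarith
      have h2 : ∀ x, f s (φ u₀) ≤ f s x := fun x =>
        hDd.induction (P := fun x => f s (φ u₀) ≤ f s x) h1
          (isClosed_le continuous_const (hc s)) x
      rw [hts s]
      exact (csInf_le (hAc s).bddBelow ⟨u₀, h2, rfl⟩).trans hu₀
  rw [key]
  refine MeasurableSet.biInter hD fun x _ => MeasurableSet.iInter fun k =>
    MeasurableSet.biUnion hE fun u _ => ?_
  exact measurableSet_lt (hf _) ((hf _).add_const _)

end MeasurableArgmin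

/-! ### Asymptotic linearity of sums of logarithms of holomorphic functions. -/

section HolomorphicSums

variable {E : Type*} [NormedAddCommGroup E] [NormedSpace ℂ E]

/-- A uniformly bounded sequence of holomorphic functions that tends to zero on a dense set tends to
zero locally uniformly. -/
theorem eventually_forall_norm_le_of_dense [FiniteDimensional ℂ E] {f : ℕ → E → ℂ} {ρ M : ℝ}
    {D : Set E} (hρ : 0 < ρ) (hd : ∀ m, DifferentiableOn ℂ (f m) (Metric.ball 0 ρ))
    (hM : ∀ m, ∀ v ∈ Metric.ball (0 : E) ρ, ‖f m v‖ ≤ M) (hD : Dense D)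
    (h : ∀ v ∈ D, v ∈ Metric.ball (0 : E) ρ → Tendsto (fun m => f m v) atTop (𝓝 0)) {ε : ℝ}
    (hε : 0 < ε) : ∀ᶠ m in atTop, ∀ v ∈ Metric.ball (0 : E) (ρ / 2), ‖f m v‖ ≤ ε := by
  have : ProperSpace E := FiniteDimensional.proper ℂ E
  have hM0 : 0 ≤ M := (norm_nonneg _).trans (hM 0 0 (Metric.mem_ball_self hρ))
  -- The net lies in the ball of radius 3ρ/4, so balls of radius ρ/4 around its points stay in the
  -- domain; on them the Lipschitz constant 2M/(ρ/4) times δ is at most ε/2.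
  set δ := min (ρ / 4) (ε * ρ / (16 * (M + 1))) with hδ
  have hδ0 : 0 < δ := by positivity
  have hδρ : δ ≤ ρ / 4 := min_le_left _ _
  have hδε : 2 * M / (ρ / 4) * δ ≤ ε / 2 := by
    calc 2 * M / (ρ / 4) * δ ≤ 2 * M / (ρ / 4) * (ε * ρ / (16 * (M + 1))) := by
          gcongr; exact min_le_right _ _
      _ = ε / 2 * (M / (M + 1)) := by field_simp; ring
      _ ≤ ε / 2 * 1 := by
          gcongr
          rw [div_le_one (by linarith)]; linarith
      _ = ε / 2 := mul_one _
  obtain ⟨t, htD, htf, htc⟩ := (isCompact_closedBall (0 : E) (ρ / 2)).elim_finite_subcover_image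
    (b := D ∩ Metric.ball 0 (3 * ρ / 4)) (c := fun c => Metric.ball c δ)
    (fun _ _ => Metric.isOpen_ball) (by
      intro v hv
      obtain ⟨c, hcD, hc⟩ := hD.exists_dist_lt v hδ0
      refine Set.mem_iUnion₂.2 ⟨c, ⟨hcD, ?_⟩, hc⟩
      rw [Metric.mem_closedBall] at hv
      rw [Metric.mem_ball]
      linarith [dist_triangle_left c 0 v])
  have hev : ∀ c ∈ t, ∀ᶠ m in atTop, ‖f m c‖ ≤ ε / 2 := by
    intro c hc
    have hcb : c ∈ Metric.ball (0 : E) ρ :=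
      Metric.ball_subset_ball (by linarith) (htD hc).2
    have := (h c (htD hc).1 hcb).norm
    rw [norm_zero] at this
    exact this.eventually_le_const (half_pos hε)
  filter_upwards [htf.eventually_all.2 hev] with m hm v hv
  obtain ⟨c, hct, hvc⟩ := Set.mem_iUnion₂.1 (htc (Metric.ball_subset_closedBall hv))
  have hsub : Metric.ball c (ρ / 4) ⊆ Metric.ball 0 ρ :=
    Metric.ball_subset_ball' (by linarith [Metric.mem_ball.1 (htD hct).2])
  have h1 := norm_sub_le_of_norm_le ((hd m).mono hsub) (fun w hw => hM m w (hsub hw))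
    (Metric.ball_subset_ball hδρ hvc)
  have h2 : 2 * M / (ρ / 4) * ‖v - c‖ ≤ ε / 2 := by
    refine le_trans ?_ hδε
    gcongr
    exact (mem_ball_iff_norm.1 hvc).le
  calc ‖f m v‖ = ‖(f m v - f m c) + f m c‖ := by rw [sub_add_cancel]
    _ ≤ ‖f m v - f m c‖ + ‖f m c‖ := norm_add_le _ _
    _ ≤ ε := by linarith [hm c hct]

/-- If the means of a sequence converge, its partial maxima are sublinear. -/
theorem eventually_forall_le_mul_of_tendsto_mean {x : ℕ → ℝ} {τ : ℝ}
    (h : Tendsto (fun m : ℕ => (m : ℝ)⁻¹ * ∑ i ∈ Finset.range m, x i) atTop (𝓝 τ)) {ε : ℝ}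
    (hε : 0 < ε) : ∀ᶠ m : ℕ in atTop, ∀ i < m, x i ≤ ε * m := by
  -- A single term over `m` is essentially the difference of consecutive means. The finitely many
  -- terms before this becomes small are constants, absorbed by ε m.
  have h1 : Tendsto (fun m : ℕ => x m / m) atTop (𝓝 0) := by
    have h2 : Tendsto (fun m : ℕ => (1 + ((m : ℝ))⁻¹) *
        (((m + 1 : ℕ) : ℝ)⁻¹ * ∑ i ∈ Finset.range (m + 1), x i) -
        (m : ℝ)⁻¹ * ∑ i ∈ Finset.range m, x i) atTop (𝓝 ((1 + 0) * τ - τ)) :=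
      ((tendsto_const_nhds.add tendsto_inv_atTop_nhds_zero_nat).mul
        (h.comp (tendsto_add_atTop_nat 1))).sub h
    rw [add_zero, one_mul, sub_self] at h2
    refine h2.congr' ?_
    filter_upwards [eventually_gt_atTop 0] with m hm
    have : (0 : ℝ) < m := by exact_mod_cast hm
    rw [Finset.sum_range_succ]
    push_cast
    field_simp
    ring
  obtain ⟨N, hN⟩ := eventually_atTop.1 (h1.eventually_le_const hε)
  have h3 : ∀ i ∈ Finset.range (N + 1), ∀ᶠ m : ℕ in atTop, x i ≤ ε * m := fun i _ =>
    (tendsto_natCast_atTop_atTop.const_mul_atTop hε).eventually_ge_atTop _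
  filter_upwards [(Finset.eventually_all _).2 h3] with m hm i him
  rcases lt_or_ge i (N + 1) with hi | hi
  · exact hm i (Finset.mem_range.2 hi)
  · have hi0 : (0 : ℝ) < i := by exact_mod_cast (by omega : 0 < i)
    have h4 := hN i (by omega)
    rw [div_le_iff₀ hi0] at h4
    have : (i : ℝ) ≤ m := by exact_mod_cast him.le
    nlinarith

theorem norm_log_one_add_sub_le {z : ℂ} (hz : ‖z‖ ≤ 1 / 2) :
    ‖Complex.log (1 + z) - (z - z ^ 2 / 2)‖ ≤ ‖z‖ ^ 3 := by
  have h := Complex.norm_log_sub_logTaylor_le 2 (z := z) (by linarith)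
  have h1 : Complex.logTaylor (2 + 1) z = z - z ^ 2 / 2 := by
    simp [Complex.logTaylor, Finset.sum_range_succ]
    ring
  rw [h1] at h
  refine h.trans ?_
  have h2 : (1 - ‖z‖)⁻¹ ≤ 2 := by
    rw [inv_le_comm₀ (by linarith) (by norm_num)]; linarith
  have h3 : 0 ≤ ‖z‖ ^ 3 := by positivity
  norm_num
  nlinarith

variable {a : ℕ → E → ℂ} {T : ℕ → ℝ} {ρ B : ℝ}

theorem norm_inv_sqrt_smul_le {C : ℝ} {m : ℕ} {u : E} (hu : ‖u‖ ≤ C) :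
    ‖((√(m : ℝ))⁻¹ : ℝ) • u‖ ≤ C / √m := by
  rw [norm_smul, norm_inv, Real.norm_of_nonneg (Real.sqrt_nonneg _), div_eq_inv_mul]
  gcongr

theorem eventually_div_sqrt_lt (C : ℝ) {r : ℝ} (hr : 0 < r) :
    ∀ᶠ m : ℕ in atTop, C / √(m : ℝ) < r :=
  have h : Tendsto (fun m : ℕ => C / √(m : ℝ)) atTop (𝓝 0) := tendsto_const_nhds.div_atTop
    (Real.tendsto_sqrt_atTop.comp tendsto_natCast_atTop_atTop)
  h.eventually_lt_const hr

/-- A sum of logarithms of holomorphic functions at scale `1 / √m` is asymptotically linear,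
uniformly on bounded sets, if the functions are square summable on average and their means and the
means of the squares of their derivatives tend to zero. -/
theorem eventually_norm_sum_log_sub_le (hρ : 0 < ρ)
    (hd : ∀ i, DifferentiableOn ℂ (a i) (Metric.ball 0 ρ))
    (hT : ∀ i, ∀ v ∈ Metric.ball (0 : E) ρ, ‖a i v‖ ≤ T i) (h0 : ∀ i, a i 0 = 0) {τ : ℝ}
    (hmean : Tendsto (fun m : ℕ => (m : ℝ)⁻¹ * ∑ i ∈ Finset.range m, T i ^ 2) atTop (𝓝 τ))
    (hunif : ∀ ε > 0, ∀ᶠ m : ℕ in atTop, ∀ v ∈ Metric.ball (0 : E) (ρ / 2),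
      ‖(m : ℂ)⁻¹ * ∑ i ∈ Finset.range m, a i v‖ ≤ ε)
    (hsq : ∀ C, ∀ ε > 0, ∀ᶠ m : ℕ in atTop, ∀ u : E, ‖u‖ ≤ C →
      ‖(m : ℂ)⁻¹ * ∑ i ∈ Finset.range m, (fderiv ℂ (a i) 0 u) ^ 2‖ ≤ ε)
    {C ε : ℝ} (hC : 0 < C) (hε : 0 < ε) :
    ∀ᶠ m : ℕ in atTop, ∀ u : E, ‖u‖ ≤ C →
      (∀ i < m, ‖a i (((√(m : ℝ))⁻¹ : ℝ) • u)‖ ≤ 1 / 2) ∧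
      ‖∑ i ∈ Finset.range m, Complex.log (1 + a i (((√(m : ℝ))⁻¹ : ℝ) • u)) -
        ∑ i ∈ Finset.range m, fderiv ℂ (a i) 0 (((√(m : ℝ))⁻¹ : ℝ) • u)‖ ≤ ε := by
  have hT0 : ∀ i, 0 ≤ T i := fun i => (norm_nonneg _).trans (hT i 0 (Metric.mem_ball_self hρ))
  obtain ⟨B, hB⟩ := hmean.bddAbove_range
  set B' := max B 1 with hB'
  have hB'0 : 0 < B' := lt_max_of_lt_right one_pos
  have hBm : ∀ m : ℕ, 0 < m → ∑ i ∈ Finset.range m, T i ^ 2 ≤ B' * m := by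
    intro m hm
    have h1 : (m : ℝ)⁻¹ * ∑ i ∈ Finset.range m, T i ^ 2 ≤ B' :=
      (hB (Set.mem_range_self m)).trans (le_max_left _ _)
    have : (0 : ℝ) < m := by exact_mod_cast hm
    rwa [inv_mul_le_iff₀ this, mul_comm] at h1
  -- η bounds every summand uniformly. It puts the arguments where the logarithm expands, and makes
  -- the sum of cubes at most η times the bounded sum of squares.
  set η := min (1 / 2) (ε / 4 / (4 * C ^ 2 / ρ ^ 2 * B')) with hη
  have hη0 : 0 < η := by positivity
  have hη1 : η ≤ 1 / 2 := min_le_left _ _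
  have hη2 : η * (4 * C ^ 2 / ρ ^ 2 * B') ≤ ε / 4 := by
    have := min_le_right (1 / 2) (ε / 4 / (4 * C ^ 2 / ρ ^ 2 * B'))
    rwa [← hη, le_div_iff₀ (by positivity)] at this
  set ε₁ := ε / 4 * ρ ^ 2 / (16 * C ^ 2) with hε₁
  have hε₁0 : 0 < ε₁ := by positivity
  filter_upwards [eventually_div_sqrt_lt C (half_pos hρ), eventually_gt_atTop 0,
    eventually_forall_le_mul_of_tendsto_mean hmean (ε := η ^ 2 * ρ ^ 2 / (4 * C ^ 2))
      (by positivity), hunif ε₁ hε₁0, hsq C (ε / 4) (by positivity),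
    eventually_div_sqrt_lt (16 * C ^ 3 * B' / ρ ^ 3) (r := ε / 4) (by positivity)]
    with m hm1 hm0 hm2 hm3 hm4 hm5 u hu
  have hmp : (0 : ℝ) < m := by exact_mod_cast hm0
  have hsp : 0 < √(m : ℝ) := Real.sqrt_pos.2 hmp
  have hss : √(m : ℝ) ^ 2 = m := Real.sq_sqrt hmp.le
  set v : E := ((√(m : ℝ))⁻¹ : ℝ) • u with hv
  have hvn : ‖v‖ ≤ C / √m := norm_inv_sqrt_smul_le hu
  have hvb2 : v ∈ Metric.ball (0 : E) (ρ / 2) := mem_ball_zero_iff.2 (hvn.trans_lt hm1)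
  have hvb : v ∈ Metric.ball (0 : E) ρ := Metric.ball_subset_ball (by linarith) hvb2
  have hv2 : ‖v‖ ^ 2 ≤ C ^ 2 / m := by
    calc ‖v‖ ^ 2 ≤ (C / √m) ^ 2 := by gcongr
      _ = C ^ 2 / m := by rw [div_pow, hss]
  have hx : ∀ i, ‖a i v‖ ≤ 2 * T i / ρ * ‖v‖ := by
    intro i
    have := norm_sub_le_of_norm_le (hd i) (hT i) hvb
    simpa [h0 i] using this
  have hl : ∀ i, ‖fderiv ℂ (a i) 0 v‖ ≤ 2 * T i / ρ * ‖v‖ := fun i =>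
    (ContinuousLinearMap.le_opNorm _ _).trans (by
      gcongr; exact norm_fderiv_le_of_norm_le (hd i) (hT i) hρ)
  have hxl : ∀ i, ‖a i v - fderiv ℂ (a i) 0 v‖ ≤ 4 * T i * (‖v‖ / ρ) ^ 2 := by
    intro i
    have := norm_sub_sub_fderiv_le (hd i) (hT i) hvb
    simpa [h0 i] using this
  have hxη : ∀ i < m, ‖a i v‖ ≤ η := by
    intro i hi
    refine abs_le_of_sq_le_sq' ?_ hη0.le |>.2
    calc ‖a i v‖ ^ 2 ≤ (2 * T i / ρ * ‖v‖) ^ 2 := by gcongr; exact hx i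
      _ = 4 / ρ ^ 2 * T i ^ 2 * ‖v‖ ^ 2 := by ring
      _ ≤ 4 / ρ ^ 2 * (η ^ 2 * ρ ^ 2 / (4 * C ^ 2) * m) * (C ^ 2 / m) := by
          gcongr; exact hm2 i hi
      _ = η ^ 2 := by field_simp
  refine ⟨fun i hi => (hxη i hi).trans hη1, ?_⟩
  -- the linear part
  have hA : ‖∑ i ∈ Finset.range m, a i v - ∑ i ∈ Finset.range m, fderiv ℂ (a i) 0 v‖ ≤ ε / 4 := by
    have hda : ∀ i, DifferentiableAt ℂ (a i) 0 := fun i =>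
      (hd i).differentiableAt (Metric.ball_mem_nhds 0 hρ)
    have hdA : DifferentiableOn ℂ (fun v => (m : ℂ)⁻¹ * ∑ i ∈ Finset.range m, a i v)
        (Metric.ball 0 (ρ / 2)) :=
      (DifferentiableOn.fun_sum fun i _ => (hd i).mono (Metric.ball_subset_ball
        (by linarith))).const_mul _
    have hfd : fderiv ℂ (fun v => (m : ℂ)⁻¹ * ∑ i ∈ Finset.range m, a i v) 0 =
        (m : ℂ)⁻¹ • ∑ i ∈ Finset.range m, fderiv ℂ (a i) 0 :=
      ((HasFDerivAt.fun_sum fun i _ => (hda i).hasFDerivAt).const_mul _).fderiv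
    -- The remainder estimate is applied to the mean rather than to each summand. The mean is
    -- uniformly at most ε₁ in norm, so after multiplication by `m` the remainder is of order ε₁ m
    -- ‖v‖², and m ‖v‖² ≤ C².
    have h1 := norm_sub_sub_fderiv_le hdA hm3 hvb2
    have hm0' : (m : ℂ) ≠ 0 := by exact_mod_cast hm0.ne'
    have h2 : ∑ i ∈ Finset.range m, a i v - ∑ i ∈ Finset.range m, fderiv ℂ (a i) 0 v =
        m * ((m : ℂ)⁻¹ * ∑ i ∈ Finset.range m, a i v - (m : ℂ)⁻¹ * ∑ i ∈ Finset.range m, a i 0 -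
          fderiv ℂ (fun v => (m : ℂ)⁻¹ * ∑ i ∈ Finset.range m, a i v) 0 (v - 0)) := by
      rw [hfd]
      simp only [h0, Finset.sum_const_zero, mul_zero, sub_zero, smul_apply,
        sum_apply, smul_eq_mul]
      field_simp
    rw [h2, norm_mul, Complex.norm_natCast]
    calc (m : ℝ) * _ ≤ m * (4 * ε₁ * (‖v - 0‖ / (ρ / 2)) ^ 2) := by gcongr
      _ = 16 / ρ ^ 2 * ε₁ * (m * ‖v‖ ^ 2) := by rw [sub_zero]; ring
      _ ≤ 16 / ρ ^ 2 * ε₁ * (m * (C ^ 2 / m)) := by gcongr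
      _ = ε / 4 := by rw [hε₁]; field_simp
  -- the quadratic part
  have hQ : ‖∑ i ∈ Finset.range m, a i v ^ 2‖ ≤ ε / 4 + ε / 4 := by
    have h1 : ‖∑ i ∈ Finset.range m, (fderiv ℂ (a i) 0 v) ^ 2‖ ≤ ε / 4 := by
      have h2 : ∑ i ∈ Finset.range m, (fderiv ℂ (a i) 0 v) ^ 2 =
          (m : ℂ)⁻¹ * ∑ i ∈ Finset.range m, (fderiv ℂ (a i) 0 u) ^ 2 := by
        rw [Finset.mul_sum]
        refine Finset.sum_congr rfl fun i _ => ?_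
        have h3 : fderiv ℂ (a i) 0 v = (((√(m : ℝ))⁻¹ : ℝ) : ℂ) * fderiv ℂ (a i) 0 u := by
          rw [hv, ← Complex.coe_smul, map_smul, smul_eq_mul]
        rw [h3, mul_pow, ← Complex.ofReal_pow, inv_pow, hss]
        push_cast
        ring
      rw [h2]
      exact hm4 u hu
    -- Replacing a by its linear part changes each square by O(T² ‖v‖³), so the total change is
    -- O(m^(-1/2)).
    have h2 : ‖∑ i ∈ Finset.range m, a i v ^ 2 -
        ∑ i ∈ Finset.range m, (fderiv ℂ (a i) 0 v) ^ 2‖ ≤ ε / 4 := by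
      rw [← Finset.sum_sub_distrib]
      refine (norm_sum_le _ _).trans ?_
      have h3 : ∀ i ∈ Finset.range m, ‖a i v ^ 2 - (fderiv ℂ (a i) 0 v) ^ 2‖ ≤
          16 / ρ ^ 3 * (C / √m) ^ 3 * T i ^ 2 := by
        intro i _
        rw [sq_sub_sq, norm_mul]
        have := hT0 i
        calc _ ≤ (2 * T i / ρ * ‖v‖ + 2 * T i / ρ * ‖v‖) * (4 * T i * (‖v‖ / ρ) ^ 2) := by
              gcongr
              · exact (norm_add_le _ _).trans (add_le_add (hx i) (hl i))
              · exact hxl i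
          _ = 16 / ρ ^ 3 * ‖v‖ ^ 3 * T i ^ 2 := by ring
          _ ≤ _ := by gcongr
      refine (Finset.sum_le_sum h3).trans ?_
      rw [← Finset.mul_sum]
      calc _ ≤ 16 / ρ ^ 3 * (C / √m) ^ 3 * (B' * m) := by gcongr; exact hBm m hm0
        _ = 16 * C ^ 3 * B' / ρ ^ 3 / √m * (m / √(m : ℝ) ^ 2) := by field_simp
        _ = 16 * C ^ 3 * B' / ρ ^ 3 / √m := by rw [hss, div_self hmp.ne', mul_one]
        _ ≤ ε / 4 := hm5.le
    calc _ = ‖(∑ i ∈ Finset.range m, a i v ^ 2 - ∑ i ∈ Finset.range m, (fderiv ℂ (a i) 0 v) ^ 2) +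
          ∑ i ∈ Finset.range m, (fderiv ℂ (a i) 0 v) ^ 2‖ := by rw [sub_add_cancel]
      _ ≤ _ := (norm_add_le _ _).trans (add_le_add h2 h1)
  -- the remainder
  have hR : ‖∑ i ∈ Finset.range m, (Complex.log (1 + a i v) - (a i v - a i v ^ 2 / 2))‖ ≤
      ε / 4 := by
    refine (norm_sum_le _ _).trans ?_
    have h3 : ∀ i ∈ Finset.range m, ‖Complex.log (1 + a i v) - (a i v - a i v ^ 2 / 2)‖ ≤
        η * (4 / ρ ^ 2 * (C ^ 2 / m)) * T i ^ 2 := by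
      intro i hi
      have hi' := Finset.mem_range.1 hi
      refine (norm_log_one_add_sub_le ((hxη i hi').trans hη1)).trans ?_
      calc ‖a i v‖ ^ 3 = ‖a i v‖ * ‖a i v‖ ^ 2 := by ring
        _ ≤ η * (2 * T i / ρ * ‖v‖) ^ 2 := by
            gcongr
            · exact hxη i hi'
            · exact hx i
        _ = η * (4 / ρ ^ 2 * ‖v‖ ^ 2) * T i ^ 2 := by ring
        _ ≤ _ := by gcongr
    refine (Finset.sum_le_sum h3).trans ?_
    rw [← Finset.mul_sum]
    calc _ ≤ η * (4 / ρ ^ 2 * (C ^ 2 / m)) * (B' * m) := by gcongr; exact hBm m hm0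
      _ = η * (4 * C ^ 2 / ρ ^ 2 * B') := by field_simp
      _ ≤ ε / 4 := hη2
  have hsplit : ∑ i ∈ Finset.range m, Complex.log (1 + a i v) -
      ∑ i ∈ Finset.range m, fderiv ℂ (a i) 0 v =
      ∑ i ∈ Finset.range m, (Complex.log (1 + a i v) - (a i v - a i v ^ 2 / 2)) +
      (∑ i ∈ Finset.range m, a i v - ∑ i ∈ Finset.range m, fderiv ℂ (a i) 0 v) -
      (∑ i ∈ Finset.range m, a i v ^ 2) / 2 := by
    rw [Finset.sum_sub_distrib, Finset.sum_sub_distrib, Finset.sum_div]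
    ring
  rw [hsplit]
  refine (norm_sub_le _ _).trans ?_
  have h5 := norm_add_le (∑ i ∈ Finset.range m, (Complex.log (1 + a i v) -
    (a i v - a i v ^ 2 / 2))) (∑ i ∈ Finset.range m, a i v -
      ∑ i ∈ Finset.range m, fderiv ℂ (a i) 0 v)
  have h6 : ‖(∑ i ∈ Finset.range m, a i v ^ 2) / 2‖ =
      ‖∑ i ∈ Finset.range m, a i v ^ 2‖ / 2 := by rw [norm_div]; norm_num
  linarith

end HolomorphicSums

/-! ### Fourier transform of the complex normal distribution. -/

section ComplexNormal

variable {n : ℕ}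

open scoped MatrixOrder ComplexOrder in
theorem Matrix.PosSemidef.exists_eq_mul_conjTranspose {Γ : Matrix (Fin n) (Fin n) ℂ}
    (h : Γ.PosSemidef) : ∃ A : Matrix (Fin n) (Fin n) ℂ, Γ = A * Aᴴ := by
  have h0 : 0 ≤ Γ := Matrix.nonneg_iff_posSemidef.2 h
  have h1 : (CFC.sqrt Γ).PosSemidef := Matrix.nonneg_iff_posSemidef.1 (CFC.sqrt_nonneg Γ)
  exact ⟨CFC.sqrt Γ, by rw [h1.isHermitian.eq, CFC.sqrt_mul_sqrt_self Γ h0]⟩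

/-- Change of variables for a complex linear map. -/
theorem integral_comp_mulVec (A : Matrix (Fin n) (Fin n) ℂ) (hA : A.det ≠ 0)
    {f : (Fin n → ℂ) → ℂ} (hf : Continuous f) :
    ∫ z, f z = (‖A.det‖ ^ 2 : ℝ) • ∫ w, f (A *ᵥ w) := by
  set L : (Fin n → ℂ) →ₗ[ℝ] (Fin n → ℂ) := (Matrix.toLin' A).restrictScalars ℝ with hL
  have hdet : LinearMap.det L = ‖A.det‖ ^ 2 := by
    rw [hL, LinearMap.det_restrictScalars, LinearMap.det_toLin', Algebra.norm_complex_apply,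
      Complex.normSq_eq_norm_sq]
  have hpos : 0 < ‖A.det‖ := norm_pos_iff.2 hA
  have hmap := Measure.map_linearMap_addHaar_eq_smul_addHaar (volume : Measure (Fin n → ℂ))
    (f := L) (by rw [hdet]; positivity)
  have hLc : Continuous L := L.continuous_of_finiteDimensional
  have h1 : ∫ z, f z ∂(Measure.map L volume) = ∫ w, f (L w) :=
    integral_map hLc.aemeasurable hf.aestronglyMeasurable
  rw [hmap, integral_smul_measure, hdet, ENNReal.toReal_ofReal (abs_nonneg _),
    abs_of_nonneg (by positivity)] at h1
  change _ = (‖A.det‖ ^ 2 : ℝ) • ∫ w, f (L w)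
  rw [← h1, smul_smul, mul_inv_cancel₀ (by positivity), one_smul]

theorem integral_exp_neg_norm_sq_add (s : ℂ) :
    ∫ w : ℂ, Complex.exp (-(‖w‖ : ℂ) ^ 2 + Complex.I * ((conj s * w).re : ℂ)) =
      Real.pi * Complex.exp (-(‖s‖ : ℂ) ^ 2 / 4) := by
  have h := GaussianFourier.integral_cexp_neg_mul_sq_norm_add (b := 1) (V := ℂ) (by simp)
    Complex.I s
  rw [Complex.finrank_real_complex] at h
  have h2 : ((2 : ℕ) : ℂ) / 2 = 1 := by norm_num
  rw [h2, Complex.cpow_one, Complex.I_sq, div_one, mul_one, neg_one_mul] at h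
  rw [← h]
  refine integral_congr_ae (Eventually.of_forall fun w => ?_)
  simp only [Complex.inner, one_mul, neg_mul, mul_comm w]

/-- The Fourier transform of the standard complex Gaussian. -/
theorem integral_exp_neg_sum_norm_sq_add (s : Fin n → ℂ) :
    ∫ w : Fin n → ℂ, Complex.exp (-((star w ⬝ᵥ w).re : ℂ) + Complex.I * ((star s ⬝ᵥ w).re : ℂ)) =
      (Real.pi : ℂ) ^ n * Complex.exp (-((star s ⬝ᵥ s).re : ℂ) / 4) := by
  have hre : ∀ w : Fin n → ℂ, (star w ⬝ᵥ w).re = ∑ i, ‖w i‖ ^ 2 := by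
    intro w
    rw [dotProduct, Complex.re_sum]
    refine Finset.sum_congr rfl fun i _ => ?_
    rw [Pi.star_apply, RCLike.star_def, mul_comm, Complex.mul_conj, Complex.normSq_eq_norm_sq,
      Complex.ofReal_re]
  have h := integral_fintype_prod_volume_eq_prod (𝕜 := ℂ) (ι := Fin n) (E := fun _ => ℂ)
    fun i w => Complex.exp (-(‖w‖ : ℂ) ^ 2 + Complex.I * ((conj (s i) * w).re : ℂ))
  simp only [integral_exp_neg_norm_sq_add, ← Complex.exp_sum] at h
  rw [Finset.prod_mul_distrib, Finset.prod_const, Finset.card_univ, Fintype.card_fin,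
    ← Complex.exp_sum] at h
  rw [hre s]
  have e : -((∑ i, ‖s i‖ ^ 2 : ℝ) : ℂ) / 4 = ∑ i, -(‖s i‖ : ℂ) ^ 2 / 4 := by
    push_cast
    rw [← Finset.sum_div, Finset.sum_neg_distrib]
  rw [e, ← h]
  refine integral_congr_ae (Eventually.of_forall fun w => ?_)
  have e1 : (star s ⬝ᵥ w).re = ∑ i, (conj (s i) * w i).re := by
    rw [dotProduct, Complex.re_sum]; rfl
  simp only [hre w, e1, Finset.sum_add_distrib, Finset.sum_neg_distrib, Complex.ofReal_sum,
    Complex.ofReal_pow, Finset.mul_sum]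

open scoped ComplexOrder in
/-- The Fourier transform of the unnormalized complex Gaussian with covariance `Γ`. -/
theorem integral_exp_neg_inv_add {Γ : Matrix (Fin n) (Fin n) ℂ} (hΓ : Γ.PosDef)
    (t : Fin n → ℂ) :
    ∫ z : Fin n → ℂ, Complex.exp (-((star z ⬝ᵥ (Γ⁻¹ *ᵥ z)).re : ℂ) +
      Complex.I * ((star t ⬝ᵥ z).re : ℂ)) =
      ((Real.pi ^ n * Γ.det.re : ℝ) : ℂ) * Complex.exp (-((star t ⬝ᵥ (Γ *ᵥ t)).re : ℂ) / 4) := by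
  -- The substitution z = A w reduces to the standard Gaussian; its real Jacobian |det A|² is det Γ.
  obtain ⟨A, hA⟩ := hΓ.posSemidef.exists_eq_mul_conjTranspose
  have hdet : Γ.det = ((‖A.det‖ ^ 2 : ℝ) : ℂ) := by
    rw [hA, Matrix.det_mul, Matrix.det_conjTranspose, RCLike.star_def, Complex.mul_conj,
      Complex.normSq_eq_norm_sq]
  have hA0 : A.det ≠ 0 := by
    intro h0
    have := hΓ.det_pos
    rw [hdet, h0] at this
    simp at this
  have hAu : IsUnit A.det := isUnit_iff_ne_zero.2 hA0
  have hcont : Continuous fun z : Fin n → ℂ => Complex.exp (-((star z ⬝ᵥ (Γ⁻¹ *ᵥ z)).re : ℂ) +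
      Complex.I * ((star t ⬝ᵥ z).re : ℂ)) := by
    have h1 : Continuous fun z : Fin n → ℂ => star z ⬝ᵥ (Γ⁻¹ *ᵥ z) :=
      Continuous.dotProduct continuous_star (Continuous.matrix_mulVec continuous_const
        continuous_id)
    have h2 : Continuous fun z : Fin n → ℂ => star t ⬝ᵥ z :=
      Continuous.dotProduct continuous_const continuous_id
    fun_prop
  rw [integral_comp_mulVec A hA0 hcont]
  have h1 : ∀ w : Fin n → ℂ, star (A *ᵥ w) ⬝ᵥ (Γ⁻¹ *ᵥ (A *ᵥ w)) = star w ⬝ᵥ w := by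
    intro w
    have h2 : Aᴴ * (Γ⁻¹ * A) = 1 := by
      have hAh : IsUnit (Aᴴ).det := by
        rw [Matrix.det_conjTranspose]; exact isUnit_iff_ne_zero.2 (star_ne_zero.2 hA0)
      rw [hA, Matrix.mul_inv_rev, mul_assoc, Matrix.nonsing_inv_mul A hAu, mul_one,
        Matrix.mul_nonsing_inv _ hAh]
    rw [Matrix.star_mulVec, ← Matrix.dotProduct_mulVec, Matrix.mulVec_mulVec, Matrix.mulVec_mulVec,
      mul_assoc, h2, Matrix.one_mulVec]
  have h3 : ∀ w : Fin n → ℂ, star t ⬝ᵥ (A *ᵥ w) = star (Aᴴ *ᵥ t) ⬝ᵥ w := by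
    intro w
    rw [Matrix.star_mulVec, Matrix.conjTranspose_conjTranspose, Matrix.dotProduct_mulVec]
  have h4 : star (Aᴴ *ᵥ t) ⬝ᵥ (Aᴴ *ᵥ t) = star t ⬝ᵥ (Γ *ᵥ t) := by
    rw [← h3, Matrix.mulVec_mulVec, ← hA]
  simp only [h1, h3]
  rw [integral_exp_neg_sum_norm_sq_add, h4, hdet, Complex.ofReal_re, Complex.real_smul]
  push_cast
  ring

open scoped ComplexOrder in
-- The total mass is the Fourier integral at t = 0; its being nonzero also yields integrability.
theorem isProbabilityMeasure_complexNormal {Γ : Matrix (Fin n) (Fin n) ℂ} (hΓ : Γ.PosDef) :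
    IsProbabilityMeasure (complexNormal 0 Γ) := by
  have hd : 0 < Γ.det.re := (Complex.pos_iff.1 hΓ.det_pos).1
  set c : ℝ := Real.pi ^ n * Γ.det.re with hc
  have hc0 : 0 < c := by positivity
  have h := integral_exp_neg_inv_add hΓ 0
  have h1 : ∫ z : Fin n → ℂ, Real.exp (-(star z ⬝ᵥ (Γ⁻¹ *ᵥ z)).re) = c := by
    have h2 : ((∫ z : Fin n → ℂ, Real.exp (-(star z ⬝ᵥ (Γ⁻¹ *ᵥ z)).re) : ℝ) : ℂ) = (c : ℂ) := by
      rw [← integral_complex_ofReal]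
      simpa [hc] using h
    exact_mod_cast h2
  have hint : Integrable fun z : Fin n → ℂ => Real.exp (-(star z ⬝ᵥ (Γ⁻¹ *ᵥ z)).re) :=
    Integrable.of_integral_ne_zero (by rw [h1]; exact hc0.ne')
  refine ⟨?_⟩
  rw [complexNormal, withDensity_apply _ MeasurableSet.univ, setLIntegral_univ,
    ← ofReal_integral_eq_lintegral_ofReal]
  · simp only [sub_zero]
    rw [integral_div, h1, div_self hc0.ne', ENNReal.ofReal_one]
  · simpa using hint.div_const c
  · exact Eventually.of_forall fun z => div_nonneg (Real.exp_pos _).le hc0.le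

open scoped ComplexOrder in
theorem integral_complexNormal {Γ : Matrix (Fin n) (Fin n) ℂ} (hΓ : Γ.PosDef) (t : Fin n → ℂ) :
    ∫ z, Complex.exp (((star t ⬝ᵥ z).re : ℂ) * Complex.I) ∂(complexNormal 0 Γ) =
      Complex.exp (-((star t ⬝ᵥ (Γ *ᵥ t)).re : ℂ) / 4) := by
  have hd : 0 < Γ.det.re := (Complex.pos_iff.1 hΓ.det_pos).1
  set c : ℝ := Real.pi ^ n * Γ.det.re with hc
  have hc0 : 0 < c := by positivity
  have hc0' : (c : ℂ) ≠ 0 := by exact_mod_cast hc0.ne'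
  have hm : Measurable fun z : Fin n → ℂ => ENNReal.ofReal
      (Real.exp (-(star (z - 0) ⬝ᵥ (Γ⁻¹ *ᵥ (z - 0))).re) / c) := by
    have h1 : Continuous fun z : Fin n → ℂ => star (z - 0) ⬝ᵥ (Γ⁻¹ *ᵥ (z - 0)) :=
      Continuous.dotProduct (continuous_star.comp (continuous_id.sub continuous_const))
        (Continuous.matrix_mulVec continuous_const (continuous_id.sub continuous_const))
    have h2 := (Complex.continuous_re.comp h1).measurable
    exact ((Real.measurable_exp.comp h2.neg).div_const c).ennreal_ofReal
  rw [complexNormal, integral_withDensity_eq_integral_toReal_smul hm (by simp)]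
  have h := integral_exp_neg_inv_add hΓ t
  rw [← hc] at h
  rw [eq_comm, ← mul_right_inj' hc0', ← h, ← integral_const_mul]
  refine integral_congr_ae (Eventually.of_forall fun z => ?_)
  simp only [sub_zero]
  rw [ENNReal.toReal_ofReal (div_nonneg (Real.exp_pos _).le hc0.le), Complex.real_smul,
    Complex.exp_add]
  rw [Complex.ofReal_div, Complex.ofReal_exp, Complex.ofReal_neg, mul_comm Complex.I]
  field_simp

end ComplexNormal

/-! ### Moments of the scores and the central limit theorem. -/

namespace HolomorphicLossModel

variable {X : Type*} [MeasurableSpace X] {ν : Measure X} {n : ℕ} {g : Matrix (Fin n) (Fin n) ℂ}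
  {D : (Fin n → ℂ) → X → EReal} (M : HolomorphicLossModel ν g D)

theorem norm_fderiv_apply_le {x : X} (hx : x ∈ M.good) (v : Fin n → ℂ) :
    ‖M.score x ⬝ᵥ v‖ ≤ 2 * M.T x / M.radius * ‖v‖ := by
  rw [← M.fderiv_eq x hx]
  refine (ContinuousLinearMap.le_opNorm _ _).trans ?_
  gcongr
  exact norm_fderiv_le_of_norm_le (M.differentiableOn x hx) (M.norm_le x hx) M.radius_pos

theorem memLp_T : MemLp M.T 2 ν :=
  (memLp_two_iff_integrable_sq M.measurable_T.aestronglyMeasurable).2 M.integrable_T_sq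

theorem measurable_score_apply (α : Fin n) : Measurable fun x => M.score x α :=
  (measurable_pi_apply α).comp M.measurable_score

theorem memLp_score (α : Fin n) : MemLp (fun x => M.score x α) 2 ν := by
  refine (M.memLp_T.const_mul (2 / M.radius)).of_le
    (M.measurable_score_apply α).aestronglyMeasurable ?_
  filter_upwards [M.ae_good] with x hx
  have h := M.norm_fderiv_apply_le hx (Pi.single α 1)
  rw [dotProduct_single_one] at h
  refine h.trans ((le_of_eq ?_).trans (le_abs_self _))
  rw [Pi.norm_single, norm_one]
  ring

theorem memLp_score_dotProduct (c : Fin n → ℂ) : MemLp (fun x => M.score x ⬝ᵥ c) 2 ν := by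
  simp only [dotProduct]
  exact memLp_finsetSum _ fun α _ => (M.memLp_score α).mul_const (c α)

theorem integral_score_dotProduct_sq (c : Fin n → ℂ) : ∫ x, (M.score x ⬝ᵥ c) ^ 2 ∂ν = 0 := by
  have h : ∀ x, (M.score x ⬝ᵥ c) ^ 2 =
      ∑ α, ∑ β, (c α * c β) * (M.score x α * M.score x β) := by
    intro x
    rw [pow_two, dotProduct, Finset.sum_mul_sum]
    exact Finset.sum_congr rfl fun α _ => Finset.sum_congr rfl fun β _ => by ring
  have hi : ∀ α β, Integrable (fun x => (c α * c β) * (M.score x α * M.score x β)) ν :=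
    fun α β => ((M.memLp_score α).integrable_mul (M.memLp_score β)).const_mul _
  simp only [h]
  rw [integral_finsetSum _ fun α _ => integrable_finsetSum _ fun β _ => hi α β]
  refine Finset.sum_eq_zero fun α _ => ?_
  rw [integral_finsetSum _ fun β _ => hi α β]
  refine Finset.sum_eq_zero fun β _ => ?_
  rw [integral_const_mul, M.integral_score_mul, mul_zero]

theorem integral_conj_score_dotProduct_mul (c : Fin n → ℂ) :
    ∫ x, conj (M.score x ⬝ᵥ c) * (M.score x ⬝ᵥ c) ∂ν = star c ⬝ᵥ (g *ᵥ c) := by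
  have h : ∀ x, conj (M.score x ⬝ᵥ c) * (M.score x ⬝ᵥ c) =
      ∑ β, ∑ α, (conj (c β) * c α) * (conj (M.score x β) * M.score x α) := by
    intro x
    rw [dotProduct, map_sum, Finset.sum_mul_sum]
    exact Finset.sum_congr rfl fun β _ => Finset.sum_congr rfl fun α _ => by rw [map_mul]; ring
  have hi : ∀ β α, Integrable (fun x => (conj (c β) * c α) *
      (conj (M.score x β) * M.score x α)) ν :=
    fun β α => ((M.memLp_score β).star.integrable_mul (M.memLp_score α)).const_mul _
  simp only [h]
  rw [integral_finsetSum _ fun β _ => integrable_finsetSum _ fun α _ => hi β α, dotProduct]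
  refine Finset.sum_congr rfl fun β _ => ?_
  rw [integral_finsetSum _ fun α _ => hi β α, Matrix.mulVec, dotProduct, Finset.mul_sum]
  refine Finset.sum_congr rfl fun α _ => ?_
  rw [integral_const_mul, M.integral_conj_score_mul, Pi.star_apply, RCLike.star_def]
  ring

theorem integral_re_score_dotProduct [IsFiniteMeasure ν] (c : Fin n → ℂ) :
    ∫ x, (M.score x ⬝ᵥ c).re ∂ν = 0 := by
  have h1 : ∫ x, M.score x ⬝ᵥ c ∂ν = 0 := by
    simp only [dotProduct]
    rw [integral_finsetSum _ fun α _ => ((M.memLp_score α).mul_const (c α)).integrable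
      one_le_two]
    refine Finset.sum_eq_zero fun α _ => ?_
    rw [integral_mul_const, M.integral_score, zero_mul]
  have h2 := integral_re ((M.memLp_score_dotProduct c).integrable one_le_two)
  simpa [h1] using h2

/-- From (Re x)² = (|x|² + Re x²)/2: the holomorphic second moment vanishes, so only half of the
Hermitian form remains. This half gives the factor 1/4 in the characteristic function of the complex
normal law. -/
theorem integral_re_score_dotProduct_sq (c : Fin n → ℂ) :
    ∫ x, (M.score x ⬝ᵥ c).re ^ 2 ∂ν = (star c ⬝ᵥ (g *ᵥ c)).re / 2 := by
  have hm := M.memLp_score_dotProduct c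
  have i1 : Integrable (fun x => (M.score x ⬝ᵥ c) ^ 2) ν :=
    (hm.integrable_mul hm).congr (Eventually.of_forall fun x => (pow_two _).symm)
  have i2 : Integrable (fun x => conj (M.score x ⬝ᵥ c) * (M.score x ⬝ᵥ c)) ν :=
    hm.star.integrable_mul hm
  have h1 := integral_re i1
  have h2 := integral_re i2
  rw [M.integral_score_dotProduct_sq] at h1
  rw [M.integral_conj_score_dotProduct_mul] at h2
  simp only [RCLike.re_to_complex, Complex.zero_re] at h1 h2
  have e : ∀ x, (M.score x ⬝ᵥ c).re ^ 2 = (1 / 2) * ((M.score x ⬝ᵥ c) ^ 2).re +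
      (1 / 2) * (conj (M.score x ⬝ᵥ c) * (M.score x ⬝ᵥ c)).re := by
    intro x
    simp only [pow_two, Complex.mul_re, Complex.conj_re, Complex.conj_im]
    ring
  simp only [e]
  have h3 := integral_add (i1.re.const_mul (1 / 2)) (i2.re.const_mul (1 / 2))
  simp only [RCLike.re_to_complex] at h3
  rw [h3, integral_const_mul, integral_const_mul, h1, h2]
  ring

variable {S : Type*} [MeasurableSpace S] {P : Measure S} {Z : ℕ → S → X}

/-- The linearized estimator, scaled by `√m`. -/
noncomputable def linearEstimator (Z : ℕ → S → X) (m : ℕ) (s : S) : Fin n → ℂ :=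
  ((√(m : ℝ))⁻¹ : ℝ) • (g⁻¹ *ᵥ ∑ i ∈ Finset.range m, star (M.score (Z i s)))

theorem measurable_linearEstimator (hZ : ∀ i, Measurable (Z i)) (m : ℕ) :
    Measurable (M.linearEstimator Z m) := by
  have h1 : Measurable fun s => ∑ i ∈ Finset.range m, star (M.score (Z i s)) :=
    Finset.measurable_fun_sum _ fun i _ =>
      continuous_star.measurable.comp (M.measurable_score.comp (hZ i))
  have h2 : Continuous fun v : Fin n → ℂ => ((√(m : ℝ))⁻¹ : ℝ) • (g⁻¹ *ᵥ v) := by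
    have h3 : Continuous fun v : Fin n → ℂ => g⁻¹ *ᵥ v :=
      Continuous.matrix_mulVec continuous_const continuous_id
    fun_prop
  exact h2.measurable.comp h1

theorem re_star_dotProduct_linearEstimator (hg : g.IsHermitian) (t : Fin n → ℂ) (m : ℕ) (s : S) :
    (star t ⬝ᵥ M.linearEstimator Z m s).re =
      (√(m : ℝ))⁻¹ * ∑ i ∈ Finset.range m, (M.score (Z i s) ⬝ᵥ (g⁻¹ *ᵥ t)).re := by
  have h : ∀ ℓ : Fin n → ℂ, star t ⬝ᵥ (g⁻¹ *ᵥ star ℓ) = star (ℓ ⬝ᵥ (g⁻¹ *ᵥ t)) := by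
    intro ℓ
    rw [Matrix.dotProduct_mulVec, ← Matrix.star_dotProduct_star, Matrix.star_mulVec,
      hg.inv.eq]
  rw [linearEstimator, Matrix.mulVec_sum, dotProduct_smul, dotProduct_sum, Complex.real_smul,
    Complex.re_ofReal_mul, Complex.re_sum]
  simp only [h, RCLike.star_def, Complex.conj_re]

open scoped ComplexOrder in
/-- The central limit theorem for the linearized estimator. -/
theorem tendstoInDistribution_linearEstimator [IsProbabilityMeasure P]
    (hg : g.PosDef) (hZ : ∀ i, Measurable (Z i)) (hind : iIndepFun Z P)
    (hlaw : ∀ i, HasLaw (Z i) ν P) [IsProbabilityMeasure (complexNormal 0 g⁻¹)] :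
    TendstoInDistribution (M.linearEstimator Z) atTop id (fun _ => P) (complexNormal 0 g⁻¹) := by
  have hν : IsProbabilityMeasure ν := (hlaw 0).isProbabilityMeasure_iff.1 inferInstance
  -- Cramér–Wold: in direction `t` the estimator is a normalized sum of real variables with
  -- coefficients `g⁻¹ *ᵥ t`, so the one-dimensional central limit theorem, evaluated at frequency
  -- 1, gives the limit.
  have key : ∀ t : Fin n → ℂ, Tendsto (fun m => ∫ s,
      Complex.exp (((star t ⬝ᵥ M.linearEstimator Z m s).re : ℂ) * Complex.I) ∂P) atTop
      (𝓝 (Complex.exp (-((star t ⬝ᵥ (g⁻¹ *ᵥ t)).re : ℂ) / 4))) := by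
    intro t
    set c : Fin n → ℂ := g⁻¹ *ᵥ t with hc
    set Y : ℕ → S → ℝ := fun i s => (M.score (Z i s) ⬝ᵥ c).re with hY
    have hfm : Measurable fun x => (M.score x ⬝ᵥ c).re := by
      have : Continuous fun v : Fin n → ℂ => (v ⬝ᵥ c).re :=
        Complex.continuous_re.comp (continuous_id.dotProduct continuous_const)
      exact this.measurable.comp M.measurable_score
    have hmem : MemLp (fun x => (M.score x ⬝ᵥ c).re) 2 ν := (M.memLp_score_dotProduct c).re
    have hident : ∀ i, IdentDistrib (Y i) (Y 0) P P := fun i =>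
      ((hlaw i).identDistrib (hlaw 0)).comp hfm
    have hYind : iIndepFun Y P := hind.comp _ fun _ => hfm
    have hYmem : MemLp (Y 0) 2 P :=
      hmem.comp_measurePreserving ((hlaw 0).measurePreserving (hZ 0))
    have hcomp : ∀ f : X → ℝ, Measurable f → ∫ s, f (Z 0 s) ∂P = ∫ x, f x ∂ν := fun f hf =>
      (hlaw 0).integral_comp hf.aestronglyMeasurable
    have hmean : ∫ s, Y 0 s ∂P = 0 := by
      rw [← M.integral_re_score_dotProduct c, ← hcomp _ hfm]
    have hsq : ∫ s, Y 0 s ^ 2 ∂P = (star t ⬝ᵥ (g⁻¹ *ᵥ t)).re / 2 := by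
      have h1 : star c ⬝ᵥ (g *ᵥ c) = star t ⬝ᵥ (g⁻¹ *ᵥ t) := by
        have hu : IsUnit g.det := isUnit_iff_ne_zero.2 hg.det_pos.ne'
        rw [hc, Matrix.mulVec_mulVec, Matrix.mul_nonsing_inv _ hu, Matrix.one_mulVec,
          Matrix.star_mulVec, hg.isHermitian.inv.eq, Matrix.dotProduct_mulVec]
      rw [← h1, ← M.integral_re_score_dotProduct_sq c, ← hcomp _ (hfm.pow_const 2)]
    have hvar : Var[Y 0; P] = (star t ⬝ᵥ (g⁻¹ *ᵥ t)).re / 2 := by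
      rw [variance_eq_sub hYmem, hmean, ← hsq]
      simp
    have hclt := tendstoInDistribution_inv_sqrt_mul_sum_sub (Y := id) (P' :=
      gaussianReal 0 Var[Y 0; P].toNNReal) HasLaw.id hYmem hYind hident
    have h := ProbabilityMeasure.tendsto_iff_tendsto_charFun.1 hclt.tendsto 1
    simp only [ProbabilityMeasure.coe_mk, Measure.map_id, charFun_gaussianReal, hmean, mul_zero,
      sub_zero] at h
    have h2 : ∀ m : ℕ, charFun (P.map fun s => (√(m : ℝ))⁻¹ * ∑ i ∈ Finset.range m, Y i s) 1 =
        ∫ s, Complex.exp (((star t ⬝ᵥ M.linearEstimator Z m s).re : ℂ) * Complex.I) ∂P := by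
      intro m
      rw [charFun_apply_real, integral_map]
      · simp only [M.re_star_dotProduct_linearEstimator hg.isHermitian, Complex.ofReal_one, one_mul]
        rfl
      · exact ((Finset.measurable_fun_sum _ fun i _ => hfm.comp (hZ i)).const_mul _).aemeasurable
      · fun_prop
    simp only [h2] at h
    have h3 : 0 ≤ Var[Y 0; P] := variance_nonneg _ _
    have h4 : Complex.exp (((1 : ℝ) : ℂ) * ((0 : ℝ) : ℂ) * Complex.I -
        ((Var[Y 0; P].toNNReal : ℝ) : ℂ) * ((1 : ℝ) : ℂ) ^ 2 / 2) =
        Complex.exp (-((star t ⬝ᵥ (g⁻¹ *ᵥ t)).re : ℂ) / 4) := by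
      rw [Real.coe_toNNReal _ h3, hvar]
      congr 1
      push_cast
      ring
    rwa [h4] at h
  -- Characteristic functions need an inner product, so convergence is proved in `EuclideanSpace`
  -- and carried back to the sup-normed space by the continuous identification.
  have hH : ∀ (x : Fin n → ℂ) (t : EuclideanSpace ℂ (Fin n)),
      inner ℝ (WithLp.toLp 2 x : EuclideanSpace ℂ (Fin n)) t = (star (WithLp.ofLp t) ⬝ᵥ x).re := by
    intro x t
    rw [PiLp.inner_apply, dotProduct, Complex.re_sum]
    refine Finset.sum_congr rfl fun i _ => ?_
    simp only [Complex.inner, Pi.star_apply, RCLike.star_def, Complex.mul_re, Complex.conj_re,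
      Complex.conj_im]
    ring
  have hto : Continuous (WithLp.toLp 2 : (Fin n → ℂ) → EuclideanSpace ℂ (Fin n)) :=
    PiLp.continuous_toLp 2 _
  have hmeas : ∀ m, Measurable fun s =>
      (WithLp.toLp 2 (M.linearEstimator Z m s) : EuclideanSpace ℂ (Fin n)) := fun m =>
    hto.measurable.comp (M.measurable_linearEstimator hZ m)
  have hdist : TendstoInDistribution (fun m s =>
      (WithLp.toLp 2 (M.linearEstimator Z m s) : EuclideanSpace ℂ (Fin n))) atTop
      (WithLp.toLp 2) (fun _ => P) (complexNormal 0 g⁻¹) := by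
    refine ⟨fun m => (hmeas m).aemeasurable, hto.measurable.aemeasurable,
      ProbabilityMeasure.tendsto_iff_tendsto_charFun.2 fun t => ?_⟩
    simp only [ProbabilityMeasure.coe_mk]
    rw [charFun_apply, integral_map hto.measurable.aemeasurable (by fun_prop)]
    simp only [hH]
    rw [integral_complexNormal hg.inv]
    refine (key (WithLp.ofLp t)).congr fun m => ?_
    rw [charFun_apply, integral_map (hmeas m).aemeasurable (by fun_prop)]
    simp only [hH]
  exact hdist.continuous_comp (PiLp.continuous_ofLp 2 _)

end HolomorphicLossModel

/-! ### Strong laws and almost sure linearization of the loss. -/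

/-- The strong law of large numbers for a function of independent observations. -/
theorem ae_tendsto_mean_of_hasLaw {X S E : Type*} [MeasurableSpace X] [MeasurableSpace S]
    [NormedAddCommGroup E] [NormedSpace ℝ E] [CompleteSpace E] [MeasurableSpace E] [BorelSpace E]
    [SecondCountableTopology E]
    {ν : Measure X} {P : Measure S} {Z : ℕ → S → X} (hZ : ∀ i, Measurable (Z i))
    (hind : iIndepFun Z P) (hlaw : ∀ i, HasLaw (Z i) ν P) {f : X → E} (hf : Measurable f)
    (hfi : Integrable f ν) :
    ∀ᵐ s ∂P, Tendsto (fun m : ℕ => (m : ℝ)⁻¹ • ∑ i ∈ Finset.range m, f (Z i s)) atTop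
      (𝓝 (∫ x, f x ∂ν)) := by
  have h := strong_law_ae (μ := P) (fun i s => f (Z i s))
    ((((hlaw 0).measurePreserving (hZ 0)).integrable_comp hf.aestronglyMeasurable).2 hfi)
    (fun i j hij => (hind.indepFun hij).comp hf hf)
    (fun i => ((hlaw i).identDistrib (hlaw 0)).comp hf)
  have h2 : ∫ s, f (Z 0 s) ∂P = ∫ x, f x ∂ν := (hlaw 0).integral_comp hf.aestronglyMeasurable
  rwa [h2] at h

namespace HolomorphicLossModel

variable {X : Type*} [MeasurableSpace X] {ν : Measure X} {n : ℕ} {g : Matrix (Fin n) (Fin n) ℂ}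
  {D : (Fin n → ℂ) → X → EReal} (M : HolomorphicLossModel ν g D)
  {S : Type*} [MeasurableSpace S] {P : Measure S} {Z : ℕ → S → X}

theorem measurable_a_apply (v : Fin n → ℂ) : Measurable fun x => M.a v x :=
  M.measurable_a.comp measurable_prodMk_left

theorem integrable_a [IsFiniteMeasure ν] {v : Fin n → ℂ} (hv : v ∈ Metric.ball 0 M.radius) :
    Integrable (fun x => M.a v x) ν := by
  refine (M.memLp_T.integrable one_le_two).mono' (M.measurable_a_apply v).aestronglyMeasurable ?_
  filter_upwards [M.ae_good] with x hx using M.norm_le x hx v hv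

/-- Almost surely, the random part of the total loss at scale `1 / √m` is asymptotically linear,
uniformly on bounded sets. -/
theorem ae_eventually_norm_sum_log_sub_le [IsProbabilityMeasure P] (hZ : ∀ i, Measurable (Z i))
    (hind : iIndepFun Z P) (hlaw : ∀ i, HasLaw (Z i) ν P) :
    ∀ᵐ s ∂P, (∀ i, Z i s ∈ M.good) ∧ ∀ C > 0, ∀ ε > 0, ∀ᶠ m : ℕ in atTop,
      ∀ u : Fin n → ℂ, ‖u‖ ≤ C →
        (∀ i < m, ‖M.a (((√(m : ℝ))⁻¹ : ℝ) • u) (Z i s)‖ ≤ 1 / 2) ∧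
        ‖∑ i ∈ Finset.range m, Complex.log (1 + M.a (((√(m : ℝ))⁻¹ : ℝ) • u) (Z i s)) -
          ∑ i ∈ Finset.range m, M.score (Z i s) ⬝ᵥ (((√(m : ℝ))⁻¹ : ℝ) • u)‖ ≤ ε := by
  have hν : IsProbabilityMeasure ν := (hlaw 0).isProbabilityMeasure_iff.1 inferInstance
  obtain ⟨Q, hQ, hQd⟩ := TopologicalSpace.exists_countable_dense (Fin n → ℂ)
  have hgood : ∀ᵐ s ∂P, ∀ i, Z i s ∈ M.good := ae_all_iff.2 fun i =>
    ((hlaw i).measurePreserving (hZ i)).quasiMeasurePreserving.ae M.ae_good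
  have hT := ae_tendsto_mean_of_hasLaw hZ hind hlaw (M.measurable_T.pow_const 2) M.integrable_T_sq
  -- A countable dense set of parameters keeps the exceptional set null; uniformity in `v` comes
  -- afterwards from boundedness and holomorphy.
  have ha : ∀ᵐ s ∂P, ∀ v ∈ Q, v ∈ Metric.ball 0 M.radius →
      Tendsto (fun m : ℕ => (m : ℝ)⁻¹ • ∑ i ∈ Finset.range m, M.a v (Z i s)) atTop (𝓝 0) := by
    refine (ae_ball_iff hQ).2 fun v _ => ?_
    by_cases hv : v ∈ Metric.ball 0 M.radius
    · have h := ae_tendsto_mean_of_hasLaw hZ hind hlaw (M.measurable_a_apply v) (M.integrable_a hv)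
      rw [M.integral_a v hv] at h
      filter_upwards [h] with s hs _ using hs
    · exact Eventually.of_forall fun s h => absurd h hv
  have hs2 : ∀ᵐ s ∂P, ∀ α β, Tendsto (fun m : ℕ => (m : ℝ)⁻¹ • ∑ i ∈ Finset.range m,
      M.score (Z i s) α * M.score (Z i s) β) atTop (𝓝 0) := by
    refine ae_all_iff.2 fun α => ae_all_iff.2 fun β => ?_
    have h := ae_tendsto_mean_of_hasLaw hZ hind hlaw
      ((M.measurable_score_apply α).mul (M.measurable_score_apply β))
      ((M.memLp_score α).integrable_mul (M.memLp_score β))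
    have h0 : ∫ x, ((fun x => M.score x α) * fun x => M.score x β) x ∂ν = 0 :=
      M.integral_score_mul α β
    rw [h0] at h
    exact h
  filter_upwards [hgood, hT, ha, hs2] with s h1 h2 h3 h4
  refine ⟨h1, fun C hC ε hε => ?_⟩
  obtain ⟨B, hB⟩ := h2.bddAbove_range
  have hmean : ∀ m : ℕ, ∀ v ∈ Metric.ball (0 : Fin n → ℂ) M.radius,
      ‖(m : ℂ)⁻¹ * ∑ i ∈ Finset.range m, M.a v (Z i s)‖ ≤ 1 + B := by
    intro m v hv
    have hB' : (m : ℝ)⁻¹ * ∑ i ∈ Finset.range m, M.T (Z i s) ^ 2 ≤ B := hB (Set.mem_range_self m)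
    rw [norm_mul, norm_inv, Complex.norm_natCast]
    calc (m : ℝ)⁻¹ * ‖∑ i ∈ Finset.range m, M.a v (Z i s)‖
        ≤ (m : ℝ)⁻¹ * ∑ i ∈ Finset.range m, (1 + M.T (Z i s) ^ 2) := by
          gcongr
          refine (norm_sum_le _ _).trans (Finset.sum_le_sum fun i _ => ?_)
          refine (M.norm_le _ (h1 i) v hv).trans ?_
          nlinarith [sq_nonneg (M.T (Z i s) - 1 / 2)]
      _ = (m : ℝ)⁻¹ * m + (m : ℝ)⁻¹ * ∑ i ∈ Finset.range m, M.T (Z i s) ^ 2 := by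
          rw [Finset.sum_add_distrib, mul_add]; simp
      _ ≤ 1 + B := add_le_add inv_mul_le_one hB'
  have h := eventually_norm_sum_log_sub_le (a := fun i v => M.a v (Z i s))
    (T := fun i => M.T (Z i s)) M.radius_pos (fun i => M.differentiableOn _ (h1 i))
    (fun i => M.norm_le _ (h1 i)) (fun i => M.a_zero _ (h1 i)) h2
    (fun ε hε => eventually_forall_norm_le_of_dense (f := fun m v => (m : ℂ)⁻¹ *
      ∑ i ∈ Finset.range m, M.a v (Z i s)) M.radius_pos
      (fun m => (DifferentiableOn.fun_sum fun i _ => M.differentiableOn _ (h1 i)).const_mul _)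
      hmean hQd (fun v hvQ hv => by
        refine (h3 v hvQ hv).congr fun m => ?_
        rw [Complex.real_smul]
        push_cast
        rfl) hε)
    (fun C ε hε => ?_) hC hε
  · refine h.mono fun m hm u hu => ?_
    have := hm u hu
    simp only [M.fderiv_eq _ (h1 _)] at this
    exact this
  -- The mean of squared derivatives is a quadratic polynomial in `u` whose coefficients tend to
  -- zero; C² bounds each monomial.
  · have hev : ∀ᶠ m : ℕ in atTop, ∑ α, ∑ β, C ^ 2 * ‖(m : ℝ)⁻¹ • ∑ i ∈ Finset.range m,
        M.score (Z i s) α * M.score (Z i s) β‖ ≤ ε := by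
      have ht : Tendsto (fun m : ℕ => ∑ α, ∑ β, C ^ 2 * ‖(m : ℝ)⁻¹ • ∑ i ∈ Finset.range m,
          M.score (Z i s) α * M.score (Z i s) β‖) atTop
          (𝓝 (∑ α : Fin n, ∑ β : Fin n, C ^ 2 * ‖(0 : ℂ)‖)) :=
        tendsto_finsetSum _ fun α _ => tendsto_finsetSum _ fun β _ =>
          (h4 α β).norm.const_mul _
      simp only [norm_zero, mul_zero, Finset.sum_const_zero] at ht
      exact ht.eventually_le_const hε
    filter_upwards [hev] with m hm u hu
    refine le_trans ?_ hm
    have e : (m : ℂ)⁻¹ * ∑ i ∈ Finset.range m, (fderiv ℂ (fun v => M.a v (Z i s)) 0 u) ^ 2 =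
        ∑ α, ∑ β, (u α * u β) * ((m : ℝ)⁻¹ • ∑ i ∈ Finset.range m,
          M.score (Z i s) α * M.score (Z i s) β) := by
      have e1 : ∀ i, (fderiv ℂ (fun v => M.a v (Z i s)) 0 u) ^ 2 =
          ∑ α, ∑ β, (u α * u β) * (M.score (Z i s) α * M.score (Z i s) β) := by
        intro i
        rw [M.fderiv_eq _ (h1 i), pow_two, dotProduct, Finset.sum_mul_sum]
        exact Finset.sum_congr rfl fun α _ => Finset.sum_congr rfl fun β _ => by ring
      simp only [e1]
      rw [Finset.sum_comm, Finset.mul_sum]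
      refine Finset.sum_congr rfl fun α _ => ?_
      rw [Finset.sum_comm, Finset.mul_sum]
      refine Finset.sum_congr rfl fun β _ => ?_
      rw [← Finset.mul_sum, Complex.real_smul]
      push_cast
      ring
    rw [e]
    refine (norm_sum_le _ _).trans (Finset.sum_le_sum fun α _ => (norm_sum_le _ _).trans
      (Finset.sum_le_sum fun β _ => ?_))
    rw [norm_mul]
    gcongr
    rw [norm_mul, pow_two]
    have := (norm_nonneg u).trans hu
    exact mul_le_mul ((norm_le_pi_norm u α).trans hu) ((norm_le_pi_norm u β).trans hu)
      (norm_nonneg _) this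

end HolomorphicLossModel

/-! ### Tightness and events of probability tending to one. -/

section WeakConvergence

/-- A sequence that converges in distribution is bounded in probability. -/
theorem eventually_measure_norm_ge_le {E S T : Type*} [NormedAddCommGroup E] [MeasurableSpace E]
    [BorelSpace E] [MeasurableSpace S] [MeasurableSpace T] {P : Measure S} {Q : Measure T}
    [IsProbabilityMeasure P] [IsProbabilityMeasure Q] {U : ℕ → S → E} {W : T → E}
    (h : TendstoInDistribution U atTop W (fun _ => P) Q) {η : ℝ≥0∞} (hη : 0 < η) :
    ∃ C : ℝ, 0 < C ∧ ∀ᶠ m in atTop, P {s | C ≤ ‖U m s‖} ≤ η := by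
  have hcl : ∀ k : ℕ, IsClosed {x : E | (k : ℝ) ≤ ‖x‖} := fun k =>
    isClosed_le continuous_const continuous_norm
  have h1 : Tendsto (Q.map W ∘ fun k : ℕ => {x : E | (k : ℝ) ≤ ‖x‖}) atTop
      (𝓝 (Q.map W (⋂ k : ℕ, {x : E | (k : ℝ) ≤ ‖x‖}))) :=
    have := Measure.isProbabilityMeasure_map h.aemeasurable_limit
    tendsto_measure_iInter_atTop (fun k => (hcl k).measurableSet.nullMeasurableSet)
      (fun i j hij x (hx : (j : ℝ) ≤ ‖x‖) => (Nat.cast_le.2 hij).trans hx)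
      ⟨0, measure_ne_top _ _⟩
  have h2 : (⋂ k : ℕ, {x : E | (k : ℝ) ≤ ‖x‖}) = ∅ := by
    refine Set.eq_empty_iff_forall_notMem.2 fun x hx => ?_
    obtain ⟨k, hk⟩ := exists_nat_gt ‖x‖
    exact absurd (Set.mem_iInter.1 hx k : (k : ℝ) ≤ ‖x‖) (not_le.2 hk)
  rw [h2, measure_empty] at h1
  obtain ⟨k, hk, hk0⟩ := ((h1.eventually_lt_const hη).and (eventually_gt_atTop 0)).exists
  refine ⟨k, by exact_mod_cast hk0, ?_⟩
  have h3 := ProbabilityMeasure.limsup_measure_closed_le_of_tendsto h.tendsto (hcl k)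
  have h4 := eventually_lt_of_limsup_lt (h3.trans_lt hk)
  filter_upwards [h4] with m hm
  simp only [ProbabilityMeasure.coe_mk] at hm
  rw [Measure.map_apply_of_aemeasurable (h.forall_aemeasurable m) (hcl k).measurableSet] at hm
  exact hm.le

/-- Events that almost surely eventually contain the events `‖U m‖ ≤ C`, where `U` is bounded in
probability, have probabilities that tend to one. -/
theorem tendsto_measure_of_ae_eventually {E S : Type*} [NormedAddCommGroup E] [MeasurableSpace E]
    [BorelSpace E] [MeasurableSpace S] {P : Measure S} [IsProbabilityMeasure P] {U : ℕ → S → E}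
    (hU : ∀ m, Measurable (U m))
    (htight : ∀ η : ℝ≥0∞, 0 < η → ∃ C : ℝ, 0 < C ∧ ∀ᶠ m in atTop, P {s | C ≤ ‖U m s‖} ≤ η)
    {A : ℕ → Set S}
    (hA : ∀ C : ℝ, 0 < C → ∀ᵐ s ∂P, ∀ᶠ m in atTop, ‖U m s‖ ≤ C → s ∈ A m) :
    Tendsto (fun m => P (A m)) atTop (𝓝 1) := by
  refine tendsto_order.2 ⟨fun b hb => ?_, fun b hb =>
    Eventually.of_forall fun m => prob_le_one.trans_lt hb⟩
  obtain ⟨c, hbc, hc⟩ := exists_between hb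
  have hη : 0 < c - b := tsub_pos_of_lt hbc
  obtain ⟨C, hC, hCm⟩ := htight _ hη
  -- The sets `F k` increase to a set of full measure, so eventually P(F m) > c. As `F m` lies in
  -- the union of `A m` and the tail event, whose probability is at most c - b, P(A m) exceeds b.
  set F : ℕ → Set S := fun k => {s | ∀ m ≥ k, ‖U m s‖ ≤ C → s ∈ A m} with hF
  have hmono : Monotone F := fun i j hij s hs m hm => hs m (hij.trans hm)
  have hfull : P (⋃ k, F k) = 1 := by
    have hae : ∀ᵐ s ∂P, s ∈ ⋃ k, F k := by
      filter_upwards [hA C hC] with s hs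
      obtain ⟨k, hk⟩ := eventually_atTop.1 hs
      exact Set.mem_iUnion.2 ⟨k, hk⟩
    rw [measure_eq_measure_of_null_sdiff (Set.subset_univ _)
      (by rwa [← Set.compl_eq_univ_sdiff]), measure_univ]
  have hlim := tendsto_measure_iUnion_atTop (μ := P) hmono
  rw [hfull] at hlim
  filter_upwards [hlim.eventually_const_lt hc, hCm] with m h1 h2
  have hms : MeasurableSet {s | C ≤ ‖U m s‖} := measurableSet_le measurable_const (hU m).norm
  have h3 : F m ⊆ A m ∪ {s | C ≤ ‖U m s‖} := by
    intro s hs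
    by_cases h : C ≤ ‖U m s‖
    · exact Or.inr h
    · exact Or.inl (hs m le_rfl (not_le.1 h).le)
  have h4 : P (F m) ≤ P (A m) + (c - b) :=
    (measure_mono h3).trans ((measure_union_le _ _).trans (by gcongr))
  by_contra hcon
  rw [not_lt] at hcon
  have h5 : P (F m) ≤ b + (c - b) := h4.trans (by gcongr)
  rw [add_tsub_cancel_of_le hbc.le] at h5
  exact absurd h1 (not_lt.2 h5)

end WeakConvergence

/-! ### Positive definite quadratic forms. -/

section QuadraticForm

variable {n : ℕ} {g : Matrix (Fin n) (Fin n) ℂ}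

theorem continuous_re_star_dotProduct_mulVec :
    Continuous fun v : Fin n → ℂ => (star v ⬝ᵥ (g *ᵥ v)).re :=
  Complex.continuous_re.comp (continuous_star.dotProduct
    (Continuous.matrix_mulVec continuous_const continuous_id))

theorem re_star_dotProduct_mulVec_smul (c : ℝ) (v : Fin n → ℂ) :
    (star (c • v) ⬝ᵥ (g *ᵥ (c • v))).re = c ^ 2 * (star v ⬝ᵥ (g *ᵥ v)).re := by
  rw [star_smul, Matrix.mulVec_smul, smul_dotProduct, dotProduct_smul]
  simp only [star_trivial, Complex.real_smul, Complex.re_ofReal_mul]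
  ring

open scoped ComplexOrder in
-- Compactness of the unit sphere and homogeneity; the sphere is empty when n = 0.
theorem Matrix.PosDef.exists_pos_mul_norm_sq_le (hg : g.PosDef) :
    ∃ lam : ℝ, 0 < lam ∧ ∀ v : Fin n → ℂ, lam * ‖v‖ ^ 2 ≤ (star v ⬝ᵥ (g *ᵥ v)).re := by
  have hpos : ∀ v : Fin n → ℂ, v ≠ 0 → 0 < (star v ⬝ᵥ (g *ᵥ v)).re := fun v hv =>
    (Complex.pos_iff.1 (hg.dotProduct_mulVec_pos hv)).1
  have key : ∃ lam : ℝ, 0 < lam ∧ ∀ v ∈ Metric.sphere (0 : Fin n → ℂ) 1,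
      lam ≤ (star v ⬝ᵥ (g *ᵥ v)).re := by
    rcases (Metric.sphere (0 : Fin n → ℂ) 1).eq_empty_or_nonempty with h | h
    · exact ⟨1, one_pos, by simp [h]⟩
    · obtain ⟨v₀, hv₀, hmin⟩ := (isCompact_sphere (0 : Fin n → ℂ) 1).exists_isMinOn h
        continuous_re_star_dotProduct_mulVec.continuousOn
      refine ⟨_, hpos v₀ ?_, fun v hv => hmin hv⟩
      rintro rfl
      simp at hv₀
  obtain ⟨lam, hlam, h⟩ := key
  refine ⟨lam, hlam, fun v => ?_⟩
  rcases eq_or_ne v 0 with rfl | hv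
  · simp
  · have hn : 0 < ‖v‖ := norm_pos_iff.2 hv
    have h1 := h (‖v‖⁻¹ • v) (by
      rw [mem_sphere_zero_iff_norm, norm_smul, norm_inv, norm_norm, inv_mul_cancel₀ hn.ne'])
    rw [re_star_dotProduct_mulVec_smul, inv_pow, ← div_eq_inv_mul, le_div_iff₀ (by positivity)] at h1
    exact h1

/-- Completing the square. -/
theorem re_star_dotProduct_mulVec_sub (hg : g.IsHermitian) (u x : Fin n → ℂ) :
    (star u ⬝ᵥ (g *ᵥ u)).re - 2 * (star (g *ᵥ x) ⬝ᵥ u).re =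
      (star (u - x) ⬝ᵥ (g *ᵥ (u - x))).re - (star x ⬝ᵥ (g *ᵥ x)).re := by
  have h1 : star (g *ᵥ x) ⬝ᵥ u = star x ⬝ᵥ (g *ᵥ u) := by
    rw [Matrix.star_mulVec, hg.eq, Matrix.dotProduct_mulVec]
  have h2 : (star u ⬝ᵥ (g *ᵥ x)).re = (star x ⬝ᵥ (g *ᵥ u)).re := by
    have : star u ⬝ᵥ (g *ᵥ x) = star (star (g *ᵥ x) ⬝ᵥ u) := by
      rw [Matrix.star_dotProduct]
    rw [this, h1, RCLike.star_def, Complex.conj_re]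
  rw [h1, star_sub, Matrix.mulVec_sub, sub_dotProduct, dotProduct_sub, dotProduct_sub]
  simp only [Complex.sub_re, h2]
  ring

end QuadraticForm

theorem EReal.coe_sum {ι : Type*} (t : Finset ι) (f : ι → ℝ) :
    ((∑ i ∈ t, f i : ℝ) : EReal) = ∑ i ∈ t, (f i : EReal) := by
  classical
  induction t using Finset.induction_on with
  | empty => simp
  | insert i t hi ih => rw [Finset.sum_insert hi, Finset.sum_insert hi, EReal.coe_add, ih]

/-! ### Quadratic approximation of the total loss and measurable minimizers. -/

namespace HolomorphicLossModel

variable {X : Type*} [MeasurableSpace X] {ν : Measure X} {n : ℕ} {g : Matrix (Fin n) (Fin n) ℂ}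
  {D : (Fin n → ℂ) → X → EReal} (M : HolomorphicLossModel ν g D)
  {S : Type*} [MeasurableSpace S] {P : Measure S} {Z : ℕ → S → X}

/-- The total loss up to a term that does not depend on the parameter. -/
noncomputable def totalLoss (Z : ℕ → S → X) (m : ℕ) (v : Fin n → ℂ) (s : S) : ℝ :=
  m * M.b v - 2 * ∑ i ∈ Finset.range m, Real.log ‖1 + M.a v (Z i s)‖

theorem sum_loss_eq {m : ℕ} {v : Fin n → ℂ} {s : S} (hv : v ∈ Metric.ball 0 M.radius)
    (hgood : ∀ i < m, Z i s ∈ M.good) (hne : ∀ i < m, 1 + M.a v (Z i s) ≠ 0) :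
    ∑ i ∈ Finset.range m, D v (Z i s) =
      ((M.totalLoss Z m v s + ∑ i ∈ Finset.range m, M.κ (Z i s) : ℝ) : EReal) := by
  have h : ∀ i ∈ Finset.range m, D v (Z i s) =
      ((M.b v - 2 * Real.log ‖1 + M.a v (Z i s)‖ + M.κ (Z i s) : ℝ) : EReal) := fun i hi =>
    M.loss_eq _ (hgood i (Finset.mem_range.1 hi)) v hv (hne i (Finset.mem_range.1 hi))
  rw [Finset.sum_congr rfl h, ← EReal.coe_sum, Finset.sum_add_distrib, Finset.sum_sub_distrib,
    Finset.sum_const, Finset.card_range, nsmul_eq_mul, ← Finset.mul_sum, totalLoss]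

/-- The total loss is asymptotically quadratic at scale `1 / √m`, uniformly on bounded sets. -/
theorem eventually_abs_totalLoss_sub_le {s : S}
    (h : ∀ C > 0, ∀ ε > 0, ∀ᶠ m : ℕ in atTop, ∀ u : Fin n → ℂ, ‖u‖ ≤ C →
        (∀ i < m, ‖M.a (((√(m : ℝ))⁻¹ : ℝ) • u) (Z i s)‖ ≤ 1 / 2) ∧
        ‖∑ i ∈ Finset.range m, Complex.log (1 + M.a (((√(m : ℝ))⁻¹ : ℝ) • u) (Z i s)) -
          ∑ i ∈ Finset.range m, M.score (Z i s) ⬝ᵥ (((√(m : ℝ))⁻¹ : ℝ) • u)‖ ≤ ε)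
    {C ε : ℝ} (hC : 0 < C) (hε : 0 < ε) :
    ∀ᶠ m : ℕ in atTop, ∀ u : Fin n → ℂ, ‖u‖ ≤ C →
      |M.totalLoss Z m (((√(m : ℝ))⁻¹ : ℝ) • u) s - ((star u ⬝ᵥ (g *ᵥ u)).re -
        2 * (∑ i ∈ Finset.range m, M.score (Z i s) ⬝ᵥ (((√(m : ℝ))⁻¹ : ℝ) • u)).re)| ≤ ε := by
  -- As m ‖v‖² ≤ C², the deterministic part contributes ε/2; the logarithms contribute 2 · ε/4.
  have hb := M.b_expansion.def (c := ε / 2 / C ^ 2) (by positivity)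
  obtain ⟨r, hr, hrb⟩ := Metric.eventually_nhds_iff_ball.1 hb
  filter_upwards [h C hC (ε / 4) (by positivity), eventually_div_sqrt_lt C hr,
    eventually_gt_atTop 0] with m hm1 hm2 hm3 u hu
  have hmp : (0 : ℝ) < m := by exact_mod_cast hm3
  have hss : √(m : ℝ) ^ 2 = m := Real.sq_sqrt hmp.le
  have hvn := norm_inv_sqrt_smul_le (m := m) hu
  set v : Fin n → ℂ := ((√(m : ℝ))⁻¹ : ℝ) • u with hv
  have h1 := hrb v (mem_ball_zero_iff.2 (hvn.trans_lt hm2))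
  have hv2 : ‖v‖ ^ 2 ≤ C ^ 2 / m := by
    calc ‖v‖ ^ 2 ≤ (C / √m) ^ 2 := by gcongr
      _ = C ^ 2 / m := by rw [div_pow, hss]
  have h2 : |m * M.b v - (star u ⬝ᵥ (g *ᵥ u)).re| ≤ ε / 2 := by
    have h3 : (star u ⬝ᵥ (g *ᵥ u)).re = m * (star v ⬝ᵥ (g *ᵥ v)).re := by
      rw [hv, re_star_dotProduct_mulVec_smul, inv_pow, hss, mul_inv_cancel_left₀ hmp.ne']
    rw [h3, ← mul_sub, abs_mul, abs_of_pos hmp]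
    rw [Real.norm_eq_abs, Real.norm_of_nonneg (by positivity)] at h1
    calc (m : ℝ) * |M.b v - (star v ⬝ᵥ (g *ᵥ v)).re| ≤ m * (ε / 2 / C ^ 2 * ‖v‖ ^ 2) := by gcongr
      _ ≤ m * (ε / 2 / C ^ 2 * (C ^ 2 / m)) := by gcongr
      _ = ε / 2 := by field_simp
  have h4 := (Complex.abs_re_le_norm _).trans (hm1 u hu).2
  rw [Complex.sub_re, Complex.re_sum] at h4
  simp only [Complex.log_re] at h4
  rw [totalLoss]
  rw [abs_le] at h2 h4 ⊢
  constructor <;> linarith [h2.1, h2.2, h4.1, h4.2]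

/-- The event on which the total loss is finite near the linearized estimator. -/
def regularEvent (Z : ℕ → S → X) (m : ℕ) : Set S :=
  {s | (‖M.linearEstimator Z m s‖ + 1) / √(m : ℝ) < M.radius ∧ ∀ i < m, Z i s ∈ M.good ∧
    2 * M.T (Z i s) / M.radius * ((‖M.linearEstimator Z m s‖ + 1) / √(m : ℝ)) ≤ 1 / 2}

theorem measurableSet_regularEvent (hZ : ∀ i, Measurable (Z i)) (m : ℕ) :
    MeasurableSet (M.regularEvent Z m) := by
  have hU : Measurable fun s => (‖M.linearEstimator Z m s‖ + 1) / √(m : ℝ) :=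
    ((M.measurable_linearEstimator hZ m).norm.add_const 1).div_const _
  have e : M.regularEvent Z m = {s | (‖M.linearEstimator Z m s‖ + 1) / √(m : ℝ) < M.radius} ∩
      ⋂ i, ⋂ (_ : i < m), (Z i ⁻¹' M.good ∩ {s | 2 * M.T (Z i s) / M.radius *
        ((‖M.linearEstimator Z m s‖ + 1) / √(m : ℝ)) ≤ 1 / 2}) := by
    ext s
    simp [regularEvent]
  rw [e]
  refine (measurableSet_lt hU measurable_const).inter (MeasurableSet.iInter fun i =>
    MeasurableSet.iInter fun _ => (hZ i M.measurableSet_good).inter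
      (measurableSet_le ?_ measurable_const))
  exact (((M.measurable_T.comp (hZ i)).const_mul 2).div_const _).mul hU

theorem norm_smul_linearEstimator_add_le (m : ℕ) (s : S) {w : Fin n → ℂ} (hw : ‖w‖ ≤ 1) :
    ‖((√(m : ℝ))⁻¹ : ℝ) • (M.linearEstimator Z m s + w)‖ ≤
      (‖M.linearEstimator Z m s‖ + 1) / √(m : ℝ) :=
  norm_inv_sqrt_smul_le ((norm_add_le _ _).trans (by gcongr))

/-- The product bounded by 1/2 in `regularEvent` is the Schwarz bound for |a|, so a = -1 is excluded
and the loss is finite. -/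
theorem one_add_a_ne_zero {m : ℕ} {s : S} (hs : s ∈ M.regularEvent Z m) {v : Fin n → ℂ}
    (hv : ‖v‖ ≤ (‖M.linearEstimator Z m s‖ + 1) / √(m : ℝ)) {i : ℕ} (hi : i < m) :
    1 + M.a v (Z i s) ≠ 0 := by
  obtain ⟨h1, h2⟩ := hs
  have hvb : v ∈ Metric.ball 0 M.radius := mem_ball_zero_iff.2 (hv.trans_lt h1)
  have h3 := norm_sub_le_of_norm_le (M.differentiableOn _ (h2 i hi).1) (M.norm_le _ (h2 i hi).1) hvb
  rw [M.a_zero _ (h2 i hi).1, sub_zero, sub_zero] at h3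
  have hr := M.radius_pos
  have hT := M.T_nonneg (Z i s)
  have h4 : ‖M.a v (Z i s)‖ ≤ 1 / 2 := h3.trans (le_trans (by gcongr) (h2 i hi).2)
  intro h0
  have h5 : M.a v (Z i s) = -1 := by linear_combination h0
  rw [h5, norm_neg, norm_one] at h4
  norm_num at h4

theorem continuousOn_totalLoss {m : ℕ} {s : S} (hs : s ∈ M.regularEvent Z m) :
    ContinuousOn (fun v => M.totalLoss Z m v s)
      (Metric.closedBall 0 ((‖M.linearEstimator Z m s‖ + 1) / √(m : ℝ))) := by
  have hsub : Metric.closedBall (0 : Fin n → ℂ) ((‖M.linearEstimator Z m s‖ + 1) / √(m : ℝ)) ⊆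
      Metric.ball 0 M.radius := Metric.closedBall_subset_ball hs.1
  unfold totalLoss
  refine ((M.continuousOn_b.mono hsub).const_mul _).sub ((continuousOn_finsetSum _ fun i hi =>
    ?_).const_mul 2)
  have hi' := Finset.mem_range.1 hi
  refine ((continuousOn_const.add ((M.differentiableOn _ (hs.2 i hi').1).continuousOn.mono
    hsub)).norm).log fun v hv => ?_
  exact norm_ne_zero_iff.2 (M.one_add_a_ne_zero hs (mem_closedBall_zero_iff.1 hv) hi')

theorem measurable_totalLoss {v : S → Fin n → ℂ} (hZ : ∀ i, Measurable (Z i)) (hv : Measurable v)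
    (m : ℕ) : Measurable fun s => M.totalLoss Z m (v s) s := by
  unfold totalLoss
  refine ((M.measurable_b.comp hv).const_mul _).sub ((Finset.measurable_fun_sum _ fun i _ =>
    ?_).const_mul 2)
  exact Real.measurable_log.comp ((M.measurable_a.comp (hv.prodMk (hZ i))).const_add 1).norm

open Classical in
/-- The total loss has a measurable minimizer in the ball of radius `1 / √m` around the linearized
estimator. -/
theorem exists_measurable_minimizer (hZ : ∀ i, Measurable (Z i)) (m : ℕ) :
    ∃ w : S → Fin n → ℂ, Measurable w ∧ (∀ s, ‖w s‖ ≤ 1) ∧ ∀ s ∈ M.regularEvent Z m,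
      ∀ x : Fin n → ℂ, ‖x‖ ≤ 1 →
        M.totalLoss Z m (((√(m : ℝ))⁻¹ : ℝ) • (M.linearEstimator Z m s + w s)) s ≤
          M.totalLoss Z m (((√(m : ℝ))⁻¹ : ℝ) • (M.linearEstimator Z m s + x)) s := by
  have hK : CompactSpace (Metric.closedBall (0 : Fin n → ℂ) 1) :=
    isCompact_iff_compactSpace.1 (isCompact_closedBall _ _)
  have hne : Nonempty (Metric.closedBall (0 : Fin n → ℂ) 1) :=
    ⟨⟨0, Metric.mem_closedBall_self zero_le_one⟩⟩
  have hnorm : ∀ x : Metric.closedBall (0 : Fin n → ℂ) 1, ‖(x : Fin n → ℂ)‖ ≤ 1 := fun x =>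
    mem_closedBall_zero_iff.1 x.2
  -- Off the regular event the loss may be singular; replacing it by 0 there makes it continuous for
  -- every `s` and keeps it measurable.
  obtain ⟨w, hw, hmin⟩ := exists_measurable_argmin (S := S)
    (K := Metric.closedBall (0 : Fin n → ℂ) 1)
    (f := fun s x => if s ∈ M.regularEvent Z m then
      M.totalLoss Z m (((√(m : ℝ))⁻¹ : ℝ) • (M.linearEstimator Z m s + (x : Fin n → ℂ))) s else 0)
    (fun x => by
      refine Measurable.ite (M.measurableSet_regularEvent hZ m) ?_ measurable_const
      refine M.measurable_totalLoss hZ ?_ m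
      exact ((M.measurable_linearEstimator hZ m).add_const (x : Fin n → ℂ)).const_smul
        ((√(m : ℝ))⁻¹ : ℝ))
    (fun s => by
      by_cases hs : s ∈ M.regularEvent Z m
      · simp only [if_pos hs]
        refine (M.continuousOn_totalLoss hs).comp_continuous (by fun_prop) fun x => ?_
        exact mem_closedBall_zero_iff.2 (M.norm_smul_linearEstimator_add_le m s (hnorm x))
      · simp only [if_neg hs]
        exact continuous_const)
  refine ⟨fun s => w s, measurable_subtype_coe.comp hw, fun s => hnorm _, fun s hs x hx => ?_⟩
  have := hmin s ⟨x, mem_closedBall_zero_iff.2 hx⟩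
  simpa only [if_pos hs] using this

end HolomorphicLossModel

/-! ### Local minimality and asymptotic normality of the minimizers. -/

namespace HolomorphicLossModel

variable {X : Type*} [MeasurableSpace X] {ν : Measure X} {n : ℕ} {g : Matrix (Fin n) (Fin n) ℂ}
  {D : (Fin n → ℂ) → X → EReal} (M : HolomorphicLossModel ν g D)
  {S : Type*} [MeasurableSpace S] {P : Measure S} {Z : ℕ → S → X}

/-- Strictness in ‖w‖ < 1 makes the minimizer interior: nearby parameters are again of the form (U +
x)/√m with ‖x‖ < 1, where the loss is finite and differs from `totalLoss` by a constant. -/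
theorem isLocalMin_sum_loss {m : ℕ} (hm : 0 < m) {s : S} (hs : s ∈ M.regularEvent Z m)
    {w : Fin n → ℂ} (hw : ‖w‖ < 1)
    (hmin : ∀ x : Fin n → ℂ, ‖x‖ ≤ 1 →
      M.totalLoss Z m (((√(m : ℝ))⁻¹ : ℝ) • (M.linearEstimator Z m s + w)) s ≤
        M.totalLoss Z m (((√(m : ℝ))⁻¹ : ℝ) • (M.linearEstimator Z m s + x)) s) :
    IsLocalMin (fun v => ∑ i ∈ Finset.range m, D v (Z i s))
      (((√(m : ℝ))⁻¹ : ℝ) • (M.linearEstimator Z m s + w)) := by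
  have hsp : √(m : ℝ) ≠ 0 := (Real.sqrt_pos.2 (by exact_mod_cast hm)).ne'
  set U := M.linearEstimator Z m s with hU
  have hsum : ∀ x : Fin n → ℂ, ‖x‖ ≤ 1 →
      ∑ i ∈ Finset.range m, D (((√(m : ℝ))⁻¹ : ℝ) • (U + x)) (Z i s) =
        ((M.totalLoss Z m (((√(m : ℝ))⁻¹ : ℝ) • (U + x)) s +
          ∑ i ∈ Finset.range m, M.κ (Z i s) : ℝ) : EReal) := by
    intro x hx
    have hle := M.norm_smul_linearEstimator_add_le (Z := Z) m s hx
    exact M.sum_loss_eq (mem_ball_zero_iff.2 (hle.trans_lt hs.1)) (fun i hi => (hs.2 i hi).1)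
      fun i hi => M.one_add_a_ne_zero hs hle hi
  have hcont : ContinuousAt (fun v : Fin n → ℂ => ‖(√(m : ℝ)) • v - U‖)
      (((√(m : ℝ))⁻¹ : ℝ) • (U + w)) := by fun_prop
  have hval : ‖(√(m : ℝ)) • (((√(m : ℝ))⁻¹ : ℝ) • (U + w)) - U‖ < 1 := by
    rw [smul_inv_smul₀ hsp, add_sub_cancel_left]; exact hw
  have hev : ∀ᶠ v : Fin n → ℂ in 𝓝 (((√(m : ℝ))⁻¹ : ℝ) • (U + w)), ‖(√(m : ℝ)) • v - U‖ < 1 :=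
    hcont.eventually_lt_const hval
  filter_upwards [hev] with v hv
  have hv' : v = ((√(m : ℝ))⁻¹ : ℝ) • (U + ((√(m : ℝ)) • v - U)) := by
    rw [add_sub_cancel, inv_smul_smul₀ hsp]
  rw [hv', hsum _ hw.le, hsum _ hv.le]
  exact EReal.coe_le_coe_iff.2 (by gcongr; exact hmin _ hv.le)

/-- Convergence of the means of T² makes max T(Z_i) over i < m at most any prescribed multiple of √m
eventually; the multiple radius/(4(C + 1)) produces exactly the bound 1/2. -/
theorem ae_eventually_mem_regularEvent [IsProbabilityMeasure P] (hZ : ∀ i, Measurable (Z i))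
    (hind : iIndepFun Z P) (hlaw : ∀ i, HasLaw (Z i) ν P) {C : ℝ} (hC : 0 < C) :
    ∀ᵐ s ∂P, ∀ᶠ m in atTop, ‖M.linearEstimator Z m s‖ ≤ C → s ∈ M.regularEvent Z m := by
  have hr := M.radius_pos
  filter_upwards [ae_tendsto_mean_of_hasLaw hZ hind hlaw (M.measurable_T.pow_const 2)
    M.integrable_T_sq, M.ae_eventually_norm_sum_log_sub_le hZ hind hlaw] with s h1 h2
  have h3 := eventually_forall_le_mul_of_tendsto_mean h1
    (ε := (M.radius / (4 * (C + 1))) ^ 2) (by positivity)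
  filter_upwards [h3, eventually_div_sqrt_lt (C + 1) hr, eventually_gt_atTop 0] with m h4 h5 h6 hU
  have hmp : (0 : ℝ) < m := by exact_mod_cast h6
  have hsp : 0 < √(m : ℝ) := Real.sqrt_pos.2 hmp
  refine ⟨lt_of_le_of_lt (by gcongr) h5, fun i hi => ⟨h2.1 i, ?_⟩⟩
  have h7 : M.T (Z i s) ≤ M.radius / (4 * (C + 1)) * √(m : ℝ) := by
    refine abs_le_of_sq_le_sq' ?_ (by positivity) |>.2
    rw [mul_pow, Real.sq_sqrt hmp.le]
    exact h4 i hi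
  have hT := M.T_nonneg (Z i s)
  calc 2 * M.T (Z i s) / M.radius * ((‖M.linearEstimator Z m s‖ + 1) / √(m : ℝ))
      ≤ 2 * (M.radius / (4 * (C + 1)) * √(m : ℝ)) / M.radius * ((C + 1) / √(m : ℝ)) := by gcongr
    _ = 1 / 2 := by field_simp; norm_num

open scoped ComplexOrder in
-- The random linear term of the loss is the pairing with g U, so completing the square centres the
-- quadratic form at U.
theorem mulVec_linearEstimator (hg : g.PosDef) (m : ℕ) (s : S) (u : Fin n → ℂ) :
    star (g *ᵥ M.linearEstimator Z m s) ⬝ᵥ u =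
      ∑ i ∈ Finset.range m, M.score (Z i s) ⬝ᵥ (((√(m : ℝ))⁻¹ : ℝ) • u) := by
  have hu : IsUnit g.det := isUnit_iff_ne_zero.2 hg.det_pos.ne'
  rw [linearEstimator, Matrix.mulVec_smul, Matrix.mulVec_mulVec, Matrix.mul_nonsing_inv _ hu,
    Matrix.one_mulVec, star_smul, star_sum, smul_dotProduct, sum_dotProduct, Finset.smul_sum]
  simp only [star_star, star_trivial, dotProduct_smul]

open scoped ComplexOrder in
/-- Minimizers of the total loss near the linearized estimator are close to it. -/
theorem ae_eventually_norm_minimizer_lt [IsProbabilityMeasure P] (hg : g.PosDef)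
    (hZ : ∀ i, Measurable (Z i)) (hind : iIndepFun Z P) (hlaw : ∀ i, HasLaw (Z i) ν P)
    {w : ℕ → S → Fin n → ℂ} (hw : ∀ m s, ‖w m s‖ ≤ 1)
    (hmin : ∀ m, ∀ s ∈ M.regularEvent Z m, ∀ x : Fin n → ℂ, ‖x‖ ≤ 1 →
      M.totalLoss Z m (((√(m : ℝ))⁻¹ : ℝ) • (M.linearEstimator Z m s + w m s)) s ≤
        M.totalLoss Z m (((√(m : ℝ))⁻¹ : ℝ) • (M.linearEstimator Z m s + x)) s)
    {C δ : ℝ} (hC : 0 < C) (hδ : 0 < δ) :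
    ∀ᵐ s ∂P, ∀ᶠ m in atTop, ‖M.linearEstimator Z m s‖ ≤ C →
      0 < m ∧ s ∈ M.regularEvent Z m ∧ ‖w m s‖ < δ := by
  obtain ⟨lam, hlam, hq⟩ := hg.exists_pos_mul_norm_sq_le
  filter_upwards [M.ae_eventually_mem_regularEvent hZ hind hlaw hC,
    M.ae_eventually_norm_sum_log_sub_le hZ hind hlaw] with s h1 h2
  have h3 := M.eventually_abs_totalLoss_sub_le h2.2 (C := C + 1) (ε := lam * δ ^ 2 / 4)
    (by positivity) (by positivity)
  filter_upwards [h1, h3, eventually_gt_atTop 0] with m h4 h5 h6 hU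
  refine ⟨h6, h4 hU, ?_⟩
  -- Comparison with x = 0: both quadratic approximations are accurate to lam δ²/4, so lam ‖w‖² ≤
  -- lam δ²/2 < lam δ².
  have h7 := hmin m s (h4 hU) 0 (by simp)
  have hexp : ∀ x : Fin n → ℂ, ‖x‖ ≤ 1 →
      |M.totalLoss Z m (((√(m : ℝ))⁻¹ : ℝ) • (M.linearEstimator Z m s + x)) s -
        ((star x ⬝ᵥ (g *ᵥ x)).re - (star (M.linearEstimator Z m s) ⬝ᵥ
          (g *ᵥ M.linearEstimator Z m s)).re)| ≤ lam * δ ^ 2 / 4 := by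
    intro x hx
    have h8 := h5 (M.linearEstimator Z m s + x) ((norm_add_le _ _).trans (add_le_add hU hx))
    rw [← M.mulVec_linearEstimator hg, re_star_dotProduct_mulVec_sub hg.isHermitian,
      add_sub_cancel_left] at h8
    exact h8
  have h8 := abs_le.1 (hexp (w m s) (hw m s))
  have h9 := abs_le.1 (hexp 0 (by simp))
  simp only [star_zero, zero_dotProduct, Complex.zero_re] at h9
  have h10 := hq (w m s)
  have h11 : ‖w m s‖ ^ 2 < δ ^ 2 := by
    have h12 : lam * ‖w m s‖ ^ 2 ≤ lam * (δ ^ 2 / 2) := by linarith [h8.1, h9.2]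
    have h13 := le_of_mul_le_mul_left h12 hlam
    have : 0 < δ ^ 2 := by positivity
    linarith
  exact lt_of_pow_lt_pow_left₀ 2 hδ.le h11

open Classical in
open scoped ComplexOrder in
/-- Local minimizers of the total loss are asymptotically normal. -/
theorem exists_isLocalMin_tendstoInDistribution [IsProbabilityMeasure P] (hg : g.PosDef)
    (hZ : ∀ i, Measurable (Z i)) (hind : iIndepFun Z P) (hlaw : ∀ i, HasLaw (Z i) ν P)
    [IsProbabilityMeasure (complexNormal 0 g⁻¹)] :
    ∃ v : ℕ → S → Fin n → ℂ, (∀ m, Measurable (v m)) ∧ (∀ m s, v m s ∈ Metric.ball 0 M.radius) ∧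
      Tendsto (fun m => P {s | IsLocalMin (fun z => ∑ i ∈ Finset.range m, D z (Z i s)) (v m s)})
        atTop (𝓝 1) ∧
      TendstoInDistribution (fun (m : ℕ) (s : S) => √(m : ℝ) • v m s) atTop id (fun _ => P)
        (complexNormal 0 g⁻¹) := by
  choose w hwm hw1 hmin using fun m => M.exists_measurable_minimizer (Z := Z) hZ m
  have hU := M.measurable_linearEstimator hZ
  have hclt := M.tendstoInDistribution_linearEstimator hg hZ hind hlaw
  have htight : ∀ η : ℝ≥0∞, 0 < η → ∃ C : ℝ, 0 < C ∧
      ∀ᶠ m in atTop, P {s | C ≤ ‖M.linearEstimator Z m s‖} ≤ η := fun η hη =>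
    eventually_measure_norm_ge_le hclt hη
  -- The default 0 keeps the estimator in the ball for every outcome; the exceptional event has
  -- probability tending to zero.
  set v : ℕ → S → Fin n → ℂ := fun m s => if s ∈ M.regularEvent Z m then
    ((√(m : ℝ))⁻¹ : ℝ) • (M.linearEstimator Z m s + w m s) else 0 with hv
  have hvm : ∀ m, Measurable (v m) := fun m =>
    Measurable.ite (M.measurableSet_regularEvent hZ m)
      (((hU m).add (hwm m)).const_smul ((√(m : ℝ))⁻¹ : ℝ)) measurable_const
  have hclose : ∀ δ : ℝ, 0 < δ → Tendsto (fun m => P {s | 0 < m ∧ s ∈ M.regularEvent Z m ∧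
      ‖w m s‖ < δ}) atTop (𝓝 1) := fun δ hδ =>
    tendsto_measure_of_ae_eventually hU htight fun C hC =>
      M.ae_eventually_norm_minimizer_lt hg hZ hind hlaw hw1 hmin hC hδ
  refine ⟨v, hvm, fun m s => ?_, ?_, ?_⟩
  · by_cases hs : s ∈ M.regularEvent Z m
    · simp only [hv, if_pos hs]
      exact mem_ball_zero_iff.2
        ((M.norm_smul_linearEstimator_add_le m s (hw1 m s)).trans_lt hs.1)
    · simp only [hv, if_neg hs]
      exact Metric.mem_ball_self M.radius_pos
  · refine tendsto_of_tendsto_of_tendsto_of_le_of_le (hclose 1 one_pos) tendsto_const_nhds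
      (fun m => measure_mono ?_) fun m => prob_le_one
    rintro s ⟨hm, hs, hlt⟩
    simp only [Set.mem_ofPred_eq, hv, if_pos hs]
    exact M.isLocalMin_sum_loss hm hs hlt (hmin m s hs)
  -- Slutsky's argument: on the regular event √m v - U is `w`, which tends to zero in probability.
  · refine tendstoInDistribution_of_tendstoInMeasure_sub _ _ hclt ?_
      fun m => ((hvm m).const_smul (√(m : ℝ))).aemeasurable
    refine tendstoInMeasure_iff_norm.2 fun δ hδ => ?_
    have hlim : Tendsto (fun m => 1 - P {s | 0 < m ∧ s ∈ M.regularEvent Z m ∧ ‖w m s‖ < δ}) atTop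
        (𝓝 (1 - 1)) := ENNReal.Tendsto.sub tendsto_const_nhds (hclose δ hδ)
          (Or.inl ENNReal.one_ne_top)
    rw [tsub_self] at hlim
    refine tendsto_of_tendsto_of_tendsto_of_le_of_le tendsto_const_nhds hlim
      (fun m => zero_le) fun m => ?_
    have hms : MeasurableSet {s | 0 < m ∧ s ∈ M.regularEvent Z m ∧ ‖w m s‖ < δ} :=
      (MeasurableSet.const _).inter ((M.measurableSet_regularEvent hZ m).inter
        (measurableSet_lt (hwm m).norm measurable_const))
    change P _ ≤ 1 - P _
    rw [← prob_compl_eq_one_sub hms]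
    refine measure_mono fun s hs => ?_
    rintro ⟨hm, hreg, hlt⟩
    have hsp : √(m : ℝ) ≠ 0 := (Real.sqrt_pos.2 (by exact_mod_cast hm)).ne'
    have : δ ≤ ‖√(m : ℝ) • v m s - M.linearEstimator Z m s‖ := by simpa using hs
    simp only [hv, if_pos hreg] at this
    rw [smul_inv_smul₀ hsp, add_sub_cancel_left] at this
    exact absurd hlt (not_lt.2 this)

end HolomorphicLossModel

/-! ### The theorem for bounded domains. -/

open scoped ComplexOrder in
theorem isProbabilityMeasure_complexNormal_inv {n : ℕ} {g : Matrix (Fin n) (Fin n) ℂ}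
    (hg : g.PosDef) : IsProbabilityMeasure (complexNormal 0 g⁻¹) :=
  isProbabilityMeasure_complexNormal hg.inv

theorem theoremC {n : ℕ} (Ω : Set (Fin n → ℂ))
    (hΩ_open : IsOpen Ω) (hΩ_conn : IsConnected Ω) (hΩ_bdd : Bornology.IsBounded Ω)
    (hL2 : ∀ z ∈ Ω, ∀ α β γ : Fin n,
      MemLp (fun ξ => score Ω α z ξ * score Ω β z ξ * score Ω γ z ξ * bergmanKernel Ω ξ z) 2
        (volume.restrict Ω))
    (z₀ : Fin n → ℂ) (hz₀ : z₀ ∈ Ω)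
    {S : Type*} [MeasurableSpace S] (P : Measure S) [IsProbabilityMeasure P]
    (Z : ℕ → S → Fin n → ℂ) (hZ_meas : ∀ i, Measurable (Z i)) (hZ_indep : iIndepFun Z P)
    (hZ_law : ∀ i, HasLaw (Z i) (poissonBergmanMeasure Ω z₀) P) :
    ∃ zhat : ℕ → S → Fin n → ℂ,
      (∀ m, Measurable (zhat m)) ∧
      (∀ m s, zhat m s ∈ Ω) ∧
      Tendsto
        (fun m => P {s | IsLocalMinOn
          (fun z => ∑ i ∈ Finset.range m, diastasis Ω z (Z i s)) Ω (zhat m s)})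
        atTop (𝓝 1) ∧
      ∃ _ : IsProbabilityMeasure (complexNormal 0 (bergmanMetric Ω z₀)⁻¹),
        TendstoInDistribution (fun (m : ℕ) (s : S) => Real.sqrt m • (zhat m s - z₀)) atTop id
          (fun _ => P) (complexNormal 0 (bergmanMetric Ω z₀)⁻¹) := by
  obtain ⟨k⟩ := nonempty_kernelModel hΩ_open hΩ_bdd hz₀
  obtain ⟨M, hM⟩ := k.nonempty_holomorphicLossModel hΩ_conn fun α => hL2 z₀ hz₀ α α α
  have hg := k.bergmanMetric_posDef
  have hN : IsProbabilityMeasure (complexNormal 0 (bergmanMetric Ω z₀)⁻¹) :=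
    isProbabilityMeasure_complexNormal_inv hg
  obtain ⟨v, hvm, hvb, hmin, hdist⟩ :=
    M.exists_isLocalMin_tendstoInDistribution hg hZ_meas hZ_indep hZ_law
  refine ⟨fun m s => z₀ + v m s, fun m => (hvm m).const_add z₀, fun m s => hM ?_, ?_, hN, ?_⟩
  · rw [mem_ball_iff_norm, add_sub_cancel_left]
    exact mem_ball_zero_iff.1 (hvb m s)
  · refine tendsto_of_tendsto_of_tendsto_of_le_of_le hmin tendsto_const_nhds
      (fun m => measure_mono fun s hs => ?_) fun m => prob_le_one
    have hs' : IsLocalMin (fun x => ∑ i ∈ Finset.range m, diastasis Ω (z₀ + x) (Z i s)) (v m s) := hs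
    have ht : Tendsto (fun z => z - z₀) (𝓝 (z₀ + v m s)) (𝓝 (v m s)) := by
      have h : Tendsto (fun z => z - z₀) (𝓝 (z₀ + v m s)) (𝓝 (z₀ + v m s - z₀)) :=
        (continuous_id.sub continuous_const).tendsto _
      rwa [add_sub_cancel_left] at h
    have h2 : IsLocalMin (fun z => ∑ i ∈ Finset.range m, diastasis Ω z (Z i s)) (z₀ + v m s) := by
      filter_upwards [ht.eventually hs'] with z hz
      simpa using hz
    exact h2.on Ω
  · simpa only [add_sub_cancel_left] using hdist
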